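/- Conventions. Simplicial sets are small, and a simplicial category has small simplicial sets as hom-spaces $\mathrm{Map}(X,Y)$. For a small simplicial category $\mathcal A$ and a simplicial category $\mathcal C$, $\mathcal C^{\mathcal A}$ is the simplicial category of simplicial functors $\mathcal A\to\mathcal C$, whose hom-spaces are the simplicial sets of simplicial natural transformations. A *weight* on $\mathcal A$ is a simplicial functor $W\colon\mathcal A\to\mathbf{SSet}$. A *$W$-cone* over $F\colon\mathcal A\to\mathcal C$ with summit $L$ is a simplicial natural transformation $\Lambda\colon W\to\mathrm{Map}_{\mathcal C}(L,F-)$; it displays $L$ as the *weighted limit* $\{W,F\}$ if, for every $X\in\mathcal C$, the map $\mathrm{Map}_{\mathcal C}(X,L)\to\mathrm{Map}_{\mathbf{SSet}^{\mathcal A}}(W,\mathrm{Map}_{\mathcal C}(X,F-))$ given by composition with $\Lambda$ is an isomorphism of simplicial sets. A *projective cell* is a map $\partial\Delta^n\times\mathrm{Map}_{\mathcal A}(A,-)\hookrightarrow\Delta^n\times\mathrm{Map}_{\mathcal A}(A,-)$ with $n\ge 0$ and $A\in\mathcal A$. A monomorphism of weights is a *projective cell complex* if it is a countable composite of pushouts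 of small coproducts of projective cells. A weight $W$ is *flexible* if $\emptyset\hookrightarrow W$ is a projective cell complex; $\mathrm{Flex}^{\mathcal A}\subset\mathbf{SSet}^{\mathcal A}$ is the full simplicial subcategory of flexible weights. An *$\infty$-cosmos* is a simplicial category $\mathcal K$ whose hom-spaces are quasi-categories, with a specified subcategory of *isofibrations*, such that: (a) $\mathcal K$ has, in the simplicially enriched sense, a terminal object $1$, small products, cotensors by all simplicial sets, limits of countable towers of isofibrations, and pullbacks of isofibrations along all maps; (b) isofibrations contain all isomorphisms and all maps to $1$; they are stable under pullback along all maps, and closed under small products and limits of countable towers (the maps from the limit of a countable tower of isofibrations to its stages are isofibrations); for every isofibration $p\colon E\to B$ and every monomorphism $U\hookrightarrow V$ of simplicial sets, the map $E^V\to E^U\times_{B^U}B^V$ is an isofibration; and for every isofibration $p\colon E\to B$ and every $X$, $\mathrm{Map}(X,E)\to\mathrm{Map}(X,B)$ is an isofibration of quasi-categories (an inner fibration with the right lifting property against both endpoint inclusions $\mathbb 1\hookrightarrow\mathbb I$ into the nerve of the free-living isomorphism). A map $f$ of $\mathcal K$ is an *equivalence* if $\mathrm{Map}(X,f)$ is an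 equivalence of quasi-categories for every $X$ (it has an inverse up to homotopies parametrised by $\mathbb I$), and a *trivial fibration* if it is both an equivalence and an isofibration. **Proposition.** Let $\mathcal K$ be an $\infty$-cosmos and let $\mathcal A$ be a small simplicial category. (i) For any diagram $F\colon\mathcal A\to\mathcal K$ and any flexible weight $W\colon\mathcal A\to\mathbf{SSet}$, the weighted limit $\{W,F\}$ exists in $\mathcal K$. (ii) For any diagram $F\colon\mathcal A\to\mathcal K$, flexible weights $W,W'\colon\mathcal A\to\mathbf{SSet}$ and projective cell complex $i\colon W\hookrightarrow W'$, the map $\{i,F\}\colon\{W',F\}\to\{W,F\}$, defined uniquely by compatibility with the limit cones, is an isofibration. Moreover, any choice of these limits and limit cones extends to a simplicial bifunctor $$\{-,-\}_{\mathcal A}\colon(\mathrm{Flex}^{\mathcal A})^{\mathrm{op}}\times\mathcal K^{\mathcal A}\to\mathcal K$$ for which the limit cones are simplicially natural in the weight and the diagram, and which carries projective cell complexes to isofibrations. (iii) If $\kappa\colon F\Rightarrow G$ is a simplicial natural transformation between diagrams $\mathcal A\to\mathcal K$ whose components are all equivalences, all isofibrations, or all trivial fibrations in $\mathcal K$, and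 $W$ is a flexible weight, then the map $\{W,\kappa\}\colon\{W,F\}\to\{W,G\}$, defined uniquely by compatibility with the limit cones, is an equivalence, isofibration, or trivial fibration (respectively) in $\mathcal K$. -/

import Mathlib

open CategoryTheory MonoidalCategory Opposite Simplicial Limits

universe v u u₁ u₂ u₃

noncomputable section

namespace InfCosmos

section Simplices

variable {C : Type u} [EnrichedCategory SSet.{v} C]

/-- The simplicial hom-space of a simplicially enriched category. -/
abbrev Map (X Y : C) : SSet.{v} := X ⟶[SSet.{v}] Y

/-- A spair of `n`-simplices as an `n`-simplex of the product. -/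
abbrev spair {X Y : SSet.{v}} {n : SimplexCategoryᵒᵖ} (x : X.obj n) (y : Y.obj n) :
    (X ⊗ Y).obj n := (show X.obj n × Y.obj n from (x, y))

/-- Composition of `n`-simplices, in diagrammatic order. -/
def scomp {X Y Z : C} {n : SimplexCategoryᵒᵖ} (f : (Map X Y).obj n) (g : (Map Y Z).obj n) :
    (Map X Z).obj n :=
  (eComp SSet.{v} X Y Z).app n (spair f g)

/-- The `n`-simplex degenerate on the identity. -/
def sid (X : C) (n : SimplexCategoryᵒᵖ) : (Map X X).obj n :=
  (eId SSet.{v} X).app n PUnit.unit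

lemma map_scomp {X Y Z : C} {n m : SimplexCategoryᵒᵖ} (θ : n ⟶ m)
    (f : (Map X Y).obj n) (g : (Map Y Z).obj n) :
    (Map X Z).map θ (scomp f g) = scomp ((Map X Y).map θ f) ((Map Y Z).map θ g) :=
  (NatTrans.naturality_apply (eComp SSet.{v} X Y Z) θ
    (spair (X := Map X Y) (Y := Map Y Z) f g)).symm

lemma map_sid (X : C) {n m : SimplexCategoryᵒᵖ} (θ : n ⟶ m) :
    (Map X X).map θ (sid X n) = sid X m :=
  (NatTrans.naturality_apply (eId SSet.{v} X) θ PUnit.unit).symm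

lemma sid_scomp {X Y : C} {n : SimplexCategoryᵒᵖ} (f : (Map X Y).obj n) :
    scomp (sid X n) f = f :=
  ConcreteCategory.congr_hom (NatTrans.congr_app (e_id_comp SSet.{v} X Y) n) f

lemma scomp_sid {X Y : C} {n : SimplexCategoryᵒᵖ} (f : (Map X Y).obj n) :
    scomp f (sid Y n) = f :=
  ConcreteCategory.congr_hom (NatTrans.congr_app (e_comp_id SSet.{v} X Y) n) f

lemma scomp_assoc {W X Y Z : C} {n : SimplexCategoryᵒᵖ} (f : (Map W X).obj n)
    (g : (Map X Y).obj n) (h : (Map Y Z).obj n) :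
    scomp (scomp f g) h = scomp f (scomp g h) :=
  ConcreteCategory.congr_hom (NatTrans.congr_app (e_assoc SSet.{v} W X Y Z) n)
    (spair (X := Map W X) (Y := Map X Y ⊗ Map Y Z) f (spair g h))

end Simplices

section Functors

variable {C : Type u₁} {D : Type u₂} [EnrichedCategory SSet.{v} C] [EnrichedCategory SSet.{v} D]

lemma map_app_scomp (F : EnrichedFunctor SSet.{v} C D) {X Y Z : C} {n : SimplexCategoryᵒᵖ}
    (f : (Map X Y).obj n) (g : (Map Y Z).obj n) :
    (F.map X Z).app n (scomp f g) = scomp ((F.map X Y).app n f) ((F.map Y Z).app n g) :=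
  ConcreteCategory.congr_hom (NatTrans.congr_app (F.map_comp X Y Z) n)
    (spair (X := Map X Y) (Y := Map Y Z) f g)

lemma map_app_sid (F : EnrichedFunctor SSet.{v} C D) (X : C) (n : SimplexCategoryᵒᵖ) :
    (F.map X X).app n (sid X n) = sid (F.obj X) n :=
  ConcreteCategory.congr_hom (NatTrans.congr_app (F.map_id X) n) PUnit.unit

lemma map_app_map (F : EnrichedFunctor SSet.{v} C D) {X Y : C} {n m : SimplexCategoryᵒᵖ}
    (θ : n ⟶ m) (f : (Map X Y).obj n) :
    (F.map X Y).app m ((Map X Y).map θ f) = (Map (F.obj X) (F.obj Y)).map θ ((F.map X Y).app n f) :=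
  NatTrans.naturality_apply (F.map X Y) θ f

end Functors

/-! ### The simplicial category of simplicial functors -/

section FunctorCategory

variable {A : Type v} {D : Type u} {E : Type u₂} [EnrichedCategory SSet.{v} A]
  [EnrichedCategory SSet.{v} D] [EnrichedCategory SSet.{v} E]

variable (A D) in
/-- Simplicial functors `A → D`, with `A` a small simplicial category. -/
structure SFun extends EnrichedFunctor SSet.{v} A D

/-- An `n`-simplex of the simplicial set of simplicial natural transformations from `F` to `G`,
i.e. of the end of the simplicial sets `Map (F a) (G a)`. -/
@[ext]
structure SNat (F G : SFun A D) (n : SimplexCategoryᵒᵖ) where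
  app (a : A) : (Map (F.obj a) (G.obj a)).obj n
  naturality {a b : A} {m : SimplexCategoryᵒᵖ} (θ : n ⟶ m) (x : (Map a b).obj m) :
    scomp ((F.map a b).app m x) ((Map _ _).map θ (app b)) =
      scomp ((Map _ _).map θ (app a)) ((G.map a b).app m x)

/-- The simplicial set of simplicial natural transformations. -/
def natObj (F G : SFun A D) : SSet.{v} where
  obj n := SNat F G n
  map {n m} θ := ↾fun σ ↦
    { app a := (Map _ _).map θ (σ.app a)
      naturality θ' x := by
        have := σ.naturality (θ ≫ θ') x
        simpa only [Functor.map_comp_apply] using this }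
  map_id n := by
    ext σ : 3
    refine SNat.ext (funext fun a ↦ ?_)
    simp
  map_comp θ θ' := by
    ext σ : 3
    refine SNat.ext (funext fun a ↦ ?_)
    simp

instance : EnrichedCategory SSet.{v} (SFun A D) where
  Hom := natObj
  id F :=
    { app n := ↾fun _ ↦
        { app a := sid (F.obj a) n
          naturality θ x := by rw [map_sid, map_sid, scomp_sid, sid_scomp] }
      naturality n m θ := by
        ext _
        exact SNat.ext (funext fun a ↦ (map_sid _ θ).symm) }
  comp F G H :=
    { app n := ↾fun p ↦
        { app a := scomp (p.1.app a) (p.2.app a)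
          naturality θ x := by
            rw [map_scomp, map_scomp, ← scomp_assoc, p.1.naturality, scomp_assoc, p.2.naturality,
              scomp_assoc] }
      naturality n m θ := by
        ext p
        exact SNat.ext (funext fun a ↦ (map_scomp θ _ _).symm) }
  id_comp F G := by
    ext n σ
    exact SNat.ext (funext fun a ↦ sid_scomp _)
  comp_id F G := by
    ext n σ
    exact SNat.ext (funext fun a ↦ scomp_sid _)
  assoc F G H K := by
    ext n σ
    exact SNat.ext (funext fun a ↦ scomp_assoc _ _ _)

/-- The underlying category of the simplicial functor category: morphisms are the `0`-simplices
of the hom-spaces, i.e. the simplicial natural transformations. -/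
instance : Category.{v} (SFun A D) where
  Hom F G := SNat F G (op ⦋0⦌)
  id F := (sid F (op ⦋0⦌) : (Map F F).obj _)
  comp {F G H} σ τ := scomp (X := F) (Y := G) (Z := H) σ τ
  id_comp {F G} σ := sid_scomp (X := F) (Y := G) σ
  comp_id {F G} σ := scomp_sid (X := F) (Y := G) σ
  assoc {F G H K} σ τ υ := scomp_assoc (W := F) (X := G) (Y := H) (Z := K) σ τ υ

instance : SimplicialCategory (SFun A D) where
  homEquiv {F G} := (SSet.unitHomEquiv (Map F G)).symm
  homEquiv_id F := (Equiv.symm_apply_eq _).2 rfl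
  homEquiv_comp {F G H} σ τ := by
    refine (Equiv.symm_apply_eq _).2 ?_
    exact congrArg₂ (fun s t ↦ scomp (X := F) (Y := G) (Z := H) s t)
      ((SSet.unitHomEquiv (Map F G)).apply_symm_apply σ).symm
      ((SSet.unitHomEquiv (Map G H)).apply_symm_apply τ).symm

end FunctorCategory

section UnderlyingMaps

variable {C : Type u} [Category.{v} C] [SimplicialCategory C]

/-- The `n`-simplex degenerate on a morphism of the underlying category. -/
def simplex {X Y : C} (f : X ⟶ Y) (n : SimplexCategoryᵒᵖ) : (Map X Y).obj n :=
  (eHomEquiv SSet.{v} f).app n PUnit.unit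

end UnderlyingMaps

/-! ### Constructions of simplicial functors -/

section Constructions

/-- A simplicial functor `C → SSet`, given by simplicial sets `W a` and actions
`W a × Map a b → W b` of the hom-spaces. -/
def ofAction {C : Type u} [EnrichedCategory SSet.{v} C] (W : C → SSet.{v})
    (act : ∀ {a b : C} {n : SimplexCategoryᵒᵖ}, (W a).obj n → (Map a b).obj n → (W b).obj n)
    (act_map : ∀ {a b : C} {n m : SimplexCategoryᵒᵖ} (θ : n ⟶ m) (w : (W a).obj n)
      (x : (Map a b).obj n),
      (W b).map θ (act w x) = act ((W a).map θ w) ((Map a b).map θ x))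
    (act_one : ∀ {a : C} {n : SimplexCategoryᵒᵖ} (w : (W a).obj n), act w (sid a n) = w)
    (act_comp : ∀ {a b c : C} {n : SimplexCategoryᵒᵖ} (w : (W a).obj n) (x : (Map a b).obj n)
      (y : (Map b c).obj n), act w (scomp x y) = act (act w x) y) :
    EnrichedFunctor SSet.{v} C SSet.{v} where
  obj := W
  map a b :=
    { app n := ↾fun x ↦
        ({ app m (θ : n ⟶ m) := ↾fun w ↦ act w ((Map a b).map θ x)
           naturality {m m'} φ (θ : n ⟶ m) := by
             ext w
             change act ((W a).map φ w) ((Map a b).map (θ ≫ φ) x) =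
               (W b).map φ (act w ((Map a b).map θ x))
             rw [act_map, Functor.map_comp_apply] } :
          (W a).HomObj (W b) (coyoneda.obj (op n)))
      naturality n m φ := by
        ext x
        refine Functor.functorHom_ext fun m' θ ↦ ?_
        ext w
        change act w ((Map a b).map θ ((Map a b).map φ x)) = act w ((Map a b).map (φ ≫ θ) x)
        rw [Functor.map_comp_apply] }
  map_id a := by
    ext n x
    refine Functor.functorHom_ext fun m θ ↦ ?_
    ext w
    change act w ((Map a a).map θ (sid a n)) = w
    rw [map_sid, act_one]
  map_comp a b c := by
    ext n p
    refine Functor.functorHom_ext fun m θ ↦ ?_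
    ext w
    change act w ((Map a c).map θ (scomp p.1 p.2)) =
      act (act w ((Map a b).map θ p.1)) ((Map b c).map θ p.2)
    rw [map_scomp, act_comp]

/-- The representable simplicial functor `Map X -`. -/
def corep {C : Type u} [EnrichedCategory SSet.{v} C] (X : C) :
    EnrichedFunctor SSet.{v} C SSet.{v} :=
  ofAction (fun Y ↦ Map X Y) scomp map_scomp scomp_sid (fun w x y ↦ (scomp_assoc w x y).symm)

/-- Precomposition `Map X L → [Map L Y, Map X Y]`. -/
def precomp {C : Type u} [EnrichedCategory SSet.{v} C] (X L Y : C) :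
    Map X L ⟶ Map (Map L Y) (Map X Y) where
  app n := ↾fun x ↦
    ({ app m (θ : n ⟶ m) := ↾fun g ↦ scomp ((Map X L).map θ x) g
       naturality {m m'} φ (θ : n ⟶ m) := by
         ext g
         change scomp ((Map X L).map (θ ≫ φ) x) ((Map L Y).map φ g) =
           (Map X Y).map φ (scomp ((Map X L).map θ x) g)
         rw [map_scomp, Functor.map_comp_apply] } :
      (Map L Y).HomObj (Map X Y) (coyoneda.obj (op n)))
  naturality n m φ := by
    ext x
    refine Functor.functorHom_ext fun m' θ ↦ ?_
    ext g
    change scomp ((Map X L).map θ ((Map X L).map φ x)) g = scomp ((Map X L).map (φ ≫ θ) x) g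
    rw [Functor.map_comp_apply]

variable {A : Type v} [EnrichedCategory SSet.{v} A]

variable (A) in
/-- Weights on the small simplicial category `A`. -/
abbrev Weight := SFun A SSet.{v}

/-- A morphism of weights given by action-preserving maps of simplicial sets. -/
def weightHom {W W' : Weight A} (f : ∀ a : A, W.obj a ⟶ W'.obj a)
    (hf : ∀ {a b : A} {n m : SimplexCategoryᵒᵖ} (x : (Map a b).obj n) (θ : n ⟶ m)
      (w : (W.obj a).obj m),
      (f b).app m ((((W.map a b).app n x : (W.obj a).HomObj (W.obj b) (coyoneda.obj (op n))).app
        m θ) w) =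
      ((((W'.map a b).app n x : (W'.obj a).HomObj (W'.obj b) (coyoneda.obj (op n))).app
        m θ) ((f a).app m w))) : W ⟶ W' :=
  (show SNat W W' (op ⦋0⦌) from
  { app a := simplex (f a) (op ⦋0⦌)
    naturality {a b n} θ x := by
      refine Functor.functorHom_ext fun m φ ↦ ?_
      ext w
      exact hf x φ w })

/-- The weight `U × Map a -`. -/
def tensorRep (U : SSet.{v}) (a : A) : Weight A :=
  ⟨ofAction (fun b ↦ U ⊗ Map a b) (fun p x ↦ spair p.1 (scomp p.2 x))
    (fun θ p x ↦ congrArg (spair (U.map θ p.1)) (map_scomp θ p.2 x))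
    (fun p ↦ congrArg (spair p.1) (scomp_sid p.2))
    (fun p x y ↦ congrArg (spair p.1) (scomp_assoc p.2 x y).symm)⟩

/-- The map of weights `U × Map a - → V × Map a -` induced by `f : U → V`. -/
def tensorRepMap {U V : SSet.{v}} (f : U ⟶ V) (a : A) : tensorRep U a ⟶ tensorRep V a :=
  weightHom (W := tensorRep U a) (W' := tensorRep V a) (fun b ↦ f ▷ Map a b)
    (fun _ _ _ ↦ rfl)

/-- The class of projective cells `∂Δⁿ × Map a - → Δⁿ × Map a -`. -/
inductive projectiveCells : MorphismProperty (Weight A) where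
  | mk (n : ℕ) (a : A) : projectiveCells (tensorRepMap (SSet.boundary.{v} n).ι a)

/-- Projective cell complexes: monomorphisms that are countable composites of pushouts of
(small) coproducts of projective cells. -/
def IsProjectiveCellComplex {V W : Weight A} (i : V ⟶ W) : Prop :=
  Mono i ∧ ((MorphismProperty.coproducts.{v} (projectiveCells (A := A))).pushouts).transfiniteCompositionsOfShape ℕ i

/-- A weight is flexible if the map to it from the empty weight is a projective cell complex. -/
def IsFlexible (W : Weight A) : Prop :=
  ∃ (V : Weight A) (i : V ⟶ W), (∀ a n, IsEmpty ((V.obj a).obj n)) ∧ IsProjectiveCellComplex i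

variable (A) in
/-- The full simplicial subcategory of flexible weights. -/
abbrev Flex := ObjectProperty.FullSubcategory (C := Weight A) IsFlexible

end Constructions

/-! ### Weighted limits -/

section WeightedLimits

variable {A : Type v} [EnrichedCategory SSet.{v} A]
  {K : Type u} [Category.{v} K] [SimplicialCategory K]

/-- The simplicial functor `Map L (F -)`. A `W`-cone over `F` with summit `L` is a morphism of
weights `W ⟶ homInto F L`. -/
def homInto (F : SFun A K) (L : K) : Weight A :=
  ⟨F.toEnrichedFunctor.comp SSet.{v} (corep L)⟩

/-- The map `Map X L → Map (Map L (F -), Map X (F -))` given by precomposition. -/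
def homIntoPre (F : SFun A K) (X L : K) : Map X L ⟶ Map (homInto F L) (homInto F X) where
  app n := ↾fun x ↦
    (show SNat (homInto F L) (homInto F X) n from
    { app a := (precomp X L (F.obj a)).app n x
      naturality {a b m} θ y := by
        refine Functor.functorHom_ext fun m' φ ↦ ?_
        ext g
        exact (scomp_assoc ((Map X L).map (θ ≫ φ) x) g
          ((Map _ _).map φ ((F.map a b).app m y))).symm })
  naturality n m θ := by
    ext x
    exact SNat.ext (funext fun a ↦ NatTrans.naturality_apply (precomp X L (F.obj a)) θ x)

/-- The map `Map F G → Map (Map L (F -), Map L (G -))` given by postcomposition. -/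
def homIntoPost (F G : SFun A K) (L : K) : Map F G ⟶ Map (homInto F L) (homInto G L) where
  app n := ↾fun κ ↦
    (show SNat (homInto F L) (homInto G L) n from
    { app a := ((corep L).map (F.obj a) (G.obj a)).app n (SNat.app κ a)
      naturality {a b m} θ y := by
        have h := congrArg (((corep L).map (F.obj a) (G.obj b)).app m) (SNat.naturality κ θ y)
        rw [map_app_scomp, map_app_scomp, map_app_map, map_app_map] at h
        exact h })
  naturality n m θ := by
    ext κ
    exact SNat.ext (funext fun a ↦ map_app_map (corep L) θ _)

/-- The map `Map L (F -) ⟶ Map X (F -)` of weights induced by `f : X ⟶ L`. -/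
def homIntoPreMap (F : SFun A K) {X L : K} (f : X ⟶ L) : homInto F L ⟶ homInto F X :=
  (homIntoPre F X L).app (op ⦋0⦌) (simplex f (op ⦋0⦌))

/-- The map `Map L (F -) ⟶ Map L (G -)` of weights induced by `κ : F ⟶ G`. -/
def homIntoPostMap {F G : SFun A K} (κ : F ⟶ G) (L : K) : homInto F L ⟶ homInto G L :=
  (homIntoPost F G L).app (op ⦋0⦌) (simplex κ (op ⦋0⦌))

/-- The comparison map `Map X L → Map (W, Map X (F -))` given by a `W`-cone `Λ` with summit `L`. -/
def comparison {W : Weight A} {F : SFun A K} {L : K} (Λ : W ⟶ homInto F L) (X : K) :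
    Map X L ⟶ Map W (homInto F X) :=
  homIntoPre F X L ≫ eHomWhiskerRight SSet.{v} Λ (homInto F X)

/-- The `W`-cone `Λ` displays `L` as a `W`-weighted limit of `F`. -/
def IsWeightedLimit {W : Weight A} {F : SFun A K} {L : K} (Λ : W ⟶ homInto F L) : Prop :=
  ∀ X : K, IsIso (comparison Λ X)

/-- For limit cones `Λ` and `Λ'` of `F` weighted by `W` and `W'`, the map `f` between the limit
objects is the one induced by `i : W ⟶ W'`. -/
def IsInducedByWeight {W W' : Weight A} {F : SFun A K} {L L' : K} (Λ : W ⟶ homInto F L)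
    (Λ' : W' ⟶ homInto F L') (i : W ⟶ W') (f : L' ⟶ L) : Prop :=
  Λ ≫ homIntoPreMap F f = i ≫ Λ'

/-- For limit cones `Λ` and `Γ` of `F` and `G` weighted by `W`, the map `f` between the limit
objects is the one induced by `κ : F ⟶ G`. -/
def IsInducedByDiagram {W : Weight A} {F G : SFun A K} {L M : K} (Λ : W ⟶ homInto F L)
    (Γ : W ⟶ homInto G M) (κ : F ⟶ G) (f : L ⟶ M) : Prop :=
  Γ ≫ homIntoPreMap G f = Λ ≫ homIntoPostMap κ L

/-- The component at `a` of a simplicial natural transformation. -/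
def component {F G : SFun A K} (κ : F ⟶ G) (a : A) : F.obj a ⟶ G.obj a :=
  (SimplicialCategory.homEquiv' _ _).symm (SNat.app κ a)

end WeightedLimits

/-! ### Simplicial bifunctors -/

/-- The product of two simplicial categories. -/
instance {C : Type u₁} {D : Type u₂} [EnrichedCategory SSet.{v} C] [EnrichedCategory SSet.{v} D] :
    EnrichedCategory SSet.{v} (C × D) where
  Hom X Y := Map X.1 Y.1 ⊗ Map X.2 Y.2
  id X := { app n := ↾fun _ ↦ spair (sid X.1 n) (sid X.2 n)
            naturality n m θ := by
              ext _
              exact congrArg₂ spair (map_sid _ θ).symm (map_sid _ θ).symm }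
  comp X Y Z := { app n := ↾fun p ↦ spair (scomp p.1.1 p.2.1) (scomp p.1.2 p.2.2)
                  naturality n m θ := by
                    ext p
                    exact congrArg₂ spair (map_scomp θ _ _).symm (map_scomp θ _ _).symm }
  id_comp X Y := by
    ext n p
    · exact sid_scomp _
    · exact sid_scomp _
  comp_id X Y := by
    ext n p
    · exact scomp_sid _
    · exact scomp_sid _
  assoc X Y Z T := by
    ext n p
    · exact scomp_assoc _ _ _
    · exact scomp_assoc _ _ _

section Bifunctors

variable {A : Type v} [EnrichedCategory SSet.{v} A]
  {K : Type u} [Category.{v} K] [SimplicialCategory K]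

/-- Simplicial naturality, in the weight and in the diagram, of a family of cones
`W ⟶ Map (P (W, F)) (F -)` over a simplicial bifunctor `P`. -/
def IsNaturalCones (P : EnrichedFunctor SSet.{v} ((Flex A)ᵒᵖ × SFun A K) K)
    (Λ : ∀ x : (Flex A)ᵒᵖ × SFun A K, x.1.unop.obj ⟶ homInto x.2 (P.obj x)) : Prop :=
  ∀ (x y : (Flex A)ᵒᵖ × SFun A K) (n : SimplexCategoryᵒᵖ)
    (w : (Map y.1.unop.obj x.1.unop.obj).obj n) (κ : (Map x.2 y.2).obj n),
    scomp (simplex (Λ y) n)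
        ((homIntoPre y.2 (P.obj x) (P.obj y)).app n
          ((P.map x y).app n (spair (X := Map x.1 y.1) w κ))) =
      scomp (scomp w (simplex (Λ x) n)) ((homIntoPost x.2 y.2 (P.obj x)).app n κ)

/-- The simplicial bifunctor `P` extends the choice of limit objects `L` with limit cones `Λ`. -/
def ExtendsLimits (L : (Flex A)ᵒᵖ × SFun A K → K)
    (Λ : ∀ x : (Flex A)ᵒᵖ × SFun A K, x.1.unop.obj ⟶ homInto x.2 (L x))
    (P : EnrichedFunctor SSet.{v} ((Flex A)ᵒᵖ × SFun A K) K) : Prop :=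
  ∃ h : ∀ x, L x = P.obj x, IsNaturalCones P (fun x ↦ Λ x ≫ eqToHom (by rw [h x]))

/-- The map `P (W', F) ⟶ P (W, F)` given by the action of a bifunctor on `i : W ⟶ W'`. -/
def bifunctorMapWeight (P : EnrichedFunctor SSet.{v} ((Flex A)ᵒᵖ × SFun A K) K) {W W' : Flex A}
    (i : W.obj ⟶ W'.obj) (F : SFun A K) : P.obj (op W', F) ⟶ P.obj (op W, F) :=
  (SimplicialCategory.homEquiv' _ _).symm
    ((P.map (op W', F) (op W, F)).app (op ⦋0⦌)
      (spair (X := Map (op W') (op W)) (simplex i (op ⦋0⦌)) (sid F (op ⦋0⦌))))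

end Bifunctors

/-! ### Quasi-categories and `∞`-cosmoi -/

section QuasiCategories

/-- Isofibrations of quasi-categories: inner fibrations with the right lifting property against
the inclusion of either endpoint into the free-living isomorphism. -/
def IsQCatIsofibration {X Y : SSet.{v}} (p : X ⟶ Y) : Prop :=
  SSet.InnerFibration p ∧
    HasLiftingProperty
      (SSet.const SSet.coherentIso.x₀ : (Δ[0] : SSet.{v}) ⟶ SSet.coherentIso.{v}) p ∧
    HasLiftingProperty
      (SSet.const SSet.coherentIso.x₁ : (Δ[0] : SSet.{v}) ⟶ SSet.coherentIso.{v}) p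

/-- A homotopy from `f` to `g` parametrised by the free-living isomorphism. -/
def IsoHomotopic {X Y : SSet.{v}} (f g : X ⟶ Y) : Prop :=
  ∃ H : X ⊗ SSet.coherentIso.{v} ⟶ Y,
    CartesianMonoidalCategory.lift (𝟙 X) (SSet.const SSet.coherentIso.x₀) ≫ H = f ∧
    CartesianMonoidalCategory.lift (𝟙 X) (SSet.const SSet.coherentIso.x₁) ≫ H = g

/-- Equivalences of quasi-categories. -/
def IsQCatEquivalence {X Y : SSet.{v}} (f : X ⟶ Y) : Prop :=
  ∃ g : Y ⟶ X, IsoHomotopic (𝟙 X) (f ≫ g) ∧ IsoHomotopic (g ≫ f) (𝟙 Y)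

end QuasiCategories

section Cosmos

variable {K : Type u} [Category.{v} K] [SimplicialCategory K]

/-- The map `κ : U ⟶ Map P B` displays `P` as the cotensor of `B` by the simplicial set `U`. -/
def IsCotensor (U : SSet.{v}) (B : K) {P : K} (κ : U ⟶ Map P B) : Prop :=
  ∀ X : K, IsIso (precomp X P B ≫ eHomWhiskerRight SSet.{v} κ (Map X B) :
    Map X P ⟶ Map U (Map X B))

/-- For cotensors `κ` of `B` by `U` and `κ'` of `B` by `V`, `f` is the map `B ^ V ⟶ B ^ U`
induced by `i : U ⟶ V`. -/
def IsCotensorMapLeft {U V : SSet.{v}} {B P P' : K} (κ : U ⟶ Map P B) (κ' : V ⟶ Map P' B)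
    (i : U ⟶ V) (f : P' ⟶ P) : Prop :=
  κ ≫ eHomWhiskerRight SSet.{v} f B = i ≫ κ'

/-- For cotensors `κ` of `E` and `κ'` of `B` by `U`, `f` is the map `E ^ U ⟶ B ^ U`
induced by `p : E ⟶ B`. -/
def IsCotensorMapRight {U : SSet.{v}} {E B P P' : K} (κ : U ⟶ Map P E) (κ' : U ⟶ Map P' B)
    (p : E ⟶ B) (f : P ⟶ P') : Prop :=
  κ' ≫ eHomWhiskerRight SSet.{v} f B = κ ≫ eHomWhiskerLeft SSet.{v} P p

open Enriched in
variable (K) in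
/-- An `∞`-cosmos structure on a simplicial category `K`. -/
structure InfinityCosmos where
  /-- The hom-spaces are quasi-categories. -/
  quasicategory (X Y : K) : SSet.Quasicategory (Map X Y)
  /-- The class of isofibrations. -/
  isofibration : MorphismProperty K
  isofibration_comp {X Y Z : K} (f : X ⟶ Y) (g : Y ⟶ Z) :
    isofibration f → isofibration g → isofibration (f ≫ g)
  /-- Completeness: terminal object, small products, cotensors, limits of countable towers of
  isofibrations, pullbacks of isofibrations; all in the simplicially enriched sense. -/
  hasTerminal : HasConicalTerminal SSet.{v} K
  hasProducts : HasConicalProducts.{v} SSet.{v} K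
  hasCotensors (U : SSet.{v}) (B : K) : ∃ (P : K) (κ : U ⟶ Map P B), IsCotensor U B κ
  hasTowers (F : ℕᵒᵖ ⥤ K)
    (hF : ∀ n : ℕ, isofibration (F.map (homOfLE (Nat.le_succ n)).op)) :
    HasConicalLimit SSet.{v} F
  hasPullbacks {E B X : K} (p : E ⟶ B) (f : X ⟶ B) (hp : isofibration p) :
    HasConicalPullback SSet.{v} p f
  isofibration_of_isIso {X Y : K} (f : X ⟶ Y) [IsIso f] : isofibration f
  isofibration_of_isTerminal {X T : K} (hT : IsTerminal T) (f : X ⟶ T) : isofibration f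
  isofibration_of_isPullback {E' E B' B : K} {g : E' ⟶ E} {q : E' ⟶ B'} {p : E ⟶ B} {f : B' ⟶ B}
    (h : IsPullback g q p f) : isofibration p → isofibration q
  isofibration_product {J : Type v} {X Y : J → K} (p : ∀ j, X j ⟶ Y j)
    (hp : ∀ j, isofibration (p j)) {c : Fan X} (hc : IsLimit c) {d : Fan Y} (hd : IsLimit d)
    (q : c.pt ⟶ d.pt) (hq : ∀ j, q ≫ d.proj j = c.proj j ≫ p j) : isofibration q
  isofibration_tower (F : ℕᵒᵖ ⥤ K)
    (hF : ∀ n : ℕ, isofibration (F.map (homOfLE (Nat.le_succ n)).op))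
    {c : Cone F} (hc : IsLimit c) (n : ℕ) : isofibration (c.π.app (op n))
  /-- The Leibniz cotensor `E ^ V ⟶ E ^ U ×_{B ^ U} B ^ V` of a monomorphism `i : U ⟶ V` and an
  isofibration `p : E ⟶ B` is an isofibration. -/
  isofibration_leibniz {U V : SSet.{v}} (i : U ⟶ V) [Mono i] {E B : K} (p : E ⟶ B)
    (hp : isofibration p)
    {EV EU BV BU : K} {κEV : V ⟶ Map EV E} {κEU : U ⟶ Map EU E}
    {κBV : V ⟶ Map BV B} {κBU : U ⟶ Map BU B}
    (hEV : IsCotensor V E κEV) (hEU : IsCotensor U E κEU)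
    (hBV : IsCotensor V B κBV) (hBU : IsCotensor U B κBU)
    {iE : EV ⟶ EU} {iB : BV ⟶ BU} {pV : EV ⟶ BV} {pU : EU ⟶ BU}
    (hiE : IsCotensorMapLeft κEU κEV i iE) (hiB : IsCotensorMapLeft κBU κBV i iB)
    (hpV : IsCotensorMapRight κEV κBV p pV) (hpU : IsCotensorMapRight κEU κBU p pU)
    {Q : K} {fst : Q ⟶ EU} {snd : Q ⟶ BV} (hQ : IsPullback fst snd pU iB)
    (l : EV ⟶ Q) (hl₁ : l ≫ fst = iE) (hl₂ : l ≫ snd = pV) : isofibration l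
  isofibration_map (X : K) {E B : K} (p : E ⟶ B) (hp : isofibration p) :
    IsQCatIsofibration (eHomWhiskerLeft SSet.{v} X p)

/-- Equivalences in an `∞`-cosmos are defined representably. -/
def IsEquivalence {X Y : K} (f : X ⟶ Y) : Prop :=
  ∀ Z : K, IsQCatEquivalence (eHomWhiskerLeft SSet.{v} Z f)

/-- Trivial fibrations are the isofibrations that are equivalences. -/
def InfinityCosmos.trivialFibration (𝒦 : InfinityCosmos K) {X Y : K} (f : X ⟶ Y) : Prop :=
  𝒦.isofibration f ∧ IsEquivalence f

end Cosmos

end InfCosmos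

end

open CategoryTheory MonoidalCategory Opposite Simplicial Limits

noncomputable section

namespace InfCosmos

/-! ### Cell complexes and Leibniz maps -/

section CellComplexes

variable {E : Type u₁} [Category.{u₂} E] {P : Type u} [Category.{u₃} P]

/-! A weight `W` and a diagram `F` define a simplicial presheaf X ↦ Map(W, Map(X, F-)) on K
(`conePresheaf`), and a weighted limit is a representation of it
(`isWeightedLimit_iff_isIso_coneHom`). The argument therefore takes place in an ordinary functor
category, that of functors on `Plex K`. There the enriched Yoneda embedding is fully faithful and
preserves conical limits, and `conePresheaf F` turns colimits of weights into limits. A map of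
presheaves counts as an isofibration if it is isomorphic to the image of an isofibration of K.

For κ : F → G and i : V → W, consider the Leibniz map from the cones weighted by W over F to the
pullback of those weighted by V over F and W over G. If i is a projective cell, the corners are
represented by cotensors, and the Leibniz axiom says that the map is an isofibration
(`presheafIsofibration_leibniz_cell`). Coproducts, pushouts and countable composites of weights
become products, base changes and limits of towers of Leibniz maps, and isofibrations are stable
under these. Representability is carried along: one only pulls back to representable targets, and
the source of an isofibration of presheaves is representable. This induction is
`fib_leibniz_cellComplex`. With G terminal and V empty it gives existence of the limit; with G
terminal it shows that cell complexes induce isofibrations; with V empty it shows that pointwise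
isofibrations induce isofibrations. The bifunctor comes from the universal property, applied simplex
by simplex.

Equivalences are tested by Map(Z, -), which reduces the claim to Map(W, φ) for a pointwise
equivalence φ of weights with values Map(Z, F a). The same cell induction, run with trivial
fibrations of simplicial sets, shows that Map(W, -) takes pointwise trivial fibrations to trivial
fibrations (`rlp_map_of_isFlexible`). The mapping path space factors φ as a section of a trivial
fibration followed by a map that is a trivial fibration because φ is an equivalence
(`pathObj.rlp_proj`, `pathObj.rlp_target`). Map(W, -) preserves such a factorization, and any map
with one is an equivalence (`isQCatEquivalence_of_span`). The homotopy theory needed here rests only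
on the homotopy extension property of the spaces Map(X, E), which follows from isofibrations between
cotensors (`hasHomotopyExtension_map`). Trivial fibrations combine the two cases. -/

/-- A class of fibrations between objects of a category `P`, some of which are distinguished. -/
structure FibrationClass (P : Type u) [Category.{u₃} P] where
  fib : MorphismProperty P
  obj : ObjectProperty P
  respectsIso : fib.RespectsIso
  objIso : obj.IsClosedUnderIsomorphisms
  source {X Y : P} (f : X ⟶ Y) : fib f → obj X
  baseChange {E' E B' B : P} {g : E' ⟶ E} {q : E' ⟶ B'} {p : E ⟶ B} {f : B' ⟶ B}
    (h : IsPullback g q p f) : fib p → obj B' → fib q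
  product {J : Type v} {X Y : J → P} (p : ∀ j, X j ⟶ Y j)
    (hp : ∀ j, fib (p j)) {c : Fan X} (hc : IsLimit c) {d : Fan Y} (hd : IsLimit d)
    (q : c.pt ⟶ d.pt) (hq : ∀ j, q ≫ d.proj j = c.proj j ≫ p j) : fib q
  tower (F : ℕᵒᵖ ⥤ P) (h0 : obj (F.obj (op 0)))
    (hF : ∀ n : ℕ, fib (F.map (homOfLE (Nat.le_succ n)).op))
    {c : Cone F} (hc : IsLimit c) : fib (c.π.app (op 0))

section Lift

variable {D : Type*} [Category* D] {F : D ⥤ E} {c : Cocone F} (hc : IsColimit c)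
  (Φ : Eᵒᵖ ⥤ P) [PreservesLimit F.op Φ]

include hc

/-- A limit-preserving functor on the opposite category sends the colimit cocone to a limit cone;
compatible families stand in for cones over the opposite diagram. -/
lemma exists_lift_of_isColimit {T : P} (t : ∀ j, T ⟶ Φ.obj (op (F.obj j)))
    (ht : ∀ {j j'} (f : j ⟶ j'), t j' ≫ Φ.map (F.map f).op = t j) :
    ∃ s : T ⟶ Φ.obj (op c.pt), ∀ j, s ≫ Φ.map (c.ι.app j).op = t j :=
  ⟨(isLimitOfPreserves Φ hc.op).lift
    { pt := T
      π := { app j := t j.unop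
             naturality j j' f := by
               have := ht f.unop
               dsimp at this ⊢
               rw [Category.id_comp]
               exact this.symm } },
    fun j ↦ (isLimitOfPreserves Φ hc.op).fac _ (op j)⟩

lemma hom_ext_of_isColimit {T : P} {s t : T ⟶ Φ.obj (op c.pt)}
    (h : ∀ j, s ≫ Φ.map (c.ι.app j).op = t ≫ Φ.map (c.ι.app j).op) : s = t :=
  (isLimitOfPreserves Φ hc.op).hom_ext fun j ↦ h j.unop

end Lift

variable [HasPullbacks P] {Φ Γ : Eᵒᵖ ⥤ P} (k : Φ ⟶ Γ)

/-- The target of the Leibniz map of `i` and `k`. -/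
abbrev leibnizTarget {V W : E} (i : V ⟶ W) : P := pullback (k.app (op V)) (Γ.map i.op)

/-- The Leibniz map `Φ W ⟶ Φ V ×_{Γ V} Γ W`. -/
def leibniz {V W : E} (i : V ⟶ W) : Φ.obj (op W) ⟶ leibnizTarget k i :=
  pullback.lift (Φ.map i.op) (k.app (op W)) (k.naturality i.op)

@[simp]
lemma leibniz_fst {V W : E} (i : V ⟶ W) :
    leibniz k i ≫ pullback.fst _ _ = Φ.map i.op := pullback.lift_fst _ _ _

@[simp]
lemma leibniz_fst_assoc {V W : E} (i : V ⟶ W) {T : P} (t : Φ.obj (op V) ⟶ T) :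
    leibniz k i ≫ pullback.fst _ _ ≫ t = Φ.map i.op ≫ t := pullback.lift_fst_assoc _ _ _ _

@[simp]
lemma leibniz_snd {V W : E} (i : V ⟶ W) :
    leibniz k i ≫ pullback.snd _ _ = k.app (op W) := pullback.lift_snd _ _ _

@[simp]
lemma leibniz_snd_assoc {V W : E} (i : V ⟶ W) {T : P} (t : Γ.obj (op W) ⟶ T) :
    leibniz k i ≫ pullback.snd _ _ ≫ t = k.app (op W) ≫ t := pullback.lift_snd_assoc _ _ _ _

/-- The functoriality of the target of the Leibniz map. -/
def leibnizTargetMap {V W S S' : E} {i : V ⟶ W} {c : S ⟶ S'} (s : S ⟶ V) (t : S' ⟶ W)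
    (w : s ≫ i = c ≫ t) : leibnizTarget k i ⟶ leibnizTarget k c :=
  pullback.lift (pullback.fst _ _ ≫ Φ.map s.op) (pullback.snd _ _ ≫ Γ.map t.op) (by
    rw [Category.assoc, Category.assoc, k.naturality, pullback.condition_assoc, ← Γ.map_comp,
      ← Γ.map_comp, ← op_comp, ← op_comp, w])

@[simp]
lemma leibnizTargetMap_fst {V W S S' : E} {i : V ⟶ W} {c : S ⟶ S'} (s : S ⟶ V) (t : S' ⟶ W)
    (w : s ≫ i = c ≫ t) : leibnizTargetMap k s t w ≫ pullback.fst _ _ =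
      pullback.fst _ _ ≫ Φ.map s.op := pullback.lift_fst _ _ _

@[simp]
lemma leibnizTargetMap_snd {V W S S' : E} {i : V ⟶ W} {c : S ⟶ S'} (s : S ⟶ V) (t : S' ⟶ W)
    (w : s ≫ i = c ≫ t) : leibnizTargetMap k s t w ≫ pullback.snd _ _ =
      pullback.snd _ _ ≫ Γ.map t.op := pullback.lift_snd _ _ _

@[simp]
lemma leibnizTargetMap_fst_assoc {V W S S' : E} {i : V ⟶ W} {c : S ⟶ S'} (s : S ⟶ V) (t : S' ⟶ W)
    (w : s ≫ i = c ≫ t) {T : P} (x : Φ.obj (op S) ⟶ T) :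
    leibnizTargetMap k s t w ≫ pullback.fst _ _ ≫ x = pullback.fst _ _ ≫ Φ.map s.op ≫ x :=
  (pullback.lift_fst_assoc _ _ _ _).trans (Category.assoc _ _ _)

@[simp]
lemma leibnizTargetMap_snd_assoc {V W S S' : E} {i : V ⟶ W} {c : S ⟶ S'} (s : S ⟶ V) (t : S' ⟶ W)
    (w : s ≫ i = c ≫ t) {T : P} (x : Γ.obj (op S') ⟶ T) :
    leibnizTargetMap k s t w ≫ pullback.snd _ _ ≫ x = pullback.snd _ _ ≫ Γ.map t.op ≫ x :=
  (pullback.lift_snd_assoc _ _ _ _).trans (Category.assoc _ _ _)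

variable (𝓕 : FibrationClass.{v} P)

/-- Both functors turn coproducts into products, and products commute with pullbacks, so the Leibniz
map of a coproduct is the product of the Leibniz maps of the summands. -/
lemma fib_leibniz_coproducts {T : MorphismProperty E}
    (hT : ∀ ⦃S S' : E⦄ (c : S ⟶ S'), T c → 𝓕.fib (leibniz k c))
    [∀ J : Type v, PreservesLimitsOfShape (Discrete J)ᵒᵖ Φ]
    [∀ J : Type v, PreservesLimitsOfShape (Discrete J)ᵒᵖ Γ]
    {V W : E} {i : V ⟶ W} (hi : MorphismProperty.coproducts.{v} T i) : 𝓕.fib (leibniz k i) := by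
  rw [MorphismProperty.coproducts_iff] at hi
  obtain ⟨J, ⟨X₁, X₂, c₁, c₂, h₁, h₂, f, hf⟩⟩ := hi
  have fac (j : Discrete J) : c₁.ι.app j ≫ h₁.desc (Cocone.mk _ (f ≫ c₂.ι)) =
      f.app j ≫ c₂.ι.app j := h₁.fac _ j
  generalize h₁.desc (Cocone.mk _ (f ≫ c₂.ι)) = i at fac
  have fac' (Ψ : Eᵒᵖ ⥤ P) (j : Discrete J) : Ψ.map i.op ≫ Ψ.map (c₁.ι.app j).op =
      Ψ.map (c₂.ι.app j).op ≫ Ψ.map (f.app j).op := by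
    rw [← Ψ.map_comp, ← Ψ.map_comp, ← op_comp, ← op_comp, fac]
  have discreteCompat {T : P} {F : Discrete J ⥤ E} {Ψ : Eᵒᵖ ⥤ P}
      (t : ∀ j, T ⟶ Ψ.obj (op (F.obj j))) {j j'} (f : j ⟶ j') :
      t j' ≫ Ψ.map (F.map f).op = t j := by
    obtain rfl := Discrete.ext (Discrete.eq_of_hom f)
    obtain rfl : f = 𝟙 _ := Subsingleton.elim _ _
    simp
  let X (j : J) : P := Φ.obj (op (X₂.obj ⟨j⟩))
  let Y (j : J) : P := leibnizTarget k (f.app ⟨j⟩)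
  let c : Fan X := Fan.mk (Φ.obj (op c₂.pt)) (fun j ↦ Φ.map (c₂.ι.app ⟨j⟩).op)
  let d : Fan Y := Fan.mk (leibnizTarget k i) (fun j ↦ leibnizTargetMap k
    (c₁.ι.app ⟨j⟩) (c₂.ι.app ⟨j⟩) (fac ⟨j⟩))
  have hc : IsLimit c := by
    choose l hl using fun (s : Fan X) ↦ exists_lift_of_isColimit h₂ Φ (fun j ↦ s.proj j.as)
      (fun f ↦ discreteCompat (fun j ↦ s.proj j.as) f)
    exact Fan.IsLimit.mk _ l (fun s j ↦ hl s ⟨j⟩)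
      (fun s m hm ↦ hom_ext_of_isColimit h₂ Φ fun j ↦ (hm j.as).trans (hl s j).symm)
  have hd : IsLimit d := by
    have H (s : Fan Y) : ∃ l : s.pt ⟶ leibnizTarget k i, ∀ j, l ≫ d.proj j = s.proj j := by
      obtain ⟨l₁, h₁'⟩ := exists_lift_of_isColimit h₁ Φ (fun j ↦ s.proj j.as ≫ pullback.fst _ _)
        (fun f ↦ discreteCompat (fun j ↦ s.proj j.as ≫ pullback.fst _ _) f)
      obtain ⟨l₂, h₂'⟩ := exists_lift_of_isColimit h₂ Γ (fun j ↦ s.proj j.as ≫ pullback.snd _ _)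
        (fun f ↦ discreteCompat (fun j ↦ s.proj j.as ≫ pullback.snd _ _) f)
      refine ⟨pullback.lift l₁ l₂ (hom_ext_of_isColimit h₁ Γ fun j ↦ ?_), fun j ↦ ?_⟩
      · rw [Category.assoc, Category.assoc, ← k.naturality, reassoc_of% (h₁' j), fac',
          reassoc_of% (h₂' j), pullback.condition]
      · refine pullback.hom_ext ?_ ?_
        · simpa [d] using (pullback.lift_fst_assoc _ _ _ _).trans (h₁' ⟨j⟩)
        · simpa [d] using (pullback.lift_snd_assoc _ _ _ _).trans (h₂' ⟨j⟩)
    choose l hl using H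
    refine Fan.IsLimit.mk _ l hl (fun s m hm ↦ pullback.hom_ext ?_ ?_)
    · refine hom_ext_of_isColimit h₁ Φ fun j ↦ ?_
      have := (hm j.as).trans (hl s j.as).symm =≫ pullback.fst _ _
      simpa [d] using this
    · refine hom_ext_of_isColimit h₂ Γ fun j ↦ ?_
      have := (hm j.as).trans (hl s j.as).symm =≫ pullback.snd _ _
      simpa [d] using this
  refine 𝓕.product (fun j ↦ leibniz k (f.app ⟨j⟩)) (fun j ↦ hT _ (hf _)) hc hd _ fun j ↦ ?_
  refine pullback.hom_ext ?_ ?_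
  · simpa [c, d] using fac' Φ ⟨j⟩
  · simp [c, d]

/-- The Leibniz map of a pushout is a base change. -/
lemma isPullback_leibniz {V W S S' : E} {s : S ⟶ V} {c : S ⟶ S'} {i : V ⟶ W} {t : S' ⟶ W}
    (h : IsPushout s c i t) [PreservesLimitsOfShape WalkingCospan Φ]
    [PreservesLimitsOfShape WalkingCospan Γ] :
    IsPullback (Φ.map t.op) (leibniz k i) (leibniz k c)
      (leibnizTargetMap k s t h.w) := by
  have hΦ : IsPullback (Φ.map t.op) (Φ.map i.op) (Φ.map c.op) (Φ.map s.op) := (h.op).map Φ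
  have hΓ : IsPullback (Γ.map t.op) (Γ.map i.op) (Γ.map c.op) (Γ.map s.op) := (h.op).map Γ
  refine ⟨⟨?_⟩, ⟨PullbackCone.IsLimit.mk _
    (fun x ↦ hΦ.lift x.fst (x.snd ≫ pullback.fst _ _) ?_) (fun x ↦ hΦ.lift_fst _ _ _)
    (fun x ↦ ?_) (fun x m h₁ h₂ ↦ hΦ.hom_ext ?_ ?_)⟩⟩
  · refine pullback.hom_ext ?_ ?_
    · simpa using hΦ.w
    · simp
  · have := x.condition =≫ pullback.fst _ _
    simpa using this
  · have := x.condition =≫ pullback.snd _ _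
    simp only [Category.assoc, leibniz_snd, leibnizTargetMap_snd] at this
    refine pullback.hom_ext ?_ (hΓ.hom_ext ?_ ?_)
    · simp
    · simp only [Category.assoc, leibniz_snd, ← k.naturality]
      rw [hΦ.lift_fst_assoc]
      simpa using this
    · simp only [Category.assoc, leibniz_snd, ← k.naturality]
      rw [hΦ.lift_snd_assoc, Category.assoc, pullback.condition]
  · rw [hΦ.lift_fst, h₁]
  · rw [hΦ.lift_snd, ← h₂]
    simp

/-- The Leibniz map of `a` pulls back to the comparison of the Leibniz targets of `a ≫ b` and `b`. -/
lemma isPullback_leibnizTargetMap {V V' W : E} (a : V ⟶ V') (b : V' ⟶ W) (c : V ⟶ W)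
    (h : a ≫ b = c) :
    IsPullback (pullback.fst _ _ : leibnizTarget k b ⟶ _)
      (leibnizTargetMap k (i := b) (c := c) a (𝟙 W) (by simpa using h)) (leibniz k a)
      (leibnizTargetMap k (𝟙 V) b (by simpa using h.symm)) := by
  have H (x : PullbackCone (leibniz k a) (leibnizTargetMap k (i := c) (𝟙 V) b
      (by simpa using h.symm))) : x.fst ≫ k.app _ = (x.snd ≫ pullback.snd _ _) ≫ Γ.map b.op := by
    have := x.condition =≫ pullback.snd _ _
    simpa using this
  refine ⟨⟨?_⟩, ⟨PullbackCone.IsLimit.mk _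
    (fun x ↦ pullback.lift x.fst (x.snd ≫ pullback.snd _ _) (H x))
    (fun x ↦ pullback.lift_fst _ _ _)
    (fun x ↦ ?_) (fun x m h₁ h₂ ↦ pullback.hom_ext ?_ ?_)⟩⟩
  · refine pullback.hom_ext ?_ ?_
    · simp
    · simpa using pullback.condition
  · have := x.condition =≫ pullback.fst _ _
    refine pullback.hom_ext ?_ ?_
    · rw [Category.assoc, leibnizTargetMap_fst, pullback.lift_fst_assoc]
      simpa using this
    · rw [Category.assoc, leibnizTargetMap_snd, pullback.lift_snd_assoc]
      simp
  · rw [pullback.lift_fst, h₁]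
  · rw [pullback.lift_snd, ← h₂]
    simp

section Tower

variable {V W : E} {i : V ⟶ W} (h : CategoryTheory.TransfiniteCompositionOfShape ℕ i)

/-- The tower of Leibniz targets of the maps to the colimit of a sequence. -/
def leibnizTower : ℕᵒᵖ ⥤ P where
  obj n := leibnizTarget k (h.incl.app n.unop)
  map f := leibnizTargetMap k (h.F.map f.unop) (𝟙 W) (h.incl.naturality f.unop)
  map_id n := pullback.hom_ext (by simp) (by simp)
  map_comp f g := pullback.hom_ext (by simp) (by simp)

/-- The cone of Leibniz maps. -/
def leibnizTowerCone : Cone (leibnizTower k h) where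
  pt := Φ.obj (op W)
  π :=
    { app n := leibniz k (h.incl.app n.unop)
      naturality n m f := by
        refine pullback.hom_ext ?_ ?_
        · simp [leibnizTower, ← Φ.map_comp, ← op_comp]
        · simp [leibnizTower] }

/-- The first projections of a cone over the tower assemble to a map into Φ W, the limit of the
values of Φ on the sequence. The second projections all agree, and since Γ W is also a limit they
are determined by the first ones. -/
lemma exists_isLimit_leibnizTowerCone [PreservesLimitsOfShape ℕᵒᵖ Φ]
    [PreservesLimitsOfShape ℕᵒᵖ Γ] : Nonempty (IsLimit (leibnizTowerCone k h)) := by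
  have H (s : Cone (leibnizTower k h)) := exists_lift_of_isColimit h.isColimit Φ
    (fun j ↦ s.π.app (op j) ≫ pullback.fst _ _) (fun {j j'} f ↦ by
      rw [← s.w f.op]
      simp [leibnizTower])
  have snd_eq (s : Cone (leibnizTower k h)) (j : ℕ) :
      s.π.app (op 0) ≫ pullback.snd _ _ = s.π.app (op j) ≫ pullback.snd _ _ := by
    rw [← s.w (homOfLE (Nat.zero_le j)).op]
    simp [leibnizTower]
  choose l hl using H
  refine ⟨⟨l, fun s j ↦ pullback.hom_ext ?_ ?_, fun s m hm ↦
    hom_ext_of_isColimit h.isColimit Φ fun j ↦ ?_⟩⟩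
  · exact (Category.assoc _ _ _).trans
      ((congrArg (l s ≫ ·) (leibniz_fst k (h.incl.app j.unop))).trans (hl s j.unop))
  · refine ((Category.assoc _ _ _).trans
      (congrArg (l s ≫ ·) (leibniz_snd k (h.incl.app j.unop)))).trans
      (Eq.trans ?_ (snd_eq s j.unop))
    refine hom_ext_of_isColimit h.isColimit Γ fun j' ↦ ?_
    rw [Category.assoc, ← k.naturality, reassoc_of% (hl s j'), snd_eq s j']
    exact (Category.assoc _ _ _).trans
      ((congrArg (s.π.app (op j') ≫ ·) pullback.condition).trans (Category.assoc _ _ _).symm)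
  · refine Eq.trans ?_ (hl s j).symm
    rw [← hm (op j)]
    exact ((congrArg (m ≫ ·) (leibniz_fst k (h.incl.app j))).symm).trans
      (Category.assoc _ _ _).symm

end Tower

attribute [instance] FibrationClass.respectsIso FibrationClass.objIso

/-- The Leibniz map of i is the limit of a tower whose n-th step is a base change of the Leibniz map
of the n-th attaching map, itself a base change of that of a coproduct of cells. The assumption on
the target starts an induction in which every stage of the tower is distinguished, as the source of
a fibration into the previous one. -/
theorem fib_leibniz_cellComplex {T : MorphismProperty E}
    (hT : ∀ ⦃S S' : E⦄ (c : S ⟶ S'), T c → 𝓕.fib (leibniz k c))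
    [∀ J : Type v, PreservesLimitsOfShape (Discrete J)ᵒᵖ Φ]
    [∀ J : Type v, PreservesLimitsOfShape (Discrete J)ᵒᵖ Γ]
    [PreservesLimitsOfShape WalkingCospan Φ] [PreservesLimitsOfShape WalkingCospan Γ]
    [PreservesLimitsOfShape ℕᵒᵖ Φ] [PreservesLimitsOfShape ℕᵒᵖ Γ]
    {V W : E} {i : V ⟶ W}
    (hi : (MorphismProperty.coproducts.{v} T).pushouts.transfiniteCompositionsOfShape ℕ i)
    (hV : 𝓕.obj (leibnizTarget k i)) : 𝓕.fib (leibniz k i) := by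
  obtain ⟨h⟩ := hi
  -- The sequence starts at an object only isomorphic to V, so the Leibniz targets at the two
  -- objects have to be identified.
  have fac : h.F.map (𝟙 _) ≫ h.incl.app ⊥ = h.isoBot.hom ≫ i := by
    rw [CategoryTheory.Functor.map_id, Category.id_comp]
    exact (Iso.inv_comp_eq _).1 h.fac
  let e : leibnizTarget k i ≅ leibnizTarget k (h.incl.app ⊥) :=
    { hom := leibnizTargetMap k h.isoBot.hom (𝟙 W) (by simpa using fac.symm)
      inv := leibnizTargetMap k h.isoBot.inv (𝟙 W) (by simpa using h.fac)
      hom_inv_id := pullback.hom_ext (by simp [← Φ.map_comp, ← op_comp]) (by simp)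
      inv_hom_id := pullback.hom_ext (by simp [← Φ.map_comp, ← op_comp]) (by simp) }
  have he : leibniz k i ≫ e.hom = leibniz k (h.incl.app ⊥) := by
    refine pullback.hom_ext ?_ ?_
    · simp only [e, Category.assoc, leibnizTargetMap_fst, leibniz_fst_assoc, leibniz_fst]
      rw [← Φ.map_comp, ← op_comp, ← fac]
      simp
    · simp [e]
  have step (n : ℕ) (hn : 𝓕.obj ((leibnizTower k h.toTransfiniteCompositionOfShape).obj (op n))) :
      𝓕.fib ((leibnizTower k h.toTransfiniteCompositionOfShape).map
        (homOfLE (Nat.le_succ n)).op) := by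
    -- The pushout square exhibits the Leibniz map of the n-th stage as a base change; pasted with
    -- the comparison of consecutive targets it gives the step of the tower.
    obtain ⟨S, S', s, t, c, hc, sq⟩ := h.map_mem n (not_isMax n)
    have h₁ := isPullback_leibnizTargetMap k (h.F.map (homOfLE (Nat.le_succ n)))
      (h.incl.app (n + 1)) (h.incl.app n) (h.incl.naturality _ |>.trans (Category.comp_id _))
    exact 𝓕.baseChange (h₁.paste_horiz (isPullback_leibniz k sq))
      (fib_leibniz_coproducts k 𝓕 hT hc) hn
  have h₀ : 𝓕.obj ((leibnizTower k h.toTransfiniteCompositionOfShape).obj (op 0)) :=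
    𝓕.obj.prop_of_iso e hV
  have hobj (n : ℕ) : 𝓕.obj ((leibnizTower k h.toTransfiniteCompositionOfShape).obj (op n)) := by
    induction n with
    | zero => exact h₀
    | succ n hn => exact 𝓕.source _ (step n hn)
  obtain ⟨hl⟩ := exists_isLimit_leibnizTowerCone k h.toTransfiniteCompositionOfShape
  have := 𝓕.tower _ h₀ (fun n ↦ step n (hobj n)) hl
  have : IsIso e.hom := e.isIso_hom
  rw [← 𝓕.fib.cancel_right_of_respectsIso (leibniz k i) e.hom, he]
  assumption

end CellComplexes

/-! ### Simplicial presheaves and the enriched Yoneda embedding -/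

section Simplex

variable {C : Type u} [Category.{v} C] [SimplicialCategory C]

lemma map_simplex {X Y : C} (f : X ⟶ Y) {n m : SimplexCategoryᵒᵖ} (θ : n ⟶ m) :
    (Map X Y).map θ (simplex f n) = simplex f m :=
  (NatTrans.naturality_apply (eHomEquiv SSet.{v} f) θ PUnit.unit).symm

lemma simplex_comp {X Y Z : C} (f : X ⟶ Y) (g : Y ⟶ Z) (n : SimplexCategoryᵒᵖ) :
    simplex (f ≫ g) n = scomp (simplex f n) (simplex g n) := by
  rw [simplex, eHomEquiv_comp]
  rfl

lemma simplex_homEquiv'_symm {X Y : C} (x : (Map X Y).obj (op ⦋0⦌)) :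
    simplex ((SimplicialCategory.homEquiv' X Y).symm x) (op ⦋0⦌) = x :=
  (SimplicialCategory.homEquiv' X Y).apply_symm_apply x

lemma simplex_injective {X Y : C} {f g : X ⟶ Y} (h : simplex f (op ⦋0⦌) = simplex g (op ⦋0⦌)) :
    f = g :=
  (SimplicialCategory.homEquiv' X Y).injective h

/-- The map from dimension zero. -/
abbrev fromZero (n : SimplexCategoryᵒᵖ) : op ⦋0⦌ ⟶ n :=
  (SimplexCategory.isTerminalZero.from n.unop).op

lemma fromZero_unique {n : SimplexCategoryᵒᵖ} (θ θ' : op ⦋0⦌ ⟶ n) : θ = θ' :=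
  Quiver.Hom.unop_inj (SimplexCategory.isTerminalZero.hom_ext _ _)

lemma simplex_eq_map {X Y : C} (f : X ⟶ Y) (n : SimplexCategoryᵒᵖ) :
    simplex f n = (Map X Y).map (fromZero n) (SimplicialCategory.homEquiv' X Y f) :=
  (map_simplex f (fromZero n)).symm

lemma simplex_symm {X Y : C} (x : (Map X Y).obj (op ⦋0⦌)) (n : SimplexCategoryᵒᵖ) :
    simplex ((SimplicialCategory.homEquiv' X Y).symm x) n = (Map X Y).map (fromZero n) x := by
  rw [simplex_eq_map, Equiv.apply_symm_apply]

end Simplex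

/-- The category of pairs of an object `X` and a dimension `n`, on which (covariant) functors to
types are simplicial presheaves on `C`. -/
structure Plex (C : Type u) where
  pt : C
  dim : SimplexCategoryᵒᵖ

instance (C : Type u) [EnrichedCategory SSet.{v} C] : Category.{v} (Plex C) where
  Hom x y := (x.dim ⟶ y.dim) × (Map y.pt x.pt).obj y.dim
  id x := (𝟙 _, sid x.pt x.dim)
  comp {x y z} f g := (f.1 ≫ g.1, scomp g.2 ((Map y.pt x.pt).map g.1 f.2))
  id_comp f := Prod.ext (Category.id_comp _) (by
    change scomp _ _ = _
    rw [map_sid, scomp_sid])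
  comp_id f := Prod.ext (Category.comp_id _) (by
    change scomp _ _ = _
    rw [sid_scomp, CategoryTheory.Functor.map_id_apply])
  assoc f g h := Prod.ext (Category.assoc _ _ _) (by
    change scomp _ _ = scomp (scomp _ _) _
    rw [map_scomp, scomp_assoc, CategoryTheory.Functor.map_comp_apply])

section Yoneda

variable (K : Type u) [Category.{v} K] [SimplicialCategory K]

/-- The enriched Yoneda embedding. -/
def eYoneda : K ⥤ Plex K ⥤ Type v where
  obj L :=
    { obj x := (Map x.pt L).obj x.dim
      map {x y} f := ↾fun g ↦ scomp f.2 ((Map x.pt L).map f.1 g)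
      map_id x := by
        ext g
        change scomp (sid _ _) ((Map x.pt L).map (𝟙 _) g) = g
        rw [sid_scomp, CategoryTheory.Functor.map_id_apply]
      map_comp {x y z} f f' := by
        ext g
        change scomp (scomp f'.2 ((Map y.pt x.pt).map f'.1 f.2)) ((Map x.pt L).map (f.1 ≫ f'.1) g) =
          scomp f'.2 ((Map y.pt L).map f'.1 (scomp f.2 ((Map x.pt L).map f.1 g)))
        rw [map_scomp, scomp_assoc, CategoryTheory.Functor.map_comp_apply] }
  map {L M} p :=
    { app x := (eHomWhiskerLeft SSet.{v} x.pt p).app x.dim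
      naturality x y f := by
        ext g
        change scomp (scomp f.2 ((Map x.pt L).map f.1 g)) (simplex p y.dim) =
          scomp f.2 ((Map x.pt M).map f.1 (scomp g (simplex p x.dim)))
        rw [map_scomp, map_simplex, scomp_assoc] }
  map_id L := by
    ext x g
    change (eHomWhiskerLeft SSet.{v} x.pt (𝟙 L)).app x.dim g = g
    rw [eHomWhiskerLeft_id]
    rfl
  map_comp p q := by
    ext x g
    change (eHomWhiskerLeft SSet.{v} x.pt (p ≫ q)).app x.dim g = _
    rw [eHomWhiskerLeft_comp]
    rfl

variable {K}

lemma eYoneda_obj_map (L : K) {x y : Plex K} (f : x ⟶ y) (g : (Map x.pt L).obj x.dim) :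
    ((eYoneda K).obj L).map f g = scomp f.2 ((Map x.pt L).map f.1 g) := rfl

/-- The morphism from the universal point. -/
abbrev Plex.toZero {L X : K} {n : SimplexCategoryᵒᵖ} (g : (Map X L).obj n) :
    (⟨L, op ⦋0⦌⟩ : Plex K) ⟶ ⟨X, n⟩ := (fromZero n, g)

/-- The identity vertex of Map L L is universal: every simplex g of Map X L is its image under
`Plex.toZero g`. This gives faithfulness here and fullness below. -/
instance : (eYoneda K).Faithful where
  map_injective {L M p q} h := by
    have := ConcreteCategory.congr_hom (NatTrans.congr_app h ⟨L, op ⦋0⦌⟩) (sid L (op ⦋0⦌))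
    exact simplex_injective ((sid_scomp _).symm.trans (Eq.trans this (sid_scomp _)))

instance : (eYoneda K).Full where
  map_surjective {L M} η := by
    refine ⟨(SimplicialCategory.homEquiv' L M).symm (η.app ⟨L, op ⦋0⦌⟩ (sid L (op ⦋0⦌))), ?_⟩
    ext ⟨X, n⟩ g
    have := NatTrans.naturality_apply η (Plex.toZero g) (sid L (op ⦋0⦌))
    rw [eYoneda_obj_map, map_sid, scomp_sid] at this
    refine Eq.trans ?_ this.symm
    exact congrArg (scomp g) (simplex_symm _ n)

/-- Limits of presheaves are computed at each pair (X, n), where the embedding is the set of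
n-simplices of Map X -. This preserves the limit precisely because it is conical in the enriched
sense. -/
lemma preservesLimit_eYoneda {J : Type u₁} [Category.{u₂} J] (F : J ⥤ K)
    [Enriched.HasConicalLimit SSet.{v} F] : PreservesLimit F (eYoneda K) := by
  refine ⟨fun {c} hc ↦ ⟨evaluationJointlyReflectsLimits _ fun x ↦ ?_⟩⟩
  exact isLimitOfPreserves ((evaluation SimplexCategoryᵒᵖ (Type v)).obj x.dim)
    (isLimitOfPreserves (eCoyoneda SSet.{v} x.pt) hc)

end Yoneda

/-! ### Isofibrations as maps of simplicial presheaves. -/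

section CosmosFibrations

variable {K : Type u} [Category.{v} K] [SimplicialCategory K] (𝒦 : InfinityCosmos K)

namespace InfinityCosmos

instance : 𝒦.isofibration.RespectsIso :=
  MorphismProperty.RespectsIso.of_respects_arrow_iso _ fun f g e hf ↦ by
    have h : g.hom = e.inv.left ≫ f.hom ≫ e.hom.right := by simp
    rw [h]
    exact 𝒦.isofibration_comp _ _ (𝒦.isofibration_of_isIso _)
      (𝒦.isofibration_comp _ _ hf (𝒦.isofibration_of_isIso _))

/-- The morphisms of simplicial presheaves represented by an isofibration. -/
abbrev presheafIsofibration : MorphismProperty (Plex K ⥤ Type v) :=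
  𝒦.isofibration.map (eYoneda K)

lemma isofibration_of_presheafIsofibration {X Y : K} {f : X ⟶ Y}
    (h : 𝒦.presheafIsofibration ((eYoneda K).map f)) : 𝒦.isofibration f := by
  obtain ⟨X', Y', f', hf', ⟨e⟩⟩ := h
  refine (𝒦.isofibration.arrow_mk_iso_iff (Arrow.isoMk
    ((eYoneda K).preimageIso (Arrow.leftFunc.mapIso e))
    ((eYoneda K).preimageIso (Arrow.rightFunc.mapIso e)) ((eYoneda K).map_injective ?_))).1 hf'
  have hl : (eYoneda K).map ((eYoneda K).preimageIso (Arrow.leftFunc.mapIso e)).hom =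
    e.hom.left := Functor.map_preimage _ _
  have hr : (eYoneda K).map ((eYoneda K).preimageIso (Arrow.rightFunc.mapIso e)).hom =
    e.hom.right := Functor.map_preimage _ _
  exact ((eYoneda K).map_comp _ _).trans ((congrArg (· ≫ _) hl).trans (e.hom.w.trans
    ((congrArg (_ ≫ ·) hr).symm.trans ((eYoneda K).map_comp _ _).symm)))

/-- Representability of the new base makes the whole cospan isomorphic to the image of a cospan in K
with one leg an isofibration. Its pullback exists in K and is preserved by the embedding. -/
lemma presheafIsofibration_baseChange {E' E B' B : Plex K ⥤ Type v} {g : E' ⟶ E} {q : E' ⟶ B'}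
    {p : E ⟶ B} {f : B' ⟶ B} (h : IsPullback g q p f) (hp : 𝒦.presheafIsofibration p)
    (hB : (eYoneda K).essImage B') : 𝒦.presheafIsofibration q := by
  obtain ⟨E₀, B₀, p₀, hp₀, ⟨e⟩⟩ := hp
  obtain ⟨X₀, ⟨eX⟩⟩ := hB
  let eE : (eYoneda K).obj E₀ ≅ E := Arrow.leftFunc.mapIso e
  let eB : (eYoneda K).obj B₀ ≅ B := Arrow.rightFunc.mapIso e
  have he : (eYoneda K).map p₀ ≫ eB.hom = eE.hom ≫ p := e.hom.w.symm
  obtain ⟨f₀, hf₀⟩ := (eYoneda K).map_surjective (eX.hom ≫ f ≫ eB.inv)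
  have := 𝒦.hasPullbacks p₀ f₀ hp₀
  have := preservesLimit_eYoneda (cospan p₀ f₀)
  have sq := IsPullback.of_hasPullback p₀ f₀
  have sq' : IsPullback ((eYoneda K).map (pullback.fst p₀ f₀) ≫ eE.hom)
      ((eYoneda K).map (pullback.snd p₀ f₀) ≫ eX.hom) p f :=
    (sq.map (eYoneda K)).of_iso (Iso.refl _) eE eX eB (by simp) (by simp) he (by simp [hf₀])
  refine ⟨_, _, _, 𝒦.isofibration_of_isPullback sq hp₀,
    ⟨Arrow.isoMk (sq'.isoIsPullback _ _ h) eX ?_⟩⟩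
  exact sq'.isoIsPullback_hom_snd _ _ h

lemma presheafIsofibration_product {J : Type v} {X Y : J → Plex K ⥤ Type v} (p : ∀ j, X j ⟶ Y j)
    (hp : ∀ j, 𝒦.presheafIsofibration (p j)) {c : Fan X} (hc : IsLimit c) {d : Fan Y}
    (hd : IsLimit d) (q : c.pt ⟶ d.pt) (hq : ∀ j, q ≫ d.proj j = c.proj j ≫ p j) :
    𝒦.presheafIsofibration q := by
  choose A B f hf e using hp
  replace e := fun j ↦ (e j).some
  have := 𝒦.hasProducts
  -- A family of presheaves isomorphic to representables has as product the presheaf represented by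
  -- the product in K; this is used for both the sources and the targets.
  have key (Z : J → K) {T : J → Plex K ⥤ Type v} (i : ∀ j, (eYoneda K).obj (Z j) ≅ T j) :
      Nonempty (IsLimit (Fan.mk ((eYoneda K).obj (∏ᶜ Z)) (fun j ↦
        (eYoneda K).map (Pi.π Z j) ≫ (i j).hom) : Fan T)) := by
    have := preservesLimit_eYoneda (Discrete.functor Z)
    have hl := isLimitFanMkObjOfIsLimit (eYoneda K) Z _ (productIsProduct Z)
    refine ⟨Fan.IsLimit.mk _ (fun s ↦ hl.lift (Fan.mk s.pt fun j ↦ s.proj j ≫ (i j).inv))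
      (fun s j ↦ ?_) (fun s m hm ↦ hl.hom_ext fun j ↦ ?_)⟩
    · have := hl.fac (Fan.mk s.pt fun j ↦ s.proj j ≫ (i j).inv) ⟨j⟩
      refine (Category.assoc _ _ _).symm.trans ((congrArg (· ≫ (i j).hom) this).trans ?_)
      exact (Category.assoc _ _ _).trans (by simp)
    · refine Eq.trans ?_ (hl.fac (Fan.mk s.pt fun j ↦ s.proj j ≫ (i j).inv) j).symm
      have := hm j.as
      exact ((Iso.eq_comp_inv _).2 ((Category.assoc _ _ _).trans this))
  obtain ⟨hA⟩ := key A (fun j ↦ Arrow.leftFunc.mapIso (e j))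
  obtain ⟨hB⟩ := key B (fun j ↦ Arrow.rightFunc.mapIso (e j))
  refine ⟨∏ᶜ A, ∏ᶜ B, Limits.Pi.map f, 𝒦.isofibration_product f hf (productIsProduct A) (productIsProduct B)
    (Limits.Pi.map f) (fun j ↦ Pi.map_π f j), ⟨Arrow.isoMk (hA.conePointUniqueUpToIso hc)
      (hB.conePointUniqueUpToIso hd) (hd.hom_ext fun j ↦ ?_)⟩⟩
  have h₁ := hA.conePointUniqueUpToIso_hom_comp hc j
  have h₂ := hB.conePointUniqueUpToIso_hom_comp hd j
  have h₃ := hq j.as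
  refine (Category.assoc _ _ _).trans ((congrArg (_ ≫ ·) h₃).trans ?_)
  refine (Category.assoc _ _ _).symm.trans ((congrArg (· ≫ _) h₁).trans ?_)
  refine Eq.trans ?_ (Category.assoc _ _ _).symm
  refine Eq.trans ?_ (congrArg (_ ≫ ·) h₂).symm
  have h₄ := congrArg (eYoneda K).map (Pi.map_π f j.as)
  rw [Functor.map_comp, Functor.map_comp] at h₄
  refine Eq.trans ?_ (Category.assoc _ _ _)
  refine Eq.trans ?_ (congrArg (· ≫ _) h₄).symm
  refine (Category.assoc _ _ _).trans (Eq.trans ?_ (Category.assoc _ _ _).symm)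
  exact congrArg (_ ≫ ·) (e j.as).hom.w

/-- Stage zero is representable by assumption and every later stage as the source of an isofibration
of presheaves. Hence the tower lifts along the fully faithful embedding to a tower of isofibrations
in K. -/
lemma presheafIsofibration_tower (F : ℕᵒᵖ ⥤ Plex K ⥤ Type v)
    (h0 : (eYoneda K).essImage (F.obj (op 0)))
    (hF : ∀ n : ℕ, 𝒦.presheafIsofibration (F.map (homOfLE (Nat.le_succ n)).op))
    {c : Cone F} (hc : IsLimit c) : 𝒦.presheafIsofibration (c.π.app (op 0)) := by
  have hF' (n : ℕᵒᵖ) : (eYoneda K).essImage (F.obj n) := by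
    obtain ⟨n⟩ := n
    cases n with
    | zero => exact h0
    | succ n =>
      obtain ⟨E₀, B₀, p₀, hp₀, ⟨e⟩⟩ := hF n
      exact ⟨E₀, ⟨Arrow.leftFunc.mapIso e⟩⟩
  let F₀ := Functor.essImage.liftFunctor F (eYoneda K) hF'
  let i : F₀ ⋙ eYoneda K ≅ F := Functor.essImage.liftFunctorCompIso F (eYoneda K) hF'
  have hF₀ (n : ℕ) : 𝒦.isofibration (F₀.map (homOfLE (Nat.le_succ n)).op) := by
    refine 𝒦.isofibration_of_presheafIsofibration ?_
    exact (𝒦.presheafIsofibration.arrow_mk_iso_iff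
      (Arrow.isoMk (i.app _) (i.app _) (i.hom.naturality _).symm)).2 (hF n)
  have := 𝒦.hasTowers F₀ hF₀
  have := preservesLimit_eYoneda F₀
  have hl := isLimitOfPreserves (eYoneda K) (limit.isLimit F₀)
  refine ⟨_, _, _, 𝒦.isofibration_tower F₀ hF₀ (limit.isLimit F₀) 0,
    ⟨Arrow.isoMk (hl.conePointsIsoOfNatIso hc i) (i.app (op 0)) ?_⟩⟩
  exact hl.conePointsIsoOfNatIso_hom_comp hc i (op 0)

/-- The class of morphisms of simplicial presheaves represented by an isofibration. -/
def fibrationClass : FibrationClass.{v} (Plex K ⥤ Type v) where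
  fib := 𝒦.presheafIsofibration
  obj := (eYoneda K).essImage
  respectsIso := inferInstance
  objIso := inferInstance
  source := by
    rintro X Y f ⟨E₀, B₀, p₀, hp₀, ⟨e⟩⟩
    exact ⟨E₀, ⟨Arrow.leftFunc.mapIso e⟩⟩
  baseChange := 𝒦.presheafIsofibration_baseChange
  product := 𝒦.presheafIsofibration_product
  tower := 𝒦.presheafIsofibration_tower

end InfinityCosmos

end CosmosFibrations

/-! ### Weights -/

section Weights

variable {A : Type v} [EnrichedCategory SSet.{v} A]

/-- The action of the hom-spaces on the values of a weight. -/
def act (W : Weight A) {a b : A} {n : SimplexCategoryᵒᵖ} (w : (W.obj a).obj n)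
    (x : (Map a b).obj n) : (W.obj b).obj n :=
  ((W.map a b).app n x : (W.obj a).HomObj (W.obj b) (coyoneda.obj (op n))).app n (𝟙 n) w

lemma app_eq_act (W : Weight A) {a b : A} {n m : SimplexCategoryᵒᵖ} (x : (Map a b).obj n)
    (θ : n ⟶ m) (w : (W.obj a).obj m) :
    ((W.map a b).app n x : (W.obj a).HomObj (W.obj b) (coyoneda.obj (op n))).app m θ w =
      act W w ((Map a b).map θ x) := by
  have h := map_app_map W.toEnrichedFunctor θ x
  rw [act, h]
  change _ = ((W.map a b).app n x : (W.obj a).HomObj (W.obj b) (coyoneda.obj (op n))).app m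
    (θ ≫ 𝟙 m) w
  rw [Category.comp_id]

lemma map_act (W : Weight A) {a b : A} {n m : SimplexCategoryᵒᵖ} (θ : n ⟶ m)
    (w : (W.obj a).obj n) (x : (Map a b).obj n) :
    (W.obj b).map θ (act W w x) = act W ((W.obj a).map θ w) ((Map a b).map θ x) := by
  rw [← app_eq_act, act]
  have := ConcreteCategory.congr_hom (((W.map a b).app n x : (W.obj a).HomObj (W.obj b)
    (coyoneda.obj (op n))).naturality θ (𝟙 n)) w
  refine Eq.trans this.symm ?_
  change ((W.map a b).app n x : (W.obj a).HomObj (W.obj b) (coyoneda.obj (op n))).app m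
    (𝟙 n ≫ θ) _ = _
  rw [Category.id_comp]
  rfl

lemma act_sid (W : Weight A) {a : A} {n : SimplexCategoryᵒᵖ} (w : (W.obj a).obj n) :
    act W w (sid a n) = w := by
  rw [act, map_app_sid W.toEnrichedFunctor]
  rfl

lemma act_scomp (W : Weight A) {a b c : A} {n : SimplexCategoryᵒᵖ} (w : (W.obj a).obj n)
    (x : (Map a b).obj n) (y : (Map b c).obj n) :
    act W w (scomp x y) = act W (act W w x) y := by
  rw [act, map_app_scomp W.toEnrichedFunctor]
  rfl

namespace SNat

variable {W G H : Weight A} {n m : SimplexCategoryᵒᵖ}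

/-- The values of a simplex of simplicial natural transformations of weights. -/
def ev (σ : (Map W G).obj n) {a : A} (θ : n ⟶ m) (w : (W.obj a).obj m) : (G.obj a).obj m :=
  (SNat.app σ a : (W.obj a).HomObj (G.obj a) (coyoneda.obj (op n))).app m θ w

lemma map_ev (σ : (Map W G).obj n) {a : A} (θ : n ⟶ m) {l : SimplexCategoryᵒᵖ} (φ : m ⟶ l)
    (w : (W.obj a).obj m) : (G.obj a).map φ (ev σ θ w) = ev σ (θ ≫ φ) ((W.obj a).map φ w) :=
  (ConcreteCategory.congr_hom ((SNat.app σ a : (W.obj a).HomObj (G.obj a)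
    (coyoneda.obj (op n))).naturality φ θ) w).symm

lemma ev_act (σ : (Map W G).obj n) {a b : A} (θ : n ⟶ m) (w : (W.obj a).obj m)
    (x : (Map a b).obj m) : ev σ θ (act W w x) = act G (ev σ θ w) x := by
  have h := SNat.naturality σ θ x
  have := ConcreteCategory.congr_hom (congrArg (fun f : (W.obj a).HomObj (G.obj b)
    (coyoneda.obj (op m)) ↦ f.app m (𝟙 m)) h) w
  change (SNat.app σ b : (W.obj b).HomObj (G.obj b) (coyoneda.obj (op n))).app m (θ ≫ 𝟙 m)
    (act W w x) = act G ((SNat.app σ a : (W.obj a).HomObj (G.obj a)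
      (coyoneda.obj (op n))).app m (θ ≫ 𝟙 m) w) x at this
  rwa [Category.comp_id] at this

lemma ev_map (σ : (Map W G).obj n) {a : A} (φ : n ⟶ m) {l : SimplexCategoryᵒᵖ} (θ : m ⟶ l)
    (w : (W.obj a).obj l) : ev ((Map W G).map φ σ) θ w = ev σ (φ ≫ θ) w :=
  rfl

lemma ev_scomp (σ : (Map W G).obj n) (τ : (Map G H).obj n) {a : A} (θ : n ⟶ m)
    (w : (W.obj a).obj m) : ev (scomp σ τ) θ w = ev τ θ (ev σ θ w) :=
  rfl

lemma ext_ev {σ τ : (Map W G).obj n}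
    (h : ∀ (a : A) (m : SimplexCategoryᵒᵖ) (θ : n ⟶ m) (w : (W.obj a).obj m),
      ev σ θ w = ev τ θ w) : σ = τ :=
  SNat.ext (funext fun a ↦ Functor.functorHom_ext fun m θ ↦ by
    ext w
    exact h a m θ w)

/-- Constructor for simplices of simplicial natural transformations of weights. -/
def ofEv (e : ∀ {a : A} {m : SimplexCategoryᵒᵖ}, (n ⟶ m) → (W.obj a).obj m → (G.obj a).obj m)
    (map_e : ∀ {a : A} {m l : SimplexCategoryᵒᵖ} (θ : n ⟶ m) (φ : m ⟶ l) (w : (W.obj a).obj m),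
      (G.obj a).map φ (e θ w) = e (θ ≫ φ) ((W.obj a).map φ w))
    (e_act : ∀ {a b : A} {m : SimplexCategoryᵒᵖ} (θ : n ⟶ m) (w : (W.obj a).obj m)
      (x : (Map a b).obj m), e θ (act W w x) = act G (e θ w) x) : (Map W G).obj n :=
  (show SNat W G n from
  { app a := show (W.obj a).HomObj (G.obj a) (coyoneda.obj (op n)) from
      { app m θ := ↾fun w ↦ e θ w
        naturality φ θ := by
          ext w
          exact (map_e θ φ w).symm }
    naturality {a b m} θ x := by
      refine Functor.functorHom_ext fun l φ ↦ ?_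
      ext w
      change e (θ ≫ φ) (((W.map a b).app m x : (W.obj a).HomObj (W.obj b)
        (coyoneda.obj (op m))).app l φ w) = ((G.map a b).app m x : (G.obj a).HomObj (G.obj b)
        (coyoneda.obj (op m))).app l φ (e (θ ≫ φ) w)
      rw [app_eq_act, app_eq_act, e_act] })

end SNat

section Hom

variable {W G H : Weight A} {m : SimplexCategoryᵒᵖ}

/-- The values of a morphism of weights. -/
def wev (f : W ⟶ G) {a : A} {m : SimplexCategoryᵒᵖ} (w : (W.obj a).obj m) : (G.obj a).obj m :=
  SNat.ev (W := W) (G := G) (n := op ⦋0⦌) f (fromZero m) w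

lemma wev_eq (f : W ⟶ G) {a : A} (θ : op ⦋0⦌ ⟶ m) (w : (W.obj a).obj m) :
    SNat.ev (W := W) (G := G) (n := op ⦋0⦌) f θ w = wev f w := by
  rw [fromZero_unique θ (fromZero m)]
  rfl

lemma map_wev (f : W ⟶ G) {a : A} {l : SimplexCategoryᵒᵖ} (φ : m ⟶ l) (w : (W.obj a).obj m) :
    (G.obj a).map φ (wev f w) = wev f ((W.obj a).map φ w) :=
  (SNat.map_ev (W := W) (G := G) (n := op ⦋0⦌) f (fromZero m) φ w).trans (wev_eq f _ _)

lemma wev_act (f : W ⟶ G) {a b : A} (w : (W.obj a).obj m) (x : (Map a b).obj m) :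
    wev f (act W w x) = act G (wev f w) x :=
  SNat.ev_act (W := W) (G := G) (n := op ⦋0⦌) f (fromZero m) w x

lemma ev_simplex (f : W ⟶ G) {n : SimplexCategoryᵒᵖ} {a : A} (θ : n ⟶ m) (w : (W.obj a).obj m) :
    SNat.ev (simplex f n) θ w = wev f w := by
  rw [simplex_eq_map, SNat.ev_map]
  exact (congrArg (fun g ↦ SNat.ev (W := W) (G := G) g _ w)
    ((SSet.unitHomEquiv (Map W G)).apply_symm_apply f)).trans (wev_eq f _ w)

lemma hom_ext_wev {f g : W ⟶ G}
    (h : ∀ (a : A) (m : SimplexCategoryᵒᵖ) (w : (W.obj a).obj m), wev f w = wev g w) : f = g :=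
  SNat.ext_ev (W := W) (G := G) fun a m θ w ↦
    (wev_eq f θ w).trans ((h a m w).trans (wev_eq g θ w).symm)

lemma wev_comp (f : W ⟶ G) (g : G ⟶ H) {a : A} (w : (W.obj a).obj m) :
    wev (f ≫ g) w = wev g (wev f w) :=
  rfl

/-- Constructor for morphisms of weights. -/
def ofWev (e : ∀ {a : A} {m : SimplexCategoryᵒᵖ}, (W.obj a).obj m → (G.obj a).obj m)
    (map_e : ∀ {a : A} {m l : SimplexCategoryᵒᵖ} (φ : m ⟶ l) (w : (W.obj a).obj m),
      (G.obj a).map φ (e w) = e ((W.obj a).map φ w))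
    (e_act : ∀ {a b : A} {m : SimplexCategoryᵒᵖ} (w : (W.obj a).obj m)
      (x : (Map a b).obj m), e (act W w x) = act G (e w) x) : W ⟶ G :=
  SNat.ofEv (W := W) (G := G) (fun _ ↦ e) (fun _ ↦ map_e) (fun _ ↦ e_act)

end Hom

lemma act_ofAction (W : A → SSet.{v})
    (α : ∀ {a b : A} {n : SimplexCategoryᵒᵖ}, (W a).obj n → (Map a b).obj n → (W b).obj n)
    (h₁ h₂ h₃) {a b : A} {n : SimplexCategoryᵒᵖ} (w : (W a).obj n) (x : (Map a b).obj n) :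
    act ⟨ofAction W α h₁ h₂ h₃⟩ w x = α w x := by
  change α w ((Map a b).map (𝟙 n) x) = α w x
  rw [CategoryTheory.Functor.map_id_apply]

section HomInto

variable {K : Type u} [Category.{v} K] [SimplicialCategory K]

lemma act_homInto (F : SFun A K) (X : K) {a b : A} {n : SimplexCategoryᵒᵖ}
    (g : (Map X (F.obj a)).obj n) (x : (Map a b).obj n) :
    act (homInto F X) g x = scomp g ((F.map a b).app n x) := by
  change scomp g ((Map _ _).map (𝟙 n) ((F.map a b).app n x)) = _
  rw [CategoryTheory.Functor.map_id_apply]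

lemma ev_homIntoPre (F : SFun A K) (X L : K) {n m : SimplexCategoryᵒᵖ} (x : (Map X L).obj n)
    {a : A} (θ : n ⟶ m) (g : (Map L (F.obj a)).obj m) :
    SNat.ev (W := homInto F L) (G := homInto F X) ((homIntoPre F X L).app n x) θ g =
      scomp ((Map X L).map θ x) g :=
  rfl

lemma ev_homIntoPost (F G : SFun A K) (L : K) {n m : SimplexCategoryᵒᵖ} (κ : (Map F G).obj n)
    {a : A} (θ : n ⟶ m) (g : (Map L (F.obj a)).obj m) :
    SNat.ev (W := homInto F L) (G := homInto G L) ((homIntoPost F G L).app n κ) θ g =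
      scomp g ((Map _ _).map θ (SNat.app κ a)) :=
  rfl

end HomInto

/-- A simplex of the internal hom of simplicial sets, as a function. -/
def hev {U X : SSet.{v}} {n m : SimplexCategoryᵒᵖ} (h : (Functor.functorHom U X).obj n)
    (θ : n ⟶ m) (y : U.obj m) : X.obj m :=
  (h : U.HomObj X (coyoneda.obj (op n))).app m θ y

lemma map_hev {U X : SSet.{v}} {n m l : SimplexCategoryᵒᵖ} (h : (Functor.functorHom U X).obj n)
    (θ : n ⟶ m) (φ : m ⟶ l) (y : U.obj m) :
    X.map φ (hev h θ y) = hev h (θ ≫ φ) (U.map φ y) :=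
  (ConcreteCategory.congr_hom
    ((h : U.HomObj X (coyoneda.obj (op n))).naturality φ θ) y).symm

lemma hev_map {U X : SSet.{v}} {n m l : SimplexCategoryᵒᵖ} (h : (Functor.functorHom U X).obj n)
    (θ : n ⟶ m) (φ : m ⟶ l) (y : U.obj l) :
    hev ((Functor.functorHom U X).map θ h) φ y = hev h (θ ≫ φ) y :=
  rfl

lemma ext_hev {U X : SSet.{v}} {n : SimplexCategoryᵒᵖ} {h h' : (Functor.functorHom U X).obj n}
    (H : ∀ (m : SimplexCategoryᵒᵖ) (θ : n ⟶ m) (y : U.obj m), hev h θ y = hev h' θ y) : h = h' :=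
  Functor.functorHom_ext fun m θ ↦ by
    ext y
    exact H m θ y

/-- Constructor for simplices of the internal hom of simplicial sets. -/
def ofHev {U X : SSet.{v}} {n : SimplexCategoryᵒᵖ}
    (e : ∀ {m : SimplexCategoryᵒᵖ}, (n ⟶ m) → U.obj m → X.obj m)
    (map_e : ∀ {m l : SimplexCategoryᵒᵖ} (θ : n ⟶ m) (φ : m ⟶ l) (y : U.obj m),
      X.map φ (e θ y) = e (θ ≫ φ) (U.map φ y)) : (Functor.functorHom U X).obj n :=
  (show U.HomObj X (coyoneda.obj (op n)) from
    { app m θ := ↾fun y ↦ e θ y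
      naturality φ θ := by
        ext y
        exact (map_e θ φ y).symm })

/-- The cotensor of a weight by a simplicial set. -/
def cotensor (U : SSet.{v}) (G : Weight A) : Weight A :=
  ⟨ofAction (fun a ↦ Functor.functorHom U (G.obj a))
    (fun {a b n} h x ↦ (show U.HomObj (G.obj b) (coyoneda.obj (op n)) from
      { app l θ := ↾fun y ↦ act G
          ((h : U.HomObj (G.obj a) (coyoneda.obj (op n))).app l θ y) ((Map a b).map θ x)
        naturality {l l'} φ θ := by
          ext y
          have := ConcreteCategory.congr_hom
            ((h : U.HomObj (G.obj a) (coyoneda.obj (op n))).naturality φ θ) y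
          change act G ((h : U.HomObj (G.obj a) (coyoneda.obj (op n))).app l' (θ ≫ φ)
            (U.map φ y)) ((Map a b).map (θ ≫ φ) x) = (G.obj b).map φ (act G _ _)
          rw [map_act, CategoryTheory.Functor.map_comp_apply]
          exact congrArg (fun z ↦ act G z _) this }))
    (fun θ w x ↦ Functor.functorHom_ext fun l φ ↦ by
      ext y
      change act G _ ((Map _ _).map (θ ≫ φ) x) = act G _ ((Map _ _).map φ ((Map _ _).map θ x))
      rw [CategoryTheory.Functor.map_comp_apply]
      rfl)
    (fun w ↦ Functor.functorHom_ext fun l φ ↦ by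
      ext y
      change act G _ ((Map _ _).map φ (sid _ _)) = _
      rw [map_sid, act_sid]
      rfl)
    (fun w x z ↦ Functor.functorHom_ext fun l φ ↦ by
      ext y
      change act G _ ((Map _ _).map φ (scomp x z)) = act G (act G _ _) _
      rw [map_scomp, act_scomp])⟩

section Cotensor

variable {U : SSet.{v}} {G : Weight A} {a b : A} {n m : SimplexCategoryᵒᵖ}

/-- The values of a simplex of the cotensor of a weight. -/
def cev (h : ((cotensor U G).obj a).obj n) (θ : n ⟶ m) (y : U.obj m) : (G.obj a).obj m :=
  hev (X := G.obj a) h θ y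

/-- Constructor for simplices of the cotensor of a weight. -/
def ofCev (e : ∀ {m : SimplexCategoryᵒᵖ}, (n ⟶ m) → U.obj m → (G.obj a).obj m)
    (map_e : ∀ {m l : SimplexCategoryᵒᵖ} (θ : n ⟶ m) (φ : m ⟶ l) (y : U.obj m),
      (G.obj a).map φ (e θ y) = e (θ ≫ φ) (U.map φ y)) : ((cotensor U G).obj a).obj n :=
  ofHev (X := G.obj a) e map_e

lemma map_cev (h : ((cotensor U G).obj a).obj n) (θ : n ⟶ m) {l : SimplexCategoryᵒᵖ} (φ : m ⟶ l)
    (y : U.obj m) : (G.obj a).map φ (cev h θ y) = cev h (θ ≫ φ) (U.map φ y) :=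
  map_hev (X := G.obj a) h θ φ y

lemma cev_map (h : ((cotensor U G).obj a).obj n) (θ : n ⟶ m) {l : SimplexCategoryᵒᵖ} (φ : m ⟶ l)
    (y : U.obj l) : cev (((cotensor U G).obj a).map θ h) φ y = cev h (θ ≫ φ) y :=
  rfl

lemma ext_cev {h h' : ((cotensor U G).obj a).obj n}
    (H : ∀ (m : SimplexCategoryᵒᵖ) (θ : n ⟶ m) (y : U.obj m), cev h θ y = cev h' θ y) : h = h' :=
  ext_hev (X := G.obj a) H

lemma cev_act (h : ((cotensor U G).obj a).obj n) (x : (Map a b).obj n) (θ : n ⟶ m) (y : U.obj m) :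
    cev (act (cotensor U G) h x) θ y = act G (cev h θ y) ((Map a b).map θ x) := by
  change act G (cev h θ y) ((Map a b).map θ ((Map a b).map (𝟙 n) x)) = _
  rw [CategoryTheory.Functor.map_id_apply]

end Cotensor

/-! ### Mapping out of a colimit of weights. -/

/-- The functor `Map - G` on weights. -/
abbrev mapTo (G : Weight A) : (Weight A)ᵒᵖ ⥤ SSet.{v} := (eHomFunctor SSet.{v} (Weight A)).flip.obj G

lemma ev_mapTo_map (G : Weight A) {W W' : Weight A} (i : W ⟶ W') {n m : SimplexCategoryᵒᵖ}
    (σ : (Map W' G).obj n) {a : A} (θ : n ⟶ m) (w : (W.obj a).obj m) :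
    SNat.ev (W := W) (G := G) (((mapTo G).map i.op).app n σ) θ w =
      SNat.ev σ θ (wev i w) := by
  change SNat.ev (W := W) (G := G) (scomp (simplex i n) σ) θ w = _
  rw [SNat.ev_scomp, ev_simplex]

/-- The simplicial set represented by `n`. -/
def repr (n : SimplexCategoryᵒᵖ) : SSet.{v} where
  obj m := ULift.{v} (n ⟶ m)
  map φ := ↾fun y ↦ ⟨y.down ≫ φ⟩

/-- The simplex of `repr n` given by a map from `n`. -/
def reprMk {n m : SimplexCategoryᵒᵖ} (θ : n ⟶ m) : (repr.{v} n).obj m := ⟨θ⟩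

/-- Simplices of `Map W G` are maps from `W` to a cotensor of `G`. -/
def mapEquiv (W G : Weight A) (n : SimplexCategoryᵒᵖ) :
    (Map W G).obj n ≃ (W ⟶ cotensor (repr.{v} n) G) where
  toFun σ := ofWev (G := cotensor (repr.{v} n) G)
    (fun {a m} w ↦ ofCev (fun {l} θ y ↦ SNat.ev σ y.down ((W.obj a).map θ w)) (fun θ φ y ↦ by
      rw [SNat.map_ev, CategoryTheory.Functor.map_comp_apply]
      rfl))
    (fun {a m l'} φ w ↦ ext_cev fun l ψ y ↦ by
      change SNat.ev σ y.down ((W.obj a).map (φ ≫ ψ) w) =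
        SNat.ev σ y.down ((W.obj a).map ψ ((W.obj a).map φ w))
      rw [CategoryTheory.Functor.map_comp_apply])
    (fun w x ↦ ext_cev fun l ψ y ↦ by
      rw [cev_act]
      change SNat.ev σ _ _ = act G (SNat.ev σ _ _) _
      rw [map_act, SNat.ev_act])
  invFun f := SNat.ofEv (W := W) (G := G)
    -- A map θ from n to m is itself an m-simplex of the standard simplex, and the value of σ at θ
    -- is recovered by evaluating the cotensor there.
    (fun {a m} θ w ↦ cev (wev f w) (𝟙 m) (reprMk θ))
    (fun {a m l} θ φ w ↦ by
      rw [map_cev, ← map_wev, cev_map, Category.id_comp, Category.comp_id]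
      rfl)
    (fun {a b m} θ w x ↦ by
      rw [wev_act, cev_act, CategoryTheory.Functor.map_id_apply])
  left_inv σ := SNat.ext_ev fun a m θ w ↦ by
    change SNat.ev σ θ ((W.obj a).map (𝟙 m) w) = _
    rw [CategoryTheory.Functor.map_id_apply]
  right_inv f := hom_ext_wev fun a m w ↦ ext_cev fun l θ y ↦ by
    change cev (wev f ((W.obj a).map θ w)) (𝟙 l) y = _
    rw [← map_wev, cev_map, Category.comp_id]

/-- The functors `W ↦ (Map W G).obj n` are representable. -/
def mapToEvaluationIso (G : Weight A) (n : SimplexCategoryᵒᵖ) :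
    mapTo G ⋙ (evaluation SimplexCategoryᵒᵖ (Type v)).obj n ≅
      yoneda.obj (cotensor (repr.{v} n) G) :=
  NatIso.ofComponents (fun W ↦ (mapEquiv W.unop G n).toIso) (fun {W W'} i ↦ by
    ext σ
    refine hom_ext_wev fun a m w ↦ ext_cev fun l θ y ↦ ?_
    refine (ev_mapTo_map G i.unop σ y.down _).trans ?_
    rw [← map_wev]
    rfl)

/-- In each dimension the functor is representable, by the cotensor of `G` with a standard simplex,
and limits of simplicial sets are computed dimensionwise. -/
instance (G : Weight A) {J : Type*} [Category* J] : PreservesLimitsOfShape J (mapTo G) where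
  preservesLimit {F} := ⟨fun {c} hc ↦ ⟨evaluationJointlyReflectsLimits _ fun n ↦ by
    have := preservesLimit_of_natIso F (mapToEvaluationIso G n).symm
    exact isLimitOfPreserves (mapTo G ⋙ (evaluation SimplexCategoryᵒᵖ (Type v)).obj n) hc⟩⟩

/-! ### The Yoneda lemma for the weights of cells. -/

section TensorRep

variable (U : SSet.{v}) (a : A) (G : Weight A)

variable {U a} in
/-- The simplices of the weight `U × Map a -`. -/
def tpair {b : A} {n : SimplexCategoryᵒᵖ} (y : U.obj n) (x : (Map a b).obj n) :
    ((tensorRep U a).obj b).obj n :=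
  spair (X := U) (Y := Map a b) y x

variable {U a} in
lemma exists_eq_tpair {b : A} {n : SimplexCategoryᵒᵖ} (p : ((tensorRep U a).obj b).obj n) :
    ∃ (y : U.obj n) (x : (Map a b).obj n), p = tpair y x :=
  ⟨p.1, p.2, rfl⟩

variable {U a} in
lemma map_tpair {b : A} {n m : SimplexCategoryᵒᵖ} (θ : n ⟶ m) (y : U.obj n)
    (x : (Map a b).obj n) :
    ((tensorRep U a).obj b).map θ (tpair y x) = tpair (U.map θ y) ((Map a b).map θ x) :=
  rfl

variable {U a} in
lemma act_tpair {b c : A} {n : SimplexCategoryᵒᵖ} (y : U.obj n) (x : (Map a b).obj n)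
    (z : (Map b c).obj n) :
    act (tensorRep U a) (tpair y x) z = tpair y (scomp x z) :=
  act_ofAction (fun b ↦ U ⊗ Map a b) (fun p x ↦ spair p.1 (scomp p.2 x)) _ _ _ _ z

/-- The Yoneda lemma for the weights `U × Map a -`. -/
def tensorRepEquiv (n : SimplexCategoryᵒᵖ) :
    (Map (tensorRep U a) G).obj n ≃ (Functor.functorHom U (G.obj a)).obj n where
  toFun σ := ofHev (fun {m} θ y ↦ SNat.ev σ θ (tpair y (sid a m)))
    (fun {m l} θ φ y ↦ by
      rw [SNat.map_ev, map_tpair, map_sid])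
  -- The formula is forced by naturality, since a pair (y, x) is the action of x on (y, id).
  invFun h := SNat.ofEv (W := tensorRep U a) (G := G) (fun {b m} θ p ↦ act G (hev h θ p.1) p.2)
    (fun θ φ p ↦ by
      rw [map_act, map_hev]
      rfl)
    (fun {b c m} θ p x ↦ by
      obtain ⟨y, z, rfl⟩ := exists_eq_tpair p
      rw [← act_scomp, act_tpair]
      rfl)
  left_inv σ := SNat.ext_ev fun b m θ p ↦ by
    obtain ⟨y, z, rfl⟩ := exists_eq_tpair p
    refine (SNat.ev_act σ θ _ _).symm.trans ?_
    refine congrArg (fun w ↦ SNat.ev σ θ w) ?_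
    refine (act_tpair _ _ _).trans (congrArg (tpair y) (sid_scomp z))
  right_inv h := ext_hev fun m θ y ↦ act_sid G _

variable {U a G} in
lemma hev_tensorRepEquiv {n m : SimplexCategoryᵒᵖ} (σ : (Map (tensorRep U a) G).obj n)
    (θ : n ⟶ m) (y : U.obj m) :
    hev (tensorRepEquiv U a G n σ) θ y = SNat.ev σ θ (tpair y (sid a m)) :=
  rfl

variable {U a} in
lemma wev_tensorRepMap {V : SSet.{v}} (f : U ⟶ V) {b : A} {n : SimplexCategoryᵒᵖ}
    (y : U.obj n) (x : (Map a b).obj n) :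
    wev (tensorRepMap f a) (tpair y x) = tpair (f.app n y) x :=
  rfl

end TensorRep

/-! ### Weighted limits as representations of the presheaf of cones. -/

section Presheaf

variable {K : Type u} [Category.{v} K] [SimplicialCategory K]

lemma homIntoPre_scomp (F : SFun A K) {X Y Z : K} {n : SimplexCategoryᵒᵖ} (f : (Map X Y).obj n)
    (g : (Map Y Z).obj n) :
    (homIntoPre F X Z).app n (scomp f g) =
      scomp (X := homInto F Z) (Y := homInto F Y) (Z := homInto F X)
        ((homIntoPre F Y Z).app n g) ((homIntoPre F X Y).app n f) :=
  SNat.ext_ev (W := homInto F Z) (G := homInto F X) fun a m θ h ↦ by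
    change scomp ((Map X Z).map θ (scomp f g)) h =
      scomp ((Map X Y).map θ f) (scomp ((Map Y Z).map θ g) h)
    rw [map_scomp]
    exact scomp_assoc _ _ _

lemma homIntoPre_sid (F : SFun A K) (X : K) (n : SimplexCategoryᵒᵖ) :
    (homIntoPre F X X).app n (sid X n) = sid (homInto F X) n :=
  SNat.ext_ev (W := homInto F X) (G := homInto F X) fun a m θ h ↦ by
    change scomp ((Map X X).map θ (sid X n)) h = h
    rw [map_sid]
    exact sid_scomp _

lemma map_homIntoPre (F : SFun A K) (X L : K) {n m : SimplexCategoryᵒᵖ} (θ : n ⟶ m)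
    (x : (Map X L).obj n) :
    (Map (homInto F L) (homInto F X)).map θ ((homIntoPre F X L).app n x) =
      (homIntoPre F X L).app m ((Map X L).map θ x) :=
  (NatTrans.naturality_apply (homIntoPre F X L) θ x).symm

/-- The simplicial presheaves `X ↦ Map W (Map X (F -))`. -/
def conePresheaf (F : SFun A K) : (Weight A)ᵒᵖ ⥤ Plex K ⥤ Type v where
  obj W :=
    { obj x := (Map W.unop (homInto F x.pt)).obj x.dim
      map {x y} f := ↾fun σ ↦ scomp ((Map W.unop (homInto F x.pt)).map f.1 σ)
        ((homIntoPre F y.pt x.pt).app y.dim f.2)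
      map_id x := by
        ext σ
        change scomp ((Map W.unop (homInto F x.pt)).map (𝟙 _) σ)
          ((homIntoPre F x.pt x.pt).app x.dim (sid x.pt x.dim)) = σ
        rw [homIntoPre_sid, scomp_sid, CategoryTheory.Functor.map_id_apply]
      map_comp {x y z} f g := by
        ext σ
        change scomp ((Map W.unop (homInto F x.pt)).map (f.1 ≫ g.1) σ)
          ((homIntoPre F z.pt x.pt).app z.dim (scomp g.2 ((Map y.pt x.pt).map g.1 f.2))) =
          scomp ((Map W.unop (homInto F y.pt)).map g.1 (scomp _ _)) _
        rw [homIntoPre_scomp, map_scomp, scomp_assoc, CategoryTheory.Functor.map_comp_apply,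
          map_homIntoPre] }
  map {W W'} i :=
    { app x := ((mapTo (homInto F x.pt)).map i).app x.dim
      naturality x y f := by
        ext σ
        change scomp (simplex i.unop y.dim) (scomp ((Map W.unop (homInto F x.pt)).map f.1 σ)
          ((homIntoPre F y.pt x.pt).app y.dim f.2)) =
          scomp ((Map W'.unop (homInto F x.pt)).map f.1 (scomp (simplex i.unop x.dim) σ)) _
        rw [map_scomp, map_simplex, scomp_assoc] }
  map_id W := by
    ext x σ
    change ((mapTo (homInto F x.pt)).map (𝟙 W)).app x.dim σ = σ
    rw [CategoryTheory.Functor.map_id]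
    rfl
  map_comp i j := by
    ext x σ
    change ((mapTo (homInto F x.pt)).map (i ≫ j)).app x.dim σ = _
    rw [CategoryTheory.Functor.map_comp]
    rfl

instance (F : SFun A K) {J : Type*} [Category* J] :
    PreservesLimitsOfShape J (conePresheaf F) where
  preservesLimit := ⟨fun hc ↦ ⟨evaluationJointlyReflectsLimits _ fun x ↦
    isLimitOfPreserves ((evaluation SimplexCategoryᵒᵖ (Type v)).obj x.dim)
      (isLimitOfPreserves (mapTo (homInto F x.pt)) hc)⟩⟩

lemma wev_homIntoPostMap {F G : SFun A K} (κ : F ⟶ G) (L : K) {a : A} {m : SimplexCategoryᵒᵖ}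
    (g : (Map L (F.obj a)).obj m) :
    wev (homIntoPostMap κ L) g = scomp g (simplex (component κ a) m) := by
  refine (ev_homIntoPost F G L _ _ g).trans (congrArg (scomp g) ?_)
  rw [component, simplex_symm]
  have := (SSet.unitHomEquiv (Map F G)).apply_symm_apply κ
  exact congrArg (fun z ↦ (Map (F.obj a) (G.obj a)).map (fromZero m) (SNat.app z a)) this

/-- The map of simplicial presheaves induced by a map of diagrams. -/
def conePresheafMap {F G : SFun A K} (κ : F ⟶ G) : conePresheaf F ⟶ conePresheaf G where
  app W :=
    { app x := (eHomWhiskerLeft SSet.{v} W.unop (homIntoPostMap κ x.pt)).app x.dim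
      naturality x y f := by
        ext σ
        refine SNat.ext_ev (W := W.unop) (G := homInto G y.pt) fun a m θ w ↦ ?_
        refine (ev_simplex _ θ _).trans ((wev_homIntoPostMap κ y.pt _).trans
          ((scomp_assoc _ _ _).trans (congrArg (scomp _) ?_)))
        exact ((ev_simplex _ _ _).trans (wev_homIntoPostMap κ x.pt _)).symm }
  naturality {W W'} i := by
    ext x σ
    exact scomp_assoc (simplex i.unop x.dim) σ (simplex (homIntoPostMap κ x.pt) x.dim)

/-- The map from a representable simplicial presheaf given by a cone. -/
def coneHom {F : SFun A K} {W : Weight A} {L : K} (Λ : W ⟶ homInto F L) :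
    (eYoneda K).obj L ⟶ (conePresheaf F).obj (op W) where
  app x := (comparison Λ x.pt).app x.dim
  naturality x y f := by
    ext (g : (Map x.pt L).obj x.dim)
    change scomp (simplex Λ y.dim) ((homIntoPre F y.pt L).app y.dim
      (scomp f.2 ((Map x.pt L).map f.1 g))) =
      scomp ((Map W (homInto F x.pt)).map f.1 (scomp (simplex Λ x.dim)
        ((homIntoPre F x.pt L).app x.dim g))) ((homIntoPre F y.pt x.pt).app y.dim f.2)
    rw [homIntoPre_scomp, map_scomp, map_simplex, scomp_assoc]
    exact congrArg (fun z ↦ scomp _ (scomp z _)) (map_homIntoPre F _ _ f.1 g).symm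

lemma comparison_app {F : SFun A K} {W : Weight A} {L : K} (Λ : W ⟶ homInto F L) (X : K)
    {n : SimplexCategoryᵒᵖ} (x : (Map X L).obj n) :
    (comparison Λ X).app n x = scomp (simplex Λ n) ((homIntoPre F X L).app n x) :=
  rfl

/-- Isomorphisms, both of simplicial sets and of presheaves on `Plex K`, are detected at each pair
(X, n). Existence of limits thereby becomes a question of representability. -/
lemma isWeightedLimit_iff_isIso_coneHom {F : SFun A K} {W : Weight A} {L : K}
    (Λ : W ⟶ homInto F L) : IsWeightedLimit Λ ↔ IsIso (coneHom Λ) := by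
  rw [NatTrans.isIso_iff_isIso_app]
  constructor
  · intro h x
    have := h x.pt
    exact (NatTrans.isIso_iff_isIso_app (comparison Λ x.pt)).1 this x.dim
  · intro h X
    rw [NatTrans.isIso_iff_isIso_app]
    exact fun n ↦ h ⟨X, n⟩

/-- Yoneda: the value of η at the identity vertex is a cone, and it determines η. -/
lemma exists_eq_coneHom {F : SFun A K} {W : Weight A} {L : K}
    (η : (eYoneda K).obj L ⟶ (conePresheaf F).obj (op W)) :
    ∃ Λ : W ⟶ homInto F L, η = coneHom Λ := by
  refine ⟨η.app ⟨L, op ⦋0⦌⟩ (sid L (op ⦋0⦌)), ?_⟩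
  ext ⟨X, n⟩ g
  have := NatTrans.naturality_apply η (Plex.toZero g) (sid L (op ⦋0⦌))
  rw [eYoneda_obj_map, map_sid, scomp_sid] at this
  refine Eq.trans this (congrArg (fun z ↦ scomp z ((homIntoPre F X L).app n g)) ?_)
  refine Eq.trans ?_ (simplex_eq_map _ n).symm
  exact congrArg ((Map W (homInto F L)).map (fromZero n))
    ((SSet.unitHomEquiv (Map W (homInto F L))).apply_symm_apply _).symm

end Presheaf

end Weights

/-! ### Projective cells and isofibrations -/

section Cells

variable {A : Type v} [EnrichedCategory SSet.{v} A]
  {K : Type u} [Category.{v} K] [SimplicialCategory K]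

lemma eYoneda_hom_ext {L : K} {P : Plex K ⥤ Type v} {η η' : (eYoneda K).obj L ⟶ P}
    (h : η.app ⟨L, op ⦋0⦌⟩ (sid L (op ⦋0⦌)) = η'.app ⟨L, op ⦋0⦌⟩ (sid L (op ⦋0⦌))) : η = η' := by
  ext ⟨X, n⟩ g
  have h₁ := NatTrans.naturality_apply η (Plex.toZero g) (sid L (op ⦋0⦌))
  have h₂ := NatTrans.naturality_apply η' (Plex.toZero g) (sid L (op ⦋0⦌))
  rw [eYoneda_obj_map, map_sid, scomp_sid] at h₁ h₂
  exact h₁.trans ((congrArg _ h).trans h₂.symm)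

lemma simplex_weight {W G : Weight A} (f : W ⟶ G) : simplex f (op ⦋0⦌) = f :=
  SNat.ext_ev (W := W) (G := G) fun _ _ θ w ↦ (ev_simplex f θ w).trans (wev_eq f θ w).symm

variable {F G : SFun A K} {W W' : Weight A} {L L' : K}

lemma coneHom_app_sid (Λ : W ⟶ homInto F L) :
    (coneHom Λ).app ⟨L, op ⦋0⦌⟩ (sid L (op ⦋0⦌)) = Λ := by
  change scomp (simplex Λ (op ⦋0⦌)) ((homIntoPre F L L).app (op ⦋0⦌) (sid L (op ⦋0⦌))) = Λ
  rw [homIntoPre_sid, scomp_sid, simplex_weight]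

/-- Both composites start at a representable presheaf, hence are determined by their values at the
identity vertex; these are the two sides of the defining equation. -/
lemma isInducedByWeight_iff (Λ : W ⟶ homInto F L) (Λ' : W' ⟶ homInto F L') (i : W ⟶ W')
    (f : L' ⟶ L) : IsInducedByWeight Λ Λ' i f ↔
      (eYoneda K).map f ≫ coneHom Λ = coneHom Λ' ≫ (conePresheaf F).map i.op := by
  have h₁ : ((eYoneda K).map f ≫ coneHom Λ).app ⟨L', op ⦋0⦌⟩ (sid L' (op ⦋0⦌)) =
      Λ ≫ homIntoPreMap F f := by
    change scomp (simplex Λ (op ⦋0⦌)) ((homIntoPre F L' L).app (op ⦋0⦌)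
      (scomp (sid L' (op ⦋0⦌)) (simplex f (op ⦋0⦌)))) = _
    rw [sid_scomp, simplex_weight]
    rfl
  have h₂ : (coneHom Λ' ≫ (conePresheaf F).map i.op).app ⟨L', op ⦋0⦌⟩ (sid L' (op ⦋0⦌)) =
      i ≫ Λ' := by
    change scomp (simplex i (op ⦋0⦌)) ((coneHom Λ').app ⟨L', op ⦋0⦌⟩ (sid L' (op ⦋0⦌))) = _
    rw [coneHom_app_sid, simplex_weight]
    rfl
  constructor
  · intro h
    exact eYoneda_hom_ext (h₁.trans (Eq.trans h h₂.symm))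
  · intro h
    refine h₁.symm.trans (Eq.trans ?_ h₂)
    rw [h]

lemma isInducedByDiagram_iff (Λ : W ⟶ homInto F L) (Γ : W ⟶ homInto G L') (κ : F ⟶ G)
    (f : L ⟶ L') : IsInducedByDiagram Λ Γ κ f ↔
      (eYoneda K).map f ≫ coneHom Γ = coneHom Λ ≫ (conePresheafMap κ).app (op W) := by
  have h₁ : ((eYoneda K).map f ≫ coneHom Γ).app ⟨L, op ⦋0⦌⟩ (sid L (op ⦋0⦌)) =
      Γ ≫ homIntoPreMap G f := by
    change scomp (simplex Γ (op ⦋0⦌)) ((homIntoPre G L L').app (op ⦋0⦌)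
      (scomp (sid L (op ⦋0⦌)) (simplex f (op ⦋0⦌)))) = _
    rw [sid_scomp, simplex_weight]
    rfl
  have h₂ : (coneHom Λ ≫ (conePresheafMap κ).app (op W)).app ⟨L, op ⦋0⦌⟩ (sid L (op ⦋0⦌)) =
      Λ ≫ homIntoPostMap κ L := by
    change scomp ((coneHom Λ).app ⟨L, op ⦋0⦌⟩ (sid L (op ⦋0⦌)))
      (simplex (homIntoPostMap κ L) (op ⦋0⦌)) = _
    rw [coneHom_app_sid, simplex_weight]
    rfl
  constructor
  · intro h
    exact eYoneda_hom_ext (h₁.trans (Eq.trans h h₂.symm))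
  · intro h
    refine h₁.symm.trans (Eq.trans ?_ h₂)
    rw [h]

lemma existsUnique_isInducedByWeight {Λ : W ⟶ homInto F L} (hΛ : IsWeightedLimit Λ)
    (Λ' : W' ⟶ homInto F L') (i : W ⟶ W') : ∃! f : L' ⟶ L, IsInducedByWeight Λ Λ' i f := by
  have := (isWeightedLimit_iff_isIso_coneHom Λ).1 hΛ
  simp only [isInducedByWeight_iff, ← IsIso.eq_comp_inv]
  exact ⟨(eYoneda K).preimage _, Functor.map_preimage _ _,
    fun f hf ↦ (eYoneda K).map_injective (hf.trans (Functor.map_preimage _ _).symm)⟩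

lemma existsUnique_isInducedByDiagram (Λ : W ⟶ homInto F L) {Γ : W ⟶ homInto G L'}
    (hΓ : IsWeightedLimit Γ) (κ : F ⟶ G) : ∃! f : L ⟶ L', IsInducedByDiagram Λ Γ κ f := by
  have := (isWeightedLimit_iff_isIso_coneHom Γ).1 hΓ
  simp only [isInducedByDiagram_iff, ← IsIso.eq_comp_inv]
  exact ⟨(eYoneda K).preimage _, Functor.map_preimage _ _,
    fun f hf ↦ (eYoneda K).map_injective (hf.trans (Functor.map_preimage _ _).symm)⟩

/-! ### Limits weighted by U × Map(a, -) are cotensors. -/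

section CotensorCone

variable {U V : SSet.{v}} {a : A} {P P' : K}

/-- The cone weighted by `U × Map a -` given by a map from `U`. -/
def cotensorCone (F : SFun A K) (κ : U ⟶ Map P (F.obj a)) : tensorRep U a ⟶ homInto F P :=
  ofWev (fun {b m} p ↦ scomp (κ.app m p.1) ((F.map a b).app m p.2))
    (fun {b m l} φ p ↦ by
      refine (map_scomp φ _ _).trans ?_
      exact congrArg₂ scomp (NatTrans.naturality_apply κ φ p.1).symm
        (NatTrans.naturality_apply (F.map a b) φ p.2).symm)
    (fun {b c m} p x ↦ by
      obtain ⟨y, z, rfl⟩ := exists_eq_tpair p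
      rw [act_tpair]
      refine Eq.trans ?_ (act_homInto F P _ x).symm
      refine Eq.trans ?_ (scomp_assoc _ _ _).symm
      exact congrArg (scomp _) (map_app_scomp F.toEnrichedFunctor z x))

lemma wev_cotensorCone (κ : U ⟶ Map P (F.obj a)) {b : A} {m : SimplexCategoryᵒᵖ} (y : U.obj m)
    (x : (Map a b).obj m) :
    wev (cotensorCone F κ) (tpair y x) = scomp (κ.app m y) ((F.map a b).app m x) :=
  rfl

/-- By the Yoneda lemma for U × Map(a, -), cones of this weight with summit X are maps from U to Map
X (F a), and under this bijection the comparison becomes the universal property of the cotensor. -/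
lemma isWeightedLimit_cotensorCone {κ : U ⟶ Map P (F.obj a)} (hκ : IsCotensor U (F.obj a) κ) :
    IsWeightedLimit (cotensorCone F κ) := by
  intro X
  rw [NatTrans.isIso_iff_isIso_app]
  intro n
  have h₁ := (NatTrans.isIso_iff_isIso_app _).1 (hκ X) n
  rw [isIso_iff_bijective] at h₁ ⊢
  rw [← (tensorRepEquiv U a (homInto F X) n).bijective.of_comp_iff']
  suffices H : (fun g ↦ tensorRepEquiv U a (homInto F X) n
      ((comparison (cotensorCone F κ) X).app n g)) = (fun g ↦ (precomp X P (F.obj a) ≫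
        eHomWhiskerRight SSet.{v} κ (Map X (F.obj a))).app n g) from
    (congrArg Function.Bijective H).mpr h₁
  funext g
  refine ext_hev (U := U) (X := Map X (F.obj a)) fun m θ y ↦ ?_
  refine (hev_tensorRepEquiv _ θ y).trans ?_
  rw [comparison_app, SNat.ev_scomp, ev_simplex]
  refine (ev_homIntoPre F X P g θ _).trans ?_
  rw [wev_cotensorCone, map_app_sid, scomp_sid]
  rfl

lemma isInducedByWeight_cotensorCone {κ : U ⟶ Map P (F.obj a)} {κ' : V ⟶ Map P' (F.obj a)}
    {i : U ⟶ V} {f : P' ⟶ P} :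
    IsInducedByWeight (cotensorCone F κ) (cotensorCone F κ') (tensorRepMap i a) f ↔
      IsCotensorMapLeft κ κ' i f := by
  constructor
  · intro h
    ext m y
    have := congrArg (fun g ↦ wev g (tpair y (sid a m))) h
    simp only [wev_comp, wev_tensorRepMap, wev_cotensorCone] at this
    rw [map_app_sid, scomp_sid, scomp_sid] at this
    refine Eq.trans ?_ this
    refine Eq.trans ?_ (congrArg (fun z ↦ scomp z _) (map_simplex f _)).symm
    rfl
  · intro h
    refine hom_ext_wev fun b m p ↦ ?_
    obtain ⟨y, x, rfl⟩ := exists_eq_tpair p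
    have := ConcreteCategory.congr_hom (NatTrans.congr_app h m) y
    rw [wev_comp, wev_comp, wev_tensorRepMap, wev_cotensorCone, wev_cotensorCone]
    refine Eq.trans ?_ (congrArg (fun z ↦ scomp z _) this)
    refine Eq.trans ?_ (scomp_assoc _ _ _).symm
    refine (ev_homIntoPre F _ _ _ _ _).trans ?_
    exact congrArg (fun z ↦ scomp z _) (map_simplex f _)

lemma isInducedByDiagram_cotensorCone {κ : U ⟶ Map P (F.obj a)} {κ' : U ⟶ Map P' (G.obj a)}
    {τ : F ⟶ G} {f : P ⟶ P'} (h : IsInducedByDiagram (cotensorCone F κ) (cotensorCone G κ') τ f) :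
    IsCotensorMapRight κ κ' (component τ a) f := by
  ext m y
  have := congrArg (fun g ↦ wev g (tpair y (sid a m))) h
  simp only [wev_comp] at this
  replace this := this.trans (wev_homIntoPostMap τ P _)
  rw [wev_cotensorCone, wev_cotensorCone, map_app_sid, scomp_sid, map_app_sid, scomp_sid] at this
  refine Eq.trans ?_ this
  refine Eq.trans ?_ (congrArg (fun z ↦ scomp z _) (map_simplex f _)).symm
  rfl

end CotensorCone

/-- The internal hom out of an empty simplicial set is a point, so each object has exactly one map
to P. -/
lemma isCotensor_hom_ext_of_isEmpty {U : SSet.{v}} (hU : ∀ n, IsEmpty (U.obj n)) {B P : K}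
    {κ : U ⟶ Map P B} (hκ : IsCotensor U B κ) : Nonempty (IsTerminal P) := by
  have key (X : K) : Function.Bijective (fun f : X ⟶ P ↦
      (precomp X P B ≫ eHomWhiskerRight SSet.{v} κ (Map X B)).app (op ⦋0⦌)
        (SimplicialCategory.homEquiv' X P f)) :=
    ((isIso_iff_bijective _).1 ((NatTrans.isIso_iff_isIso_app _).1 (hκ X) (op ⦋0⦌))).comp
      (SimplicialCategory.homEquiv' X P).bijective
  have hs (X : K) (h h' : (Functor.functorHom U (Map X B)).obj (op ⦋0⦌)) : h = h' :=
    ext_hev fun m _ y ↦ ((hU m).false y).elim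
  have hne (X : K) : (Functor.functorHom U (Map X B)).obj (op ⦋0⦌) :=
    ofHev (fun {m} _ y ↦ ((hU m).false y).elim) (fun {m _} _ _ y ↦ ((hU m).false y).elim)
  exact ⟨IsTerminal.ofUniqueHom (fun X ↦ ((key X).2 (hne X)).choose)
    (fun X f ↦ (key X).1 (hs X _ _))⟩

/-! ### Leibniz maps of cells are isofibrations. -/

namespace InfinityCosmos

variable (𝒦 : InfinityCosmos K)

/-- This is the Leibniz axiom for the inclusion of the empty simplicial set: cotensors by it are
terminal, so the pullback reduces to the cotensor of B by U. -/
lemma isofibration_cotensor {U : SSet.{v}} {E B EU BU : K} {p : E ⟶ B} (hp : 𝒦.isofibration p)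
    {κE : U ⟶ Map EU E} {κB : U ⟶ Map BU B} (hE : IsCotensor U E κE) (hB : IsCotensor U B κB)
    {f : EU ⟶ BU} (hf : IsCotensorMapRight κE κB p f) : 𝒦.isofibration f := by
  let N : SSet.Subcomplex U := ⊥
  have hN (n) : IsEmpty (N.toSSet.obj n) := ⟨fun y ↦ y.2⟩
  have hN' {Y : SSet.{v}} (g g' : N.toSSet ⟶ Y) : g = g' := by
    ext n y
    exact ((hN n).false y).elim
  obtain ⟨E₀, κ₀, h₀⟩ := 𝒦.hasCotensors N.toSSet E
  obtain ⟨B₀, κ₁, h₁⟩ := 𝒦.hasCotensors N.toSSet B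
  obtain ⟨hE₀⟩ := isCotensor_hom_ext_of_isEmpty hN h₀
  obtain ⟨hB₀⟩ := isCotensor_hom_ext_of_isEmpty hN h₁
  have : IsIso (hB₀.from E₀) := isIso_of_isTerminal hE₀ hB₀ _
  exact 𝒦.isofibration_leibniz N.ι p hp hE h₀ hB h₁
    (iE := hE₀.from _) (iB := hB₀.from _) (pV := f) (pU := hB₀.from _)
    (hN' _ _) (hN' _ _) hf (hN' _ _) (Q := BU) (fst := hE₀.from _) (snd := 𝟙 BU)
    (IsPullback.of_vert_isIso ⟨hB₀.hom_ext _ _⟩) f (hE₀.hom_ext _ _) (Category.comp_id f)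

/-- Cotensors of F a and G a by U and V represent the four corners. The Leibniz axiom applies to
them in K, and the Yoneda embedding carries the resulting isofibration to the Leibniz map of
presheaves. -/
lemma presheafIsofibration_leibniz_cell {κ : F ⟶ G}
    (hκ : ∀ a, 𝒦.isofibration (component κ a)) {U V : SSet.{v}} (i : U ⟶ V) [Mono i] (a : A) :
    𝒦.presheafIsofibration (leibniz (conePresheafMap κ) (tensorRepMap i a)) := by
  obtain ⟨EV, κEV, hEV⟩ := 𝒦.hasCotensors V (F.obj a)
  obtain ⟨EU, κEU, hEU⟩ := 𝒦.hasCotensors U (F.obj a)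
  obtain ⟨BV, κBV, hBV⟩ := 𝒦.hasCotensors V (G.obj a)
  obtain ⟨BU, κBU, hBU⟩ := 𝒦.hasCotensors U (G.obj a)
  have hEV' := isWeightedLimit_cotensorCone (F := F) hEV
  have hEU' := isWeightedLimit_cotensorCone (F := F) hEU
  have hBV' := isWeightedLimit_cotensorCone (F := G) hBV
  have hBU' := isWeightedLimit_cotensorCone (F := G) hBU
  obtain ⟨iE, hiE, -⟩ := existsUnique_isInducedByWeight hEU' (cotensorCone F κEV) (tensorRepMap i a)
  obtain ⟨iB, hiB, -⟩ := existsUnique_isInducedByWeight hBU' (cotensorCone G κBV) (tensorRepMap i a)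
  obtain ⟨pV, hpV, -⟩ := existsUnique_isInducedByDiagram (cotensorCone F κEV) hBV' κ
  obtain ⟨pU, hpU, -⟩ := existsUnique_isInducedByDiagram (cotensorCone F κEU) hBU' κ
  have hpU' := isInducedByDiagram_cotensorCone hpU
  -- This is what makes the pullback of E^U and B^V over B^U exist in K.
  have hpU'' := 𝒦.isofibration_cotensor (hκ a) hEU hBU hpU'
  have := 𝒦.hasPullbacks pU iB hpU''
  have := preservesLimit_eYoneda (cospan pU iB)
  have sq := IsPullback.of_hasPullback pU iB
  -- The limit cone of B^U is a monomorphism of presheaves, so commutativity can be checked on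
  -- cones, where it is naturality in the weight.
  have w : iE ≫ pU = pV ≫ iB := by
    have := (isWeightedLimit_iff_isIso_coneHom _).1 hBU'
    refine (eYoneda K).map_injective ?_
    rw [← cancel_mono (coneHom (cotensorCone G κBU)), Functor.map_comp, Functor.map_comp,
      Category.assoc, Category.assoc, (isInducedByDiagram_iff _ _ _ _).1 hpU,
      (isInducedByWeight_iff _ _ _ _).1 hiB, ← Category.assoc,
      (isInducedByWeight_iff _ _ _ _).1 hiE, ← Category.assoc ((eYoneda K).map pV),
      (isInducedByDiagram_iff _ _ _ _).1 hpV, Category.assoc, Category.assoc, NatTrans.naturality]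
  have hl := 𝒦.isofibration_leibniz i (component κ a) (hκ a) hEV hEU hBV hBU
    (isInducedByWeight_cotensorCone.1 hiE) (isInducedByWeight_cotensorCone.1 hiB)
    (isInducedByDiagram_cotensorCone hpV) hpU' sq (sq.lift iE pV w) (sq.lift_fst _ _ _)
    (sq.lift_snd _ _ _)
  have := (isWeightedLimit_iff_isIso_coneHom _).1 hEV'
  have := (isWeightedLimit_iff_isIso_coneHom _).1 hEU'
  have := (isWeightedLimit_iff_isIso_coneHom _).1 hBV'
  have := (isWeightedLimit_iff_isIso_coneHom _).1 hBU'
  have sq' := (sq.map (eYoneda K)).of_iso (Iso.refl _) (asIso (coneHom (cotensorCone F κEU)))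
    (asIso (coneHom (cotensorCone G κBV))) (asIso (coneHom (cotensorCone G κBU)))
    (fst' := (eYoneda K).map (pullback.fst pU iB) ≫ coneHom (cotensorCone F κEU))
    (snd' := (eYoneda K).map (pullback.snd pU iB) ≫ coneHom (cotensorCone G κBV))
    (f' := (conePresheafMap κ).app _) (g' := (conePresheaf G).map (tensorRepMap i a).op)
    (by simp) (by simp) ((isInducedByDiagram_iff _ _ _ _).1 hpU)
    ((isInducedByWeight_iff _ _ _ _).1 hiB)
  refine ⟨_, _, _, hl, ⟨Arrow.isoMk (asIso (coneHom (cotensorCone F κEV))) sq'.isoPullback ?_⟩⟩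
  refine pullback.hom_ext ?_ ?_
  · simp only [Arrow.mk_hom, asIso_hom, Category.assoc, leibniz_fst,
      IsPullback.isoPullback_hom_fst]
    rw [← Category.assoc, ← Functor.map_comp, sq.lift_fst]
    exact ((isInducedByWeight_iff _ _ _ _).1 hiE).symm
  · simp only [Arrow.mk_hom, asIso_hom, Category.assoc, leibniz_snd,
      IsPullback.isoPullback_hom_snd]
    rw [← Category.assoc, ← Functor.map_comp, sq.lift_snd]
    exact ((isInducedByDiagram_iff _ _ _ _).1 hpV).symm

end InfinityCosmos

end Cells

/-! ### Flexible limits and isofibrations -/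

section FlexibleLimits

variable {A : Type v} [EnrichedCategory SSet.{v} A]
  {K : Type u} [Category.{v} K] [SimplicialCategory K]

lemma exists_isTerminal_of_unique {C : Type u₁} [Category.{u₂} C] (P : C ⥤ Type v)
    (h : ∀ x, Nonempty (Unique (P.obj x))) : Nonempty (IsTerminal P) := by
  have := fun x ↦ (h x).some
  refine ⟨IsTerminal.ofUniqueHom (fun Q ↦ { app x := ↾fun _ ↦ default }) (fun Q f ↦ ?_)⟩
  ext x q
  exact Subsingleton.elim _ _

/-- There is exactly one cone weighted by an empty weight, for every summit and in every dimension.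
-/
lemma unique_conePresheaf_of_isEmpty (F : SFun A K) {V : Weight A}
    (hV : ∀ a n, IsEmpty ((V.obj a).obj n)) : Nonempty (IsTerminal ((conePresheaf F).obj (op V))) :=
  exists_isTerminal_of_unique _ fun x ↦ ⟨⟨⟨SNat.ofEv (W := V) (G := homInto F x.pt)
    (fun {a m} _ w ↦ ((hV a m).false w).elim) (fun {a m _} _ _ w ↦ ((hV a m).false w).elim)
    (fun {a _ m} _ w _ ↦ ((hV a m).false w).elim)⟩,
    fun _ ↦ SNat.ext_ev (W := V) (G := homInto F x.pt) fun a m _ w ↦ ((hV a m).false w).elim⟩⟩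

/-- The constant diagram at an object `T` whose hom-spaces `Map X T` are points. -/
def constTerminal (A : Type v) [EnrichedCategory SSet.{v} A] (T : K)
    (hT : ∀ (X : K) n, Subsingleton ((Map X T).obj n)) : SFun A K where
  obj _ := T
  map a b := { app n := ↾fun _ ↦ sid T n
               naturality n m θ := by
                 ext _
                 exact (map_sid T θ).symm }
  map_id a := by
    ext n _
    exact (hT T n).elim _ _
  map_comp a b c := by
    ext n _
    exact (hT T n).elim _ _

lemma exists_isTerminal_conePresheaf_constTerminal (T : K)
    (hT : ∀ (X : K) n, Subsingleton ((Map X T).obj n)) (hT' : IsTerminal T) (W : (Weight A)ᵒᵖ) :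
    Nonempty (IsTerminal ((conePresheaf (constTerminal A T hT)).obj W)) :=
  exists_isTerminal_of_unique _ fun x ↦
    ⟨⟨⟨SNat.ofEv (W := W.unop) (G := homInto (constTerminal A T hT) x.pt)
      (fun {_ m} _ _ ↦ simplex (hT'.from x.pt) m) (fun {_ _ _} _ _ _ ↦ (hT x.pt _).elim _ _)
      (fun {_ _ m} _ _ _ ↦ (hT x.pt m).elim _ _)⟩,
    fun _ ↦ SNat.ext_ev (W := W.unop) (G := homInto (constTerminal A T hT) x.pt)
      fun _ m _ _ ↦ (hT x.pt m).elim _ _⟩⟩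

namespace InfinityCosmos

variable (𝒦 : InfinityCosmos K)

/-- The enriched form of terminality is needed: T stays terminal as a presheaf, so Map X T has at
most one simplex in each dimension, and not only one vertex. -/
lemma exists_terminal (𝒦 : InfinityCosmos K) : ∃ (T : K), Nonempty (IsTerminal T) ∧
    Nonempty (IsTerminal ((eYoneda K).obj T)) ∧
    ∀ (X : K) n, Subsingleton ((Map X T).obj n) := by
  have := 𝒦.hasTerminal
  have (F : Discrete PEmpty.{1} ⥤ K) := preservesLimit_eYoneda F
  have h : IsTerminal ((eYoneda K).obj (⊤_ K)) := terminalIsTerminal.isTerminalObj _ _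
  refine ⟨⊤_ K, ⟨terminalIsTerminal⟩, ⟨h⟩, fun X n ↦ ?_⟩
  have h' : IsTerminal ((Map X (⊤_ K)).obj n) :=
    h.isTerminalObj ((evaluation _ _).obj (⟨X, n⟩ : Plex K)) _
  exact ⟨fun x y ↦ ConcreteCategory.congr_hom (h'.hom_ext (↾fun _ : PUnit ↦ x) (↾fun _ ↦ y))
    PUnit.unit⟩

theorem presheafIsofibration_leibniz {F G : SFun A K} {κ : F ⟶ G}
    (hκ : ∀ a, 𝒦.isofibration (component κ a)) {V W : Weight A} {i : V ⟶ W}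
    (hi : IsProjectiveCellComplex i)
    (hV : (eYoneda K).essImage (leibnizTarget (conePresheafMap κ) i)) :
    𝒦.presheafIsofibration (leibniz (conePresheafMap κ) i) :=
  fib_leibniz_cellComplex (conePresheafMap κ) 𝒦.fibrationClass
    (fun _ _ _ hc ↦ by
      obtain ⟨n, a⟩ := hc
      exact 𝒦.presheafIsofibration_leibniz_cell hκ _ a) hi.2 hV

/-- Relative to the map from F to the terminal diagram, the Leibniz map of i is the map of cone
presheaves up to isomorphism, because cones over the terminal diagram are unique. -/
lemma presheafIsofibration_conePresheaf_map (F : SFun A K) {V W : Weight A} {i : V ⟶ W}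
    (hi : IsProjectiveCellComplex i) (hV : (eYoneda K).essImage ((conePresheaf F).obj (op V))) :
    𝒦.presheafIsofibration ((conePresheaf F).map i.op) := by
  obtain ⟨T, ⟨hT⟩, -, hT'⟩ := 𝒦.exists_terminal
  have hG (W : (Weight A)ᵒᵖ) := exists_isTerminal_conePresheaf_constTerminal (A := A) T hT' hT W
  let κ : F ⟶ constTerminal A T hT' := (show SNat F (constTerminal A T hT') (op ⦋0⦌) from
    { app a := simplex (hT.from (F.obj a)) _
      naturality _ _ := (hT' _ _).elim _ _ })
  have : IsIso ((conePresheaf (constTerminal A T hT')).map i.op) :=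
    isIso_of_isTerminal (hG _).some (hG _).some _
  rw [← leibniz_fst (conePresheafMap κ) i,
    𝒦.presheafIsofibration.cancel_right_of_respectsIso]
  exact 𝒦.presheafIsofibration_leibniz (fun a ↦ 𝒦.isofibration_of_isTerminal hT _) hi
    ((eYoneda K).essImage.prop_of_iso (asIso (pullback.fst _ _)).symm hV)

/-- Cones weighted by the empty weight form the terminal presheaf, which is represented by a
terminal object. The map from cones weighted by `W` to it is an isofibration of presheaves, and so
has representable source. -/
lemma essImage_conePresheaf (𝒦 : InfinityCosmos K) (F : SFun A K) {W : Weight A} (hW : IsFlexible W) :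
    (eYoneda K).essImage ((conePresheaf F).obj (op W)) := by
  obtain ⟨V, i, hV, hi⟩ := hW
  obtain ⟨T, -, ⟨hT⟩, -⟩ := 𝒦.exists_terminal
  exact 𝒦.fibrationClass.source _ (𝒦.presheafIsofibration_conePresheaf_map F hi
    ⟨T, ⟨hT.uniqueUpToIso (unique_conePresheaf_of_isEmpty F hV).some⟩⟩)

theorem exists_isWeightedLimit (𝒦 : InfinityCosmos K) (F : SFun A K) {W : Weight A} (hW : IsFlexible W) :
    ∃ (L : K) (Λ : W ⟶ homInto F L), IsWeightedLimit Λ := by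
  obtain ⟨L, ⟨e⟩⟩ := 𝒦.essImage_conePresheaf F hW
  obtain ⟨Λ, hΛ⟩ := exists_eq_coneHom e.hom
  refine ⟨L, Λ, (isWeightedLimit_iff_isIso_coneHom Λ).2 ?_⟩
  rw [← hΛ]
  infer_instance

theorem isofibration_of_isInducedByWeight {F : SFun A K} {W W' : Weight A} {i : W ⟶ W'}
    (hi : IsProjectiveCellComplex i) {L L' : K} {Λ : W ⟶ homInto F L} {Λ' : W' ⟶ homInto F L'}
    (hΛ : IsWeightedLimit Λ) (hΛ' : IsWeightedLimit Λ') {f : L' ⟶ L}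
    (hf : IsInducedByWeight Λ Λ' i f) : 𝒦.isofibration f := by
  have := (isWeightedLimit_iff_isIso_coneHom Λ).1 hΛ
  have := (isWeightedLimit_iff_isIso_coneHom Λ').1 hΛ'
  let e := asIso (coneHom Λ)
  let e' := asIso (coneHom Λ')
  refine 𝒦.isofibration_of_presheafIsofibration ((𝒦.presheafIsofibration.arrow_mk_iso_iff
    (Arrow.isoMk e' e
      ((isInducedByWeight_iff _ _ _ _).1 hf).symm)).2
    (𝒦.presheafIsofibration_conePresheaf_map F hi ⟨L, ⟨e⟩⟩))

/-- In the Leibniz map of κ and the inclusion of the empty weight into `W`, the corners at the empty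
weight are terminal. The target is then the presheaf of cones over G, represented by M, and the
Leibniz map is the action of κ. -/
theorem isofibration_of_isInducedByDiagram {F G : SFun A K} {κ : F ⟶ G}
    (hκ : ∀ a, 𝒦.isofibration (component κ a)) {W : Weight A} (hW : IsFlexible W) {L M : K}
    {Λ : W ⟶ homInto F L} {Γ : W ⟶ homInto G M} (hΛ : IsWeightedLimit Λ)
    (hΓ : IsWeightedLimit Γ) {f : L ⟶ M} (hf : IsInducedByDiagram Λ Γ κ f) :
    𝒦.isofibration f := by
  have := (isWeightedLimit_iff_isIso_coneHom Λ).1 hΛ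
  have := (isWeightedLimit_iff_isIso_coneHom Γ).1 hΓ
  let e := asIso (coneHom Λ)
  let e' := asIso (coneHom Γ)
  obtain ⟨V, i, hV, hi⟩ := hW
  have : IsIso ((conePresheafMap κ).app (op V)) :=
    isIso_of_isTerminal (unique_conePresheaf_of_isEmpty F hV).some
      (unique_conePresheaf_of_isEmpty G hV).some _
  have h := 𝒦.presheafIsofibration_leibniz hκ hi
    ⟨M, ⟨e' ≪≫ (asIso (pullback.snd _ _)).symm⟩⟩
  rw [← 𝒦.presheafIsofibration.cancel_right_of_respectsIso _ (pullback.snd _ _),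
    leibniz_snd] at h
  exact 𝒦.isofibration_of_presheafIsofibration ((𝒦.presheafIsofibration.arrow_mk_iso_iff
    (Arrow.isoMk e e'
      ((isInducedByDiagram_iff _ _ _ _).1 hf).symm)).2 h)

end InfinityCosmos

end FlexibleLimits

/-! ### The limit bifunctor -/

section Bifunctor

variable {A : Type v} [EnrichedCategory SSet.{v} A]
  {K : Type u} [Category.{v} K] [SimplicialCategory K]

lemma homIntoPost_sid (F : SFun A K) (L : K) (n : SimplexCategoryᵒᵖ) :
    (homIntoPost F F L).app n (sid F n) = sid (homInto F L) n :=
  SNat.ext_ev (W := homInto F L) (G := homInto F L) fun a m θ g ↦ by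
    change scomp g ((Map _ _).map θ (sid (F.obj a) n)) = g
    rw [map_sid]
    exact scomp_sid _

lemma homIntoPost_scomp {F G H : SFun A K} (L : K) {n : SimplexCategoryᵒᵖ} (κ : (Map F G).obj n)
    (τ : (Map G H).obj n) :
    (homIntoPost F H L).app n (scomp κ τ) =
      scomp (X := homInto F L) (Y := homInto G L) (Z := homInto H L)
        ((homIntoPost F G L).app n κ) ((homIntoPost G H L).app n τ) :=
  SNat.ext_ev (W := homInto F L) (G := homInto H L) fun a m θ g ↦ by
    change scomp g ((Map _ _).map θ (scomp (SNat.app κ a) (SNat.app τ a))) =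
      scomp (scomp g ((Map _ _).map θ (SNat.app κ a))) ((Map _ _).map θ (SNat.app τ a))
    rw [map_scomp]
    exact (scomp_assoc _ _ _).symm

/-- Postcomposition commutes with precomposition by associativity; this interchange is what makes
the limit bifunctor respect composition. -/
lemma homIntoPost_homIntoPre {F G : SFun A K} (X L : K) {n : SimplexCategoryᵒᵖ}
    (κ : (Map F G).obj n) (x : (Map X L).obj n) :
    scomp (X := homInto F L) (Y := homInto G L) (Z := homInto G X)
        ((homIntoPost F G L).app n κ) ((homIntoPre G X L).app n x) =
      scomp (X := homInto F L) (Y := homInto F X) (Z := homInto G X)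
        ((homIntoPre F X L).app n x) ((homIntoPost F G X).app n κ) :=
  SNat.ext_ev (W := homInto F L) (G := homInto G X) fun _ _ _ _ ↦ (scomp_assoc _ _ _).symm

/-- The simplices of the space of cones over `G` weighted by `W'` obtained from a cone over `F`
weighted by `W`. -/
def transportCone {W W' : Weight A} {F : SFun A K} (G : SFun A K) {L : K} (Λ : W ⟶ homInto F L)
    {n : SimplexCategoryᵒᵖ} (w : (Map W' W).obj n) (κ : (Map F G).obj n) :
    (Map W' (homInto G L)).obj n :=
  scomp (scomp w (simplex Λ n)) ((homIntoPost F G L).app n κ)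

lemma map_transportCone {W W' : Weight A} {F G : SFun A K} {L : K} (Λ : W ⟶ homInto F L)
    {n m : SimplexCategoryᵒᵖ} (θ : n ⟶ m) (w : (Map W' W).obj n) (κ : (Map F G).obj n) :
    (Map W' (homInto G L)).map θ (transportCone G Λ w κ) =
      transportCone G Λ ((Map W' W).map θ w) ((Map F G).map θ κ) := by
  rw [transportCone, map_scomp, map_scomp, map_simplex]
  exact congrArg (scomp _) (NatTrans.naturality_apply (homIntoPost F G L) θ κ).symm

lemma IsWeightedLimit.bijective {W : Weight A} {F : SFun A K} {L : K} {Λ : W ⟶ homInto F L}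
    (hΛ : IsWeightedLimit Λ) (X : K) (n : SimplexCategoryᵒᵖ) :
    Function.Bijective ((comparison Λ X).app n) :=
  (isIso_iff_bijective _).1 ((NatTrans.isIso_iff_isIso_app _).1 (hΛ X) n)

/-- The simplex of maps to a weighted limit given by a simplex of cones. -/
def IsWeightedLimit.lift {W : Weight A} {F : SFun A K} {L : K} {Λ : W ⟶ homInto F L}
    (hΛ : IsWeightedLimit Λ) {X : K} {n : SimplexCategoryᵒᵖ} (c : (Map W (homInto F X)).obj n) :
    (Map X L).obj n :=
  ((hΛ.bijective X n).2 c).choose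

lemma IsWeightedLimit.fac {W : Weight A} {F : SFun A K} {L : K} {Λ : W ⟶ homInto F L}
    (hΛ : IsWeightedLimit Λ) {X : K} {n : SimplexCategoryᵒᵖ} (c : (Map W (homInto F X)).obj n) :
    scomp (simplex Λ n) ((homIntoPre F X L).app n (hΛ.lift c)) = c :=
  ((hΛ.bijective X n).2 c).choose_spec

lemma IsWeightedLimit.hom_ext {W : Weight A} {F : SFun A K} {L : K} {Λ : W ⟶ homInto F L}
    (hΛ : IsWeightedLimit Λ) {X : K} {n : SimplexCategoryᵒᵖ} {x y : (Map X L).obj n}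
    (h : scomp (simplex Λ n) ((homIntoPre F X L).app n x) =
      scomp (simplex Λ n) ((homIntoPre F X L).app n y)) : x = y :=
  (hΛ.bijective X n).1 h

variable {L : (Flex A)ᵒᵖ × SFun A K → K}
  {Λ : ∀ x : (Flex A)ᵒᵖ × SFun A K, x.1.unop.obj ⟶ homInto x.2 (L x)}
  (hΛ : ∀ x, IsWeightedLimit (Λ x))

/-- The bifunctor given by a choice of flexible weighted limits. -/
def limitBifunctor : EnrichedFunctor SSet.{v} ((Flex A)ᵒᵖ × SFun A K) K where
  obj := L
  map x y :=
    { app n := ↾fun p ↦ (hΛ y).lift (transportCone (W := x.1.unop.obj) (W' := y.1.unop.obj) y.2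
        (Λ x) p.1 p.2)
      naturality n m θ := by
        ext p
        refine (hΛ y).hom_ext ?_
        refine ((hΛ y).fac _).trans ?_
        refine (map_transportCone (Λ x) θ p.1 p.2).symm.trans ?_
        refine (congrArg ((Map _ _).map θ) ((hΛ y).fac _)).symm.trans ?_
        rw [map_scomp, map_simplex, map_homIntoPre]
        rfl }
  map_id x := by
    ext n z
    refine (hΛ x).hom_ext (((hΛ x).fac _).trans ?_)
    change scomp (scomp (sid x.1.unop.obj n) (simplex (Λ x) n))
      ((homIntoPost x.2 x.2 (L x)).app n (sid x.2 n)) =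
      scomp _ ((homIntoPre x.2 (L x) (L x)).app n (sid (L x) n))
    rw [homIntoPost_sid, homIntoPre_sid, sid_scomp]
  map_comp x y z := by
    ext n p
    refine (hΛ z).hom_ext (((hΛ z).fac _).trans ?_)
    let w : (Map y.1.unop.obj x.1.unop.obj).obj n := p.1.1
    let κ : (Map x.2 y.2).obj n := p.1.2
    let w' : (Map z.1.unop.obj y.1.unop.obj).obj n := p.2.1
    let κ' : (Map y.2 z.2).obj n := p.2.2
    change scomp (scomp (scomp w' w) (simplex (Λ x) n))
      ((homIntoPost x.2 z.2 (L x)).app n (scomp κ κ')) =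
      scomp (simplex (Λ z) n) ((homIntoPre z.2 (L x) (L z)).app n
        (scomp ((hΛ y).lift (transportCone y.2 (Λ x) w κ))
          ((hΛ z).lift (transportCone z.2 (Λ y) w' κ'))))
    -- Maps into a limit are compared on cones. The cone at z absorbs the second lift, the
    -- interchange moves the precomposition past the postcomposition, and then the cone at y absorbs
    -- the first lift.
    rw [homIntoPre_scomp, ← scomp_assoc, (hΛ z).fac, transportCone,
      scomp_assoc (scomp w' (simplex (Λ y) n)), homIntoPost_homIntoPre,
      ← scomp_assoc (scomp w' (simplex (Λ y) n)), scomp_assoc w' (simplex (Λ y) n), (hΛ y).fac,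
      transportCone, homIntoPost_scomp]
    simp only [scomp_assoc]

lemma extendsLimits_limitBifunctor : ExtendsLimits L Λ (limitBifunctor hΛ) := by
  have h : IsNaturalCones (limitBifunctor hΛ) Λ := fun x y n w κ ↦ (hΛ y).fac _
  refine ⟨fun _ ↦ rfl, (congrArg (IsNaturalCones (limitBifunctor hΛ)) ?_).mpr h⟩
  exact funext fun x ↦ Category.comp_id _

lemma isInducedByWeight_bifunctorMapWeight {W W' : Flex A} (i : W.obj ⟶ W'.obj) (F : SFun A K) :
    IsInducedByWeight (Λ (op W, F)) (Λ (op W', F)) i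
      (bifunctorMapWeight (limitBifunctor hΛ) i F) := by
  have h := (hΛ (op W, F)).fac (transportCone F (Λ (op W', F)) (simplex i (op ⦋0⦌))
    (sid F (op ⦋0⦌)))
  have h' : transportCone F (Λ (op W', F)) (simplex i (op ⦋0⦌)) (sid F (op ⦋0⦌)) =
      i ≫ Λ (op W', F) := by
    rw [transportCone, homIntoPost_sid, scomp_sid, ← simplex_comp, simplex_weight]
  refine Eq.trans ?_ (h.trans h')
  rw [simplex_weight]
  exact congrArg (fun x ↦ scomp (Λ (op W, F)) ((homIntoPre F (L (op W', F)) (L (op W, F))).app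
    (op ⦋0⦌) x)) (simplex_homEquiv'_symm _)

lemma InfinityCosmos.isofibration_bifunctorMapWeight (𝒦 : InfinityCosmos K) {W W' : Flex A}
    {i : W.obj ⟶ W'.obj} (hi : IsProjectiveCellComplex i) (F : SFun A K) :
    𝒦.isofibration (bifunctorMapWeight (limitBifunctor hΛ) i F) :=
  𝒦.isofibration_of_isInducedByWeight hi (hΛ (op W, F)) (hΛ (op W', F))
    (isInducedByWeight_bifunctorMapWeight hΛ i F)

end Bifunctor

/-! ### Homotopies parametrised by the free-living isomorphism -/

section Interval

/-- The value on a pair of a map of simplicial sets from a product. -/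
def pap {X Y Z : SSet.{v}} (h : X ⊗ Y ⟶ Z) {n : SimplexCategoryᵒᵖ} (x : X.obj n) (y : Y.obj n) :
    Z.obj n :=
  h.app n (spair (X := X) (Y := Y) x y)

lemma map_pap {X Y Z : SSet.{v}} (h : X ⊗ Y ⟶ Z) {n m : SimplexCategoryᵒᵖ} (θ : n ⟶ m)
    (x : X.obj n) (y : Y.obj n) : Z.map θ (pap h x y) = pap h (X.map θ x) (Y.map θ y) :=
  (NatTrans.naturality_apply h θ (spair (X := X) (Y := Y) x y)).symm

lemma ext_pap {X Y Z : SSet.{v}} {h h' : X ⊗ Y ⟶ Z}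
    (H : ∀ (n : SimplexCategoryᵒᵖ) (x : X.obj n) (y : Y.obj n), pap h x y = pap h' x y) :
    h = h' := by
  ext n p
  exact H n p.1 p.2

/-- Constructor for maps of simplicial sets from a product. -/
def pmk {X Y Z : SSet.{v}} (f : ∀ {n : SimplexCategoryᵒᵖ}, X.obj n → Y.obj n → Z.obj n)
    (hf : ∀ {n m : SimplexCategoryᵒᵖ} (θ : n ⟶ m) (x : X.obj n) (y : Y.obj n),
      Z.map θ (f x y) = f (X.map θ x) (Y.map θ y)) : X ⊗ Y ⟶ Z where
  app n := ↾fun p ↦ f p.1 p.2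
  naturality n m θ := by
    ext p
    exact (hf θ p.1 p.2).symm

/-- Constructor for maps of simplicial sets. -/
def smk {X Z : SSet.{v}} (f : ∀ {n : SimplexCategoryᵒᵖ}, X.obj n → Z.obj n)
    (hf : ∀ {n m : SimplexCategoryᵒᵖ} (θ : n ⟶ m) (x : X.obj n), Z.map θ (f x) = f (X.map θ x)) :
    X ⟶ Z where
  app n := ↾fun p ↦ f p
  naturality n m θ := by
    ext p
    exact (hf θ p).symm

lemma map_app_apply {X Z : SSet.{v}} (f : X ⟶ Z) {n m : SimplexCategoryᵒᵖ} (θ : n ⟶ m)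
    (x : X.obj n) : Z.map θ (f.app n x) = f.app m (X.map θ x) :=
  (NatTrans.naturality_apply f θ x).symm

/-- The free-living isomorphism, as an interval. -/
abbrev interval : SSet.{v} := SSet.coherentIso.{v}

/-- The simplices degenerate on the source of the interval. -/
def izero (n : SimplexCategoryᵒᵖ) : interval.{v}.obj n :=
  (SSet.const SSet.coherentIso.x₀ : interval.{v} ⟶ interval.{v}).app n (SSet.coherentIso.x₀.{v}
    |> interval.{v}.map (fromZero n))

/-- The simplices degenerate on the target of the interval. -/
def ione (n : SimplexCategoryᵒᵖ) : interval.{v}.obj n :=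
  (SSet.const SSet.coherentIso.x₁ : interval.{v} ⟶ interval.{v}).app n (SSet.coherentIso.x₀.{v}
    |> interval.{v}.map (fromZero n))

lemma map_izero {n m : SimplexCategoryᵒᵖ} (θ : n ⟶ m) :
    interval.{v}.map θ (izero n) = izero m := map_app_apply _ θ _

lemma map_ione {n m : SimplexCategoryᵒᵖ} (θ : n ⟶ m) :
    interval.{v}.map θ (ione n) = ione m := map_app_apply _ θ _

/-- The vertices of a simplex of the interval. -/
def ival {n : SimplexCategoryᵒᵖ} (x : interval.{v}.obj n) (k : Fin (n.unop.len + 1)) : Bool :=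
  (Functor.obj (show ComposableArrows WalkingIso.{v} n.unop.len from x) k).as.down

/-- The simplex of the interval with given vertices. -/
def iof {n : SimplexCategoryᵒᵖ} (f : Fin (n.unop.len + 1) → Bool) : interval.{v}.obj n :=
  (Codiscrete.functor (fun k ↦ ULift.up (f k)) : ComposableArrows WalkingIso.{v} n.unop.len)

/-- The interval is the nerve of a codiscrete category, so its simplices are determined by their
vertices and maps into it can be given by Boolean formulas. -/
lemma ext_ival {n : SimplexCategoryᵒᵖ} {x y : interval.{v}.obj n} (h : ∀ k, ival x k = ival y k) :
    x = y := by
  refine CategoryTheory.Functor.ext (fun k ↦ ?_) (fun _ _ _ ↦ Subsingleton.elim _ _)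
  exact congrArg (fun b ↦ Codiscrete.mk (ULift.up b)) (h k)

lemma ival_izero (n : SimplexCategoryᵒᵖ) (k) : ival (izero.{v} n) k = false := rfl

lemma ival_ione (n : SimplexCategoryᵒᵖ) (k) : ival (ione.{v} n) k = true := rfl

lemma izero_ne_ione (n : SimplexCategoryᵒᵖ) : izero.{v} n ≠ ione n := fun h ↦ by
  have := congrArg (fun x ↦ ival x 0) h
  simp [ival_izero, ival_ione] at this

/-- The automorphism of the interval that exchanges the end points. -/
def iswap : interval.{v} ⟶ interval.{v} :=
  smk (fun x ↦ iof fun k ↦ !ival x k) (fun _ _ ↦ rfl)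

/-- The map from the square to the interval whose value is the target at `(0, 0)` and the source
at all other vertices. -/
def inor : interval.{v} ⊗ interval.{v} ⟶ interval.{v} :=
  pmk (fun x y ↦ iof fun k ↦ !(ival x k || ival y k)) (fun _ _ _ ↦ rfl)

lemma inor_ione_left {n : SimplexCategoryᵒᵖ} (x : interval.{v}.obj n) :
    pap inor (ione n) x = izero n := rfl

lemma inor_izero_right {n : SimplexCategoryᵒᵖ} (x : interval.{v}.obj n) :
    pap inor x (izero n) = iswap.app n x :=
  ext_ival fun _ ↦ congrArg not (Bool.or_false _)

lemma inor_ione_right {n : SimplexCategoryᵒᵖ} (x : interval.{v}.obj n) :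
    pap inor x (ione n) = izero n :=
  ext_ival fun _ ↦ congrArg not (Bool.or_true _)

lemma isoHomotopic_iff {X Y : SSet.{v}} {f g : X ⟶ Y} :
    IsoHomotopic f g ↔ ∃ H : X ⊗ interval.{v} ⟶ Y,
      (∀ n (x : X.obj n), pap H x (izero n) = f.app n x) ∧
      ∀ n (x : X.obj n), pap H x (ione n) = g.app n x := by
  constructor
  · rintro ⟨H, rfl, rfl⟩
    exact ⟨H, fun _ _ ↦ rfl, fun _ _ ↦ rfl⟩
  · rintro ⟨H, h₀, h₁⟩
    refine ⟨H, ?_, ?_⟩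
    · ext n x
      exact h₀ n x
    · ext n x
      exact h₁ n x

end Interval

/-! ### Gluing maps along subcomplexes. -/

section Glue

variable {V C Y : SSet.{v}}

/-- Every simplex of a union lies in one of the two subcomplexes, so agreement on the overlap
suffices. The factor C carries the parameter of a homotopy. -/
lemma exists_glue {S₁ S₂ : V.Subcomplex} (h₁ : S₁.toSSet ⊗ C ⟶ Y) (h₂ : S₂.toSSet ⊗ C ⟶ Y)
    (h : ∀ n (v : V.obj n) (hv₁ : v ∈ S₁.obj n) (hv₂ : v ∈ S₂.obj n) (c : C.obj n),
      pap h₁ (X := S₁.toSSet) ⟨v, hv₁⟩ c = pap h₂ (X := S₂.toSSet) ⟨v, hv₂⟩ c) :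
    ∃ k : (S₁ ⊔ S₂).toSSet ⊗ C ⟶ Y,
      (∀ n (v : V.obj n) (hv : v ∈ S₁.obj n) (c : C.obj n),
        pap k (X := (S₁ ⊔ S₂).toSSet) ⟨v, Or.inl hv⟩ c = pap h₁ (X := S₁.toSSet) ⟨v, hv⟩ c) ∧
      ∀ n (v : V.obj n) (hv : v ∈ S₂.obj n) (c : C.obj n),
        pap k (X := (S₁ ⊔ S₂).toSSet) ⟨v, Or.inr hv⟩ c = pap h₂ (X := S₂.toSSet) ⟨v, hv⟩ c := by
  classical
  let f {n : SimplexCategoryᵒᵖ} (v : (S₁ ⊔ S₂).toSSet.obj n) (c : C.obj n) : Y.obj n :=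
    if hv : v.1 ∈ S₁.obj n then pap h₁ (X := S₁.toSSet) ⟨v.1, hv⟩ c
    else pap h₂ (X := S₂.toSSet) ⟨v.1, v.2.resolve_left hv⟩ c
  have f₁ {n : SimplexCategoryᵒᵖ} (v : (S₁ ⊔ S₂).toSSet.obj n) (c : C.obj n)
      (hv : v.1 ∈ S₁.obj n) : f v c = pap h₁ (X := S₁.toSSet) ⟨v.1, hv⟩ c := dif_pos hv
  have f₂ {n : SimplexCategoryᵒᵖ} (v : (S₁ ⊔ S₂).toSSet.obj n) (c : C.obj n)
      (hv : v.1 ∈ S₂.obj n) : f v c = pap h₂ (X := S₂.toSSet) ⟨v.1, hv⟩ c := by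
    by_cases hv' : v.1 ∈ S₁.obj n
    · exact (f₁ v c hv').trans (h n _ hv' hv c)
    · exact dif_neg hv'
  refine ⟨pmk (X := (S₁ ⊔ S₂).toSSet) f (fun {n m} θ v c ↦ ?_), fun n v hv c ↦ f₁ _ c hv,
    fun n v hv c ↦ f₂ _ c hv⟩
  obtain ⟨v, hv | hv⟩ := v
  · exact (congrArg (Y.map θ) (f₁ _ _ hv)).trans
      ((map_pap h₁ θ _ _).trans (f₁ ((S₁ ⊔ S₂).toSSet.map θ ⟨v, Or.inl hv⟩) _ (S₁.map θ hv)).symm)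
  · exact (congrArg (Y.map θ) (f₂ _ _ hv)).trans
      ((map_pap h₂ θ _ _).trans (f₂ ((S₁ ⊔ S₂).toSSet.map θ ⟨v, Or.inr hv⟩) _ (S₂.map θ hv)).symm)

/-- The subcomplex of `V ⊗ interval` where the second component is `0`. -/
def faceZero (V : SSet.{v}) : (V ⊗ interval.{v}).Subcomplex where
  obj n := {p | p.2 = izero n}
  map θ _ hp := (congrArg (interval.{v}.map θ) hp).trans (map_izero θ)

/-- The subcomplex of `V ⊗ interval` where the second component is `1`. -/
def faceOne (V : SSet.{v}) : (V ⊗ interval.{v}).Subcomplex where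
  obj n := {p | p.2 = ione n}
  map θ _ hp := (congrArg (interval.{v}.map θ) hp).trans (map_ione θ)

end Glue

/-! ### Homotopy lifting and homotopy extension. -/

section Fibrations

variable {Y Z : SSet.{v}}

/-- Maps of simplicial sets with the relative homotopy lifting extension property, for homotopies
parametrised by the free-living isomorphism. -/
def HasHomotopyLifting (q : Y ⟶ Z) : Prop :=
  ∀ ⦃V : SSet.{v}⦄ (S : V.Subcomplex) (a : V ⟶ Y) (h : S.toSSet ⊗ interval.{v} ⟶ Y)
    (b : V ⊗ interval.{v} ⟶ Z), (∀ n (v : S.toSSet.obj n), pap h v (izero n) = a.app n v.1) →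
    (∀ n (v : V.obj n), q.app n (a.app n v) = pap b v (izero n)) →
    (∀ n (v : S.toSSet.obj n) j, q.app n (pap h v j) = pap b v.1 j) →
    ∃ k : V ⊗ interval.{v} ⟶ Y, (∀ n (v : V.obj n) j, q.app n (pap k v j) = pap b v j) ∧
      (∀ n (v : V.obj n), pap k v (izero n) = a.app n v) ∧
      ∀ n (v : S.toSSet.obj n) j, pap k v.1 j = pap h v j

/-- Simplicial sets with the homotopy extension property for homotopies
parametrised by the free-living isomorphism. -/
def HasHomotopyExtension (Y : SSet.{v}) : Prop :=
  ∀ ⦃V : SSet.{v}⦄ (S : V.Subcomplex) (a : V ⟶ Y) (h : S.toSSet ⊗ interval.{v} ⟶ Y),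
    (∀ n (v : S.toSSet.obj n), pap h v (izero n) = a.app n v.1) →
    ∃ k : V ⊗ interval.{v} ⟶ Y, (∀ n (v : V.obj n), pap k v (izero n) = a.app n v) ∧
      ∀ n (v : S.toSSet.obj n) j, pap k v.1 j = pap h v j

/-- Over a point the conditions on the base are vacuous, so results on lifting also apply to
extension. -/
lemma HasHomotopyExtension.hasHomotopyLifting (hY : HasHomotopyExtension Y) :
    HasHomotopyLifting (SemiCartesianMonoidalCategory.toUnit Y) := fun V S a h b h₁ _ _ ↦ by
  obtain ⟨k, hk⟩ := hY S a h h₁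
  exact ⟨k, fun _ _ _ ↦ rfl, hk⟩

/-- The filling of a square with three given sides. -/
lemma HasHomotopyLifting.exists_square {q : Y ⟶ Z} (hq : HasHomotopyLifting q) {V : SSet.{v}}
    (α β₀ β₁ : V ⊗ interval.{v} ⟶ Y) (f : (V ⊗ interval.{v}) ⊗ interval.{v} ⟶ Z)
    (h₀ : ∀ n (v : V.obj n), pap β₀ v (izero n) = pap α v (izero n))
    (h₁ : ∀ n (v : V.obj n), pap β₁ v (izero n) = pap α v (ione n))
    (hα : ∀ n (v : V.obj n) j, q.app n (pap α v j) =
      pap f (X := V ⊗ interval.{v}) (spair v j) (izero n))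
    (hβ₀ : ∀ n (v : V.obj n) j, q.app n (pap β₀ v j) =
      pap f (X := V ⊗ interval.{v}) (spair v (izero n)) j)
    (hβ₁ : ∀ n (v : V.obj n) j, q.app n (pap β₁ v j) =
      pap f (X := V ⊗ interval.{v}) (spair v (ione n)) j) :
    ∃ τ : V ⊗ interval.{v} ⟶ Y, (∀ n (v : V.obj n), pap τ v (izero n) = pap β₀ v (ione n)) ∧
      (∀ n (v : V.obj n), pap τ v (ione n) = pap β₁ v (ione n)) ∧
      ∀ n (v : V.obj n) j, q.app n (pap τ v j) =
        pap f (X := V ⊗ interval.{v}) (spair v j) (ione n) := by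
  let p : V ⊗ interval.{v} ⟶ V := SemiCartesianMonoidalCategory.fst _ _
  -- The sides β₀ and β₁ form a homotopy on the two end faces of V × I, starting where α does.
  -- Lifting it to all of V × I with initial map α and base f gives the filler, and τ is the filler
  -- at time 1.
  obtain ⟨h, hh₀, hh₁⟩ := exists_glue (((faceZero V).ι ≫ p) ▷ interval.{v} ≫ β₀)
    (((faceOne V).ι ≫ p) ▷ interval.{v} ≫ β₁)
    (fun n v hv₀ hv₁ ↦ (izero_ne_ione n (hv₀.symm.trans hv₁)).elim)
  obtain ⟨k, hk, -, hk'⟩ := hq (faceZero V ⊔ faceOne V) α h f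
    (by
      rintro n ⟨⟨v, i⟩, (hi : i = izero n) | (hi : i = ione n)⟩ <;> subst hi
      · exact (hh₀ _ (spair v (izero n)) rfl _).trans (h₀ _ _)
      · exact (hh₁ _ (spair v (ione n)) rfl _).trans (h₁ _ _))
    (fun n v ↦ hα n v.1 v.2)
    (by
      rintro n ⟨⟨v, i⟩, (hi : i = izero n) | (hi : i = ione n)⟩ j <;> subst hi
      · exact (congrArg _ (hh₀ _ (spair v (izero n)) rfl _)).trans (hβ₀ _ _ _)
      · exact (congrArg _ (hh₁ _ (spair v (ione n)) rfl _)).trans (hβ₁ _ _ _))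
  refine ⟨pmk (fun {n} v j ↦ pap k (X := V ⊗ interval.{v}) (spair v j) (ione n))
    (fun θ v j ↦ (map_pap k θ (X := V ⊗ interval.{v}) (spair v j) _).trans
      (congrArg _ (map_ione θ))), fun n v ↦ ?_, fun n v ↦ ?_, fun n v j ↦ hk _ _ _⟩
  · exact (hk' n ⟨spair v (izero n), Or.inl rfl⟩ _).trans (hh₀ _ _ rfl _)
  · exact (hk' n ⟨spair v (ione n), Or.inr rfl⟩ _).trans (hh₁ _ _ rfl _)

end Fibrations

/-! ### Homotopies, sections and trivial fibrations. -/

section Homotopies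

variable {W X Y Z : SSet.{v}}

lemma IsoHomotopic.whisker {f g : X ⟶ Y} (h : IsoHomotopic f g) (p : W ⟶ X) (q : Y ⟶ Z) :
    IsoHomotopic (p ≫ f ≫ q) (p ≫ g ≫ q) := by
  rw [isoHomotopic_iff] at h ⊢
  obtain ⟨H, h₀, h₁⟩ := h
  exact ⟨p ▷ interval.{v} ≫ H ≫ q, fun n x ↦ congrArg (q.app n) (h₀ n (p.app n x)),
    fun n x ↦ congrArg (q.app n) (h₁ n (p.app n x))⟩

/-- The composite is the fourth side of the square whose other sides are the constant homotopy at f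
and the two given homotopies. -/
lemma IsoHomotopic.trans (hY : HasHomotopyExtension Y) {f g h : X ⟶ Y}
    (hfg : IsoHomotopic f g) (hgh : IsoHomotopic g h) : IsoHomotopic f h := by
  rw [isoHomotopic_iff] at hfg hgh ⊢
  obtain ⟨H, h₀, h₁⟩ := hfg
  obtain ⟨H', h₀', h₁'⟩ := hgh
  obtain ⟨τ, hτ₀, hτ₁, -⟩ := hY.hasHomotopyLifting.exists_square H
    (SemiCartesianMonoidalCategory.fst X interval.{v} ≫ f) H'
    (SemiCartesianMonoidalCategory.toUnit _) (fun n x ↦ (h₀ n x).symm)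
    (fun n x ↦ (h₀' n x).trans (h₁ n x).symm) (fun _ _ _ ↦ rfl) (fun _ _ _ ↦ rfl)
    (fun _ _ _ ↦ rfl)
  exact ⟨τ, hτ₀, fun n x ↦ (hτ₁ n x).trans (h₁' n x)⟩

/-- Lifting the homotopy from g ≫ q to the identity with starting point g yields a homotopy whose
end is a strict section. -/
lemma HasHomotopyLifting.exists_section {q : Y ⟶ Z} (hq : HasHomotopyLifting q) {g : Z ⟶ Y}
    (hg : IsoHomotopic (g ≫ q) (𝟙 Z)) : ∃ s : Z ⟶ Y, s ≫ q = 𝟙 Z ∧ IsoHomotopic g s := by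
  rw [isoHomotopic_iff] at hg
  obtain ⟨H, h₀, h₁⟩ := hg
  obtain ⟨k, hk, hk', -⟩ := hq (⊥ : Z.Subcomplex) g
    (pmk (X := (⊥ : Z.Subcomplex).toSSet) (fun v ↦ v.2.elim) (fun _ v ↦ v.2.elim)) H
    (fun n v ↦ v.2.elim) (fun n z ↦ (h₀ n z).symm) (fun n v ↦ v.2.elim)
  refine ⟨smk (fun z ↦ pap k z (ione _)) (fun θ z ↦ (map_pap k θ z _).trans
    (congrArg _ (map_ione θ))), ?_, isoHomotopic_iff.2 ⟨k, hk', fun _ _ ↦ rfl⟩⟩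
  ext n z
  exact (hk n z _).trans (h₁ n z)

/-- A section of a map with the homotopy lifting property that is a homotopy inverse is a
fibrewise homotopy inverse. -/
lemma HasHomotopyLifting.exists_fibrewise_homotopy {q : Y ⟶ Z} (hq : HasHomotopyLifting q)
    {s : Z ⟶ Y} (hs : s ≫ q = 𝟙 Z) (h : IsoHomotopic (𝟙 Y) (q ≫ s)) :
    ∃ τ : Y ⊗ interval.{v} ⟶ Y, (∀ n (y : Y.obj n), pap τ y (izero n) = y) ∧
      (∀ n (y : Y.obj n), pap τ y (ione n) = s.app n (q.app n y)) ∧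
      ∀ n (y : Y.obj n) j, q.app n (pap τ y j) = q.app n y := by
  have hs' (n) (z : Z.obj n) : q.app n (s.app n z) = z :=
    ConcreteCategory.congr_hom (NatTrans.congr_app hs n) z
  rw [isoHomotopic_iff] at h
  obtain ⟨H, h₀, h₁⟩ := h
  replace h₀ (n) (y : Y.obj n) : pap H y (izero n) = y := h₀ n y
  replace h₁ (n) (y : Y.obj n) : pap H y (ione n) = s.app n (q.app n y) := h₁ n y
  -- Here H runs from the identity to q ≫ s. The square has initial side the reverse of s∘q∘H and
  -- lateral sides the reverse of H and the constant homotopy at q ≫ s, and lies over q∘H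
  -- reparametrised by `inor`. As `inor` is constantly 0 on the fourth side, the homotopy obtained
  -- there is fibrewise.
  obtain ⟨τ, hτ₀, hτ₁, hτ⟩ := hq.exists_square (Y ◁ iswap ≫ H ≫ q ≫ s) (Y ◁ iswap ≫ H)
    (SemiCartesianMonoidalCategory.fst Y interval.{v} ≫ q ≫ s)
    ((α_ Y interval.{v} interval.{v}).hom ≫ Y ◁ inor ≫ H ≫ q)
    (fun n y ↦ by
      change pap H y (ione n) = s.app n (q.app n (pap H y (ione n)))
      rw [h₁, hs'])
    (fun n y ↦ by
      change s.app n (q.app n y) = s.app n (q.app n (pap H y (izero n)))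
      rw [h₀])
    (fun n y j ↦ by
      change q.app n (s.app n (q.app n (pap H y (iswap.app n j)))) =
        q.app n (pap H y (pap inor j (izero n)))
      rw [hs', inor_izero_right])
    (fun n y j ↦ rfl)
    (fun n y j ↦ by
      change q.app n (s.app n (q.app n y)) = q.app n (pap H y (pap inor (ione n) j))
      rw [hs', inor_ione_left, h₀])
  refine ⟨τ, fun n y ↦ (hτ₀ n y).trans (h₀ n y), hτ₁, fun n y j ↦ (hτ n y j).trans ?_⟩
  change q.app n (pap H y (pap inor j (ione n))) = _
  rw [inor_ione_right, h₀]

/-- The filling of a square with three given sides, relative to a subcomplex. -/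
lemma HasHomotopyExtension.exists_square (hY : HasHomotopyExtension Y) {V : SSet.{v}}
    (S : V.Subcomplex) (α β₀ β₁ : V ⊗ interval.{v} ⟶ Y)
    (γ : (S.toSSet ⊗ interval.{v}) ⊗ interval.{v} ⟶ Y)
    (h₀ : ∀ n (v : V.obj n), pap β₀ v (izero n) = pap α v (izero n))
    (h₁ : ∀ n (v : V.obj n), pap β₁ v (izero n) = pap α v (ione n))
    (hγ : ∀ n (v : S.toSSet.obj n) u, pap γ (X := S.toSSet ⊗ interval.{v}) (spair v u) (izero n) =
      pap α v.1 u)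
    (hγ₀ : ∀ n (v : S.toSSet.obj n) t, pap γ (X := S.toSSet ⊗ interval.{v}) (spair v (izero n)) t =
      pap β₀ v.1 t)
    (hγ₁ : ∀ n (v : S.toSSet.obj n) t, pap γ (X := S.toSSet ⊗ interval.{v}) (spair v (ione n)) t =
      pap β₁ v.1 t) :
    ∃ k : (V ⊗ interval.{v}) ⊗ interval.{v} ⟶ Y,
      (∀ n (v : V.obj n) t, pap k (X := V ⊗ interval.{v}) (spair v (izero n)) t = pap β₀ v t) ∧
      (∀ n (v : V.obj n) t, pap k (X := V ⊗ interval.{v}) (spair v (ione n)) t = pap β₁ v t) ∧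
      (∀ n (v : V.obj n) u, pap k (X := V ⊗ interval.{v}) (spair v u) (izero n) = pap α v u) ∧
      ∀ n (v : S.toSSet.obj n) u t, pap k (X := V ⊗ interval.{v}) (spair v.1 u) t =
        pap γ (X := S.toSSet ⊗ interval.{v}) (spair v u) t := by
  let S' : (V ⊗ interval.{v}).Subcomplex := S.prod ⊤
  let p' : S'.toSSet ⟶ S.toSSet ⊗ interval.{v} :=
    smk (fun p ↦ (spair (X := S.toSSet) ⟨p.1.1, p.2.1⟩ p.1.2)) (fun _ _ ↦ rfl)
  let p : V ⊗ interval.{v} ⟶ V := SemiCartesianMonoidalCategory.fst _ _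
  obtain ⟨δ, hδ₀, hδ₁⟩ := exists_glue (((faceZero V).ι ≫ p) ▷ interval.{v} ≫ β₀)
    (((faceOne V).ι ≫ p) ▷ interval.{v} ≫ β₁)
    (fun n v hv₀ hv₁ ↦ (izero_ne_ione n (hv₀.symm.trans hv₁)).elim)
  -- The data on S × I are glued to the two lateral sides, so that homotopy extension with initial
  -- map α gives a filler extending γ as well.
  obtain ⟨ε, hε, hε'⟩ := exists_glue (p' ▷ interval.{v} ≫ γ) δ (by
    rintro n ⟨v, i⟩ hv ((hi : i = izero n) | (hi : i = ione n)) t <;> subst hi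
    · exact (hγ₀ n ⟨v, hv.1⟩ t).trans (hδ₀ n (spair v (izero n)) rfl t).symm
    · exact (hγ₁ n ⟨v, hv.1⟩ t).trans (hδ₁ n (spair v (ione n)) rfl t).symm)
  obtain ⟨k, hk, hk'⟩ := hY (S' ⊔ (faceZero V ⊔ faceOne V)) α ε (by
    rintro n ⟨w, hw⟩
    have hw' : w ∈ S'.obj n ∨ w ∈ (faceZero V ⊔ faceOne V).obj n := hw
    obtain hw' | hw' := hw'
    · exact (hε n w hw' _).trans (hγ n ⟨w.1, hw'.1⟩ w.2)
    · refine (hε' n w hw' _).trans ?_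
      have hw'' : w.2 = izero n ∨ w.2 = ione n := hw'
      obtain hi | hi := hw''
      · exact (hδ₀ n w hi _).trans ((h₀ n w.1).trans (congrArg (pap α w.1) hi.symm))
      · exact (hδ₁ n w hi _).trans ((h₁ n w.1).trans (congrArg (pap α w.1) hi.symm)))
  refine ⟨k, fun n v t ↦ ?_, fun n v t ↦ ?_, fun n v u ↦ hk n _, fun n v u t ↦ ?_⟩
  · have hv : spair (X := V) (Y := interval.{v}) v (izero n) ∈ (faceZero V ⊔ faceOne V).obj n :=
      Or.inl rfl
    exact (hk' n ⟨_, Or.inr hv⟩ t).trans ((hε' n _ hv t).trans (hδ₀ n _ rfl t))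
  · have hv : spair (X := V) (Y := interval.{v}) v (ione n) ∈ (faceZero V ⊔ faceOne V).obj n :=
      Or.inr rfl
    exact (hk' n ⟨_, Or.inr hv⟩ t).trans ((hε' n _ hv t).trans (hδ₁ n _ rfl t))
  · have hv : spair (X := V) (Y := interval.{v}) v.1 u ∈ S'.obj n := ⟨v.2, trivial⟩
    exact (hk' n ⟨_, Or.inl hv⟩ t).trans (hε n _ hv t)

/-- A monomorphism is an isomorphism onto its range followed by the inclusion of a subcomplex. -/
lemma rlp_monomorphisms_of_subcomplex {q : Y ⟶ Z}
    (h : ∀ ⦃V : SSet.{v}⦄ (S : V.Subcomplex), HasLiftingProperty S.ι q) :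
    (MorphismProperty.monomorphisms SSet.{v}).rlp q := by
  intro U V i hi
  have : Mono i := hi
  have := h (SSet.Subcomplex.range i)
  rw [← SSet.Subcomplex.toRange_ι i]
  infer_instance

/-- A homotopy inverse can be improved to a strict section s with a fibrewise homotopy τ from the
identity to q ≫ s. For a lifting problem (t, b), the map b ≫ s is a lift that agrees with t only up
to τ; pushing it along the reverse of τ, over the constant homotopy at b, corrects it on S. -/
theorem HasHomotopyLifting.rlp_monomorphisms {q : Y ⟶ Z} (hq : HasHomotopyLifting q)
    (hY : HasHomotopyExtension Y) {g : Z ⟶ Y} (hg : IsoHomotopic (g ≫ q) (𝟙 Z))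
    (hg' : IsoHomotopic (𝟙 Y) (q ≫ g)) : (MorphismProperty.monomorphisms SSet.{v}).rlp q := by
  obtain ⟨s, hs, hgs⟩ := hq.exists_section hg
  obtain ⟨τ, hτ₀, hτ₁, hτ⟩ := hq.exists_fibrewise_homotopy hs
    -- The homotopy from the identity to q ≫ g continues to q ≫ s.
    (hg'.trans hY (hgs.whisker q (𝟙 Y)))
  refine rlp_monomorphisms_of_subcomplex fun V S ↦ ⟨fun {t b} sq ↦ ?_⟩
  have hsq (n) (x : S.toSSet.obj n) : q.app n (t.app n x) = b.app n x.1 :=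
    ConcreteCategory.congr_hom (NatTrans.congr_app sq.w n) x
  have hs' (n) (z : Z.obj n) : q.app n (s.app n z) = z :=
    ConcreteCategory.congr_hom (NatTrans.congr_app hs n) z
  obtain ⟨k, hk, -, hk'⟩ := hq S (b ≫ s) (t ▷ interval.{v} ≫ Y ◁ iswap ≫ τ)
    (SemiCartesianMonoidalCategory.fst V interval.{v} ≫ b)
    (fun n x ↦ (hτ₁ n _).trans (congrArg (s.app n) (hsq n x)))
    (fun n x ↦ hs' n _) (fun n x j ↦ (hτ n _ _).trans (hsq n x))
  refine ⟨⟨{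
    l := smk (fun x ↦ pap k x (ione _)) (fun θ z ↦ (map_pap k θ z _).trans
      (congrArg _ (map_ione θ)))
    fac_left := ?_
    fac_right := ?_ }⟩⟩
  · ext n x
    exact (hk' n x (ione n)).trans (hτ₀ n _)
  · ext n x
    exact hk n x _

/-- The two maps define a map on the end faces of X × I, and a homotopy is a lift of their common
image over the inclusion of these faces. -/
lemma isoHomotopic_of_rlp {q : Y ⟶ Z} (hq : (MorphismProperty.monomorphisms SSet.{v}).rlp q)
    {f g : X ⟶ Y} (h : f ≫ q = g ≫ q) : IsoHomotopic f g := by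
  let p : X ⊗ interval.{v} ⟶ X := SemiCartesianMonoidalCategory.fst _ _
  obtain ⟨k, hk₀, hk₁⟩ := exists_glue
    (SemiCartesianMonoidalCategory.fst _ interval.{v} ≫ (faceZero X).ι ≫ p ≫ f)
    (SemiCartesianMonoidalCategory.fst _ interval.{v} ≫ (faceOne X).ι ≫ p ≫ g)
    (fun n v hv₀ hv₁ ↦ (izero_ne_ione n (hv₀.symm.trans hv₁)).elim)
  -- The glued map has a superfluous interval factor, on which it does not depend; it is removed by
  -- restricting to `x₀`.
  have sq : CommSq (CartesianMonoidalCategory.lift (𝟙 _) (SSet.const SSet.coherentIso.x₀) ≫ k)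
      (faceZero X ⊔ faceOne X).ι q (p ≫ f ≫ q) := by
    refine ⟨?_⟩
    ext n ⟨x, hx | hx⟩
    · exact congrArg (q.app n) (hk₀ n x hx _)
    · refine (congrArg (q.app n) (hk₁ n x hx (izero n))).trans ?_
      exact ConcreteCategory.congr_hom (NatTrans.congr_app h.symm n) x.1
  have := hq _ (MorphismProperty.monomorphisms.infer_property (faceZero X ⊔ faceOne X).ι)
  have hl := sq.fac_left
  refine isoHomotopic_iff.2 ⟨sq.lift, fun n x ↦ ?_, fun n x ↦ ?_⟩
  · exact (ConcreteCategory.congr_hom (NatTrans.congr_app hl n)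
      ⟨spair x (izero n), Or.inl rfl⟩).trans (hk₀ _ _ rfl _)
  · exact (ConcreteCategory.congr_hom (NatTrans.congr_app hl n)
      ⟨spair x (ione n), Or.inr rfl⟩).trans (hk₁ _ _ rfl _)

/-- A map that factors as a section of a trivial fibration followed by a trivial fibration is an
equivalence. -/
lemma isQCatEquivalence_of_span {π : Z ⟶ X} {q : Z ⟶ Y} {s : X ⟶ Z}
    (hπ : (MorphismProperty.monomorphisms SSet.{v}).rlp π)
    (hq : (MorphismProperty.monomorphisms SSet.{v}).rlp q) (hs : s ≫ π = 𝟙 X) :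
    IsQCatEquivalence (s ≫ q) := by
  -- Lifting against the inclusion of the empty subcomplex gives a section of q; followed by π it is
  -- the homotopy inverse.
  have := hq (⊥ : Y.Subcomplex).ι (MorphismProperty.monomorphisms.infer_property _)
  have sq : CommSq (SSet.Subcomplex.isInitialBot.to Z) (⊥ : Y.Subcomplex).ι q (𝟙 Y) :=
    ⟨SSet.Subcomplex.isInitialBot.hom_ext _ _⟩
  have ht : sq.lift ≫ q = 𝟙 Y := sq.fac_right
  refine ⟨sq.lift ≫ π, ?_, ?_⟩
  · have h := (isoHomotopic_of_rlp hq (f := 𝟙 Z) (g := q ≫ sq.lift) (by simp)).whisker s π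
    simpa [hs] using h
  · have h := (isoHomotopic_of_rlp hπ (f := π ≫ s) (g := 𝟙 Z) (by simp [hs])).whisker sq.lift q
    simpa using h

end Homotopies

/-! ### Path objects -/

section PathObjects

/-- A simplex of the mapping path space of a map of simplicial sets. -/
@[ext]
structure PathSimplex {X Y : SSet.{v}} (f : X ⟶ Y) (n : SimplexCategoryᵒᵖ) where
  pt : X.obj n
  path : (Functor.functorHom interval.{v} Y).obj n
  path_zero : hev path (𝟙 n) (izero n) = f.app n pt

variable {V X Y : SSet.{v}} (f : X ⟶ Y)

/-- The mapping path space of a map of simplicial sets. -/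
def pathObj : SSet.{v} where
  obj n := PathSimplex f n
  map {n m} θ := ↾fun p ↦
    { pt := X.map θ p.pt
      path := (Functor.functorHom interval.{v} Y).map θ p.path
      path_zero := by
        rw [hev_map, Category.comp_id, ← map_app_apply, ← p.path_zero, map_hev, map_izero,
          Category.id_comp] }
  map_id n := by
    ext p : 3
    refine PathSimplex.ext ?_ ?_
    · exact CategoryTheory.Functor.map_id_apply X n p.pt
    · exact CategoryTheory.Functor.map_id_apply (Functor.functorHom interval.{v} Y) n p.path
  map_comp θ θ' := by
    ext p : 3
    refine PathSimplex.ext ?_ ?_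
    · exact CategoryTheory.Functor.map_comp_apply X θ θ' p.pt
    · exact CategoryTheory.Functor.map_comp_apply (Functor.functorHom interval.{v} Y) θ θ' p.path

namespace pathObj

variable {f}

/-- The origin of a path. -/
def pt {n : SimplexCategoryᵒᵖ} (p : (pathObj f).obj n) : X.obj n := PathSimplex.pt p

/-- The values of a path. -/
def val {n : SimplexCategoryᵒᵖ} (p : (pathObj f).obj n) (j : interval.{v}.obj n) : Y.obj n :=
  hev (PathSimplex.path p) (𝟙 n) j

lemma map_pt {n m : SimplexCategoryᵒᵖ} (θ : n ⟶ m) (p : (pathObj f).obj n) :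
    X.map θ (pt p) = pt ((pathObj f).map θ p) := rfl

lemma map_val {n m : SimplexCategoryᵒᵖ} (θ : n ⟶ m) (p : (pathObj f).obj n)
    (j : interval.{v}.obj n) :
    Y.map θ (val p j) = val ((pathObj f).map θ p) (interval.{v}.map θ j) := by
  refine (map_hev _ _ _ _).trans ?_
  change _ = hev (PathSimplex.path p) (θ ≫ 𝟙 m) _
  rw [Category.id_comp, Category.comp_id]

lemma val_izero {n : SimplexCategoryᵒᵖ} (p : (pathObj f).obj n) :
    val p (izero n) = f.app n (pt p) := PathSimplex.path_zero p

lemma ext_val {n : SimplexCategoryᵒᵖ} {p p' : (pathObj f).obj n} (h : pt p = pt p')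
    (h' : ∀ (m : SimplexCategoryᵒᵖ) (θ : n ⟶ m) (j : interval.{v}.obj m),
      val ((pathObj f).map θ p) j = val ((pathObj f).map θ p') j) : p = p' := by
  refine PathSimplex.ext h (ext_hev fun m θ j ↦ ?_)
  have := h' m θ j
  change hev (PathSimplex.path p) (θ ≫ 𝟙 m) j = hev (PathSimplex.path p') (θ ≫ 𝟙 m) j at this
  rwa [Category.comp_id] at this

/-- Constructor for maps to the mapping path space. -/
def lift (x : V ⟶ X) (γ : V ⊗ interval.{v} ⟶ Y)
    (h : ∀ n (w : V.obj n), pap γ w (izero n) = f.app n (x.app n w)) : V ⟶ pathObj f :=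
  smk (fun {n} w ↦
    ({ pt := x.app n w
       path := ofHev (fun θ j ↦ pap γ (V.map θ w) j)
        (fun θ φ j ↦ by rw [map_pap, ← CategoryTheory.Functor.map_comp_apply])
       path_zero := by
        change pap γ (V.map (𝟙 n) w) (izero n) = _
        rw [CategoryTheory.Functor.map_id_apply, h] } : PathSimplex f n))
    (fun θ w ↦ PathSimplex.ext (map_app_apply x θ w) (ext_hev fun m φ j ↦
      congrArg (fun z ↦ pap γ z j) (CategoryTheory.Functor.map_comp_apply V θ φ w)))

lemma val_lift (x : V ⟶ X) (γ : V ⊗ interval.{v} ⟶ Y) (h) {n : SimplexCategoryᵒᵖ} (w : V.obj n)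
    (j : interval.{v}.obj n) : val ((lift (f := f) x γ h).app n w) j = pap γ w j := by
  change pap γ (V.map (𝟙 n) w) j = _
  rw [CategoryTheory.Functor.map_id_apply]

lemma val_map_lift (x : V ⟶ X) (γ : V ⊗ interval.{v} ⟶ Y) (h) {n m : SimplexCategoryᵒᵖ} (θ : n ⟶ m)
    (w : V.obj n) (j : interval.{v}.obj m) :
    val ((pathObj f).map θ ((lift (f := f) x γ h).app n w)) j = pap γ (V.map θ w) j := by
  rw [map_app_apply, val_lift]

variable (f)

/-- The projection to the origin. -/
def proj : pathObj f ⟶ X := smk pt map_pt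

/-- The evaluation at the end point. -/
def target : pathObj f ⟶ Y :=
  smk (fun p ↦ val p (ione _)) (fun θ p ↦ (map_val θ p _).trans (congrArg _ (map_ione θ)))

/-- The evaluation of paths. -/
def eval : pathObj f ⊗ interval.{v} ⟶ Y := pmk val map_val

/-- The constant paths. -/
def const : X ⟶ pathObj f :=
  lift (𝟙 X) (SemiCartesianMonoidalCategory.fst _ _ ≫ f) (fun _ _ ↦ rfl)

lemma const_proj : const f ≫ proj f = 𝟙 X := rfl

lemma const_target : const f ≫ target f = f := by
  ext n x
  exact val_lift (f := f) (𝟙 X) (SemiCartesianMonoidalCategory.fst _ _ ≫ f) (fun _ _ ↦ rfl) x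
    (ione n)

variable {f}

/-- A lift prescribes paths starting at the images of the given points of X, extending paths already
given over S. This is an instance of homotopy extension in Y. -/
lemma rlp_proj (hY : HasHomotopyExtension Y) :
    (MorphismProperty.monomorphisms SSet.{v}).rlp (proj f) := by
  refine rlp_monomorphisms_of_subcomplex fun V S ↦ ⟨fun {t b} sq ↦ ?_⟩
  have hsq (n) (x : S.toSSet.obj n) : pt (t.app n x) = b.app n x.1 :=
    ConcreteCategory.congr_hom (NatTrans.congr_app sq.w n) x
  obtain ⟨k, hk, hk'⟩ := hY S (b ≫ f) (t ▷ interval.{v} ≫ eval f)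
    (fun n x ↦ (val_izero _).trans (congrArg _ (hsq n x)))
  refine ⟨⟨{
    l := lift b k hk
    fac_left := ?_
    fac_right := rfl }⟩⟩
  ext n x
  refine ext_val (hsq n x).symm fun m θ j ↦ ?_
  refine (val_map_lift b k hk θ x.1 j).trans ?_
  refine (hk' m (S.toSSet.map θ x) j).trans ?_
  exact congrArg (fun z ↦ val z j) (map_app_apply t θ x).symm

/-- A homotopy of paths with prescribed end points b is found by first extending the homotopy of
origins in X and then filling a square in Y. Its sides are the initial paths, the images of the
origins and the end points, and the filling is relative to what is given on S. -/
lemma hasHomotopyLifting_target (hX : HasHomotopyExtension X) (hY : HasHomotopyExtension Y) :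
    HasHomotopyLifting (target f) := by
  intro V S a h b h₀ hb hb'
  obtain ⟨x, hx, hx'⟩ := hX S (a ≫ proj f) (h ≫ proj f) (fun n v ↦ congrArg pt (h₀ n v))
  obtain ⟨k, hk₀, hk₁, hk, hk'⟩ := hY.exists_square S (a ▷ interval.{v} ≫ eval f) (x ≫ f) b
    (pmk (X := S.toSSet ⊗ interval.{v}) (fun p t ↦ val (pap h p.1 t) p.2) (fun θ p t ↦ by
      rw [map_val, map_pap]
      rfl))
    (fun n v ↦ (congrArg (f.app n) (hx n v)).trans (val_izero _).symm) (fun n v ↦ (hb n v).symm)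
    (fun n v u ↦ congrArg (fun z ↦ val z u) (h₀ n v))
    (fun n v t ↦ (val_izero _).trans (congrArg (f.app n) (hx' n v t).symm))
    (fun n v t ↦ hb' n v t)
  -- The filler has the path parameter before the time parameter; they are exchanged because a
  -- homotopy of paths takes time first.
  let δ : (V ⊗ interval.{v}) ⊗ interval.{v} ⟶ Y :=
    pmk (X := V ⊗ interval.{v}) (fun q u ↦ pap k (X := V ⊗ interval.{v}) (spair q.1 u) q.2)
      (fun θ q u ↦ map_pap k θ (spair q.1 u) q.2)
  have hδ (n) (q : (V ⊗ interval.{v}).obj n) : pap δ q (izero n) = f.app n (x.app n q) :=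
    hk₀ n q.1 q.2
  refine ⟨lift x δ hδ, fun n v t ↦ ?_, fun n v ↦ ?_, fun n v t ↦ ?_⟩
  · exact (val_lift x δ hδ _ _).trans (hk₁ n v t)
  · refine ext_val (hx n v) fun m θ u ↦ (val_map_lift x δ hδ θ _ u).trans ?_
    refine Eq.trans ?_ ((hk m (V.map θ v) u).trans ?_)
    · exact congrArg (pap k (X := V ⊗ interval.{v}) (spair (V.map θ v) u)) (map_izero θ)
    · exact congrArg (fun z ↦ val z u) (map_app_apply a θ v).symm
  · refine ext_val (hx' n v t) fun m θ u ↦ (val_map_lift x δ hδ θ _ u).trans ?_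
    refine (hk' m (S.toSSet.map θ v) _ _).trans ?_
    exact congrArg (fun z ↦ val z u) (map_pap h θ v t).symm

/-- The homotopy of end points is extended in Y first and then lifted through the evaluation at the
end point. -/
lemma hasHomotopyExtension (hX : HasHomotopyExtension X) (hY : HasHomotopyExtension Y) :
    HasHomotopyExtension (pathObj f) := by
  intro V S a h h₀
  obtain ⟨b, hb, hb'⟩ := hY S (a ≫ target f) (h ≫ target f)
    (fun n v ↦ congrArg ((target f).app n) (h₀ n v))
  obtain ⟨k, -, hk⟩ := hasHomotopyLifting_target hX hY S a h b h₀ (fun n v ↦ (hb n v).symm)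
    (fun n v j ↦ (hb' n v j).symm)
  exact ⟨k, hk⟩

/-- If g is inverse to f, then g ≫ const f is inverse to the target map. Indeed const f is inverse
to the trivial fibration `proj f`, and evaluation of paths is a homotopy from proj f ≫ f to the
target map. The lifting property then follows from `HasHomotopyLifting.rlp_monomorphisms`. -/
theorem rlp_target (hX : HasHomotopyExtension X) (hY : HasHomotopyExtension Y)
    (hf : IsQCatEquivalence f) :
    (MorphismProperty.monomorphisms SSet.{v}).rlp (target f) := by
  obtain ⟨g, hg, hg'⟩ := hf
  have hP := hasHomotopyExtension (f := f) hX hY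
  refine (hasHomotopyLifting_target hX hY).rlp_monomorphisms hP (g := g ≫ const f) ?_ ?_
  · simpa [const_target] using hg'
  · have h₁ : IsoHomotopic (𝟙 _) (proj f ≫ const f) :=
      isoHomotopic_of_rlp (rlp_proj hY) (by rw [Category.assoc, const_proj]; simp)
    have h₂ : IsoHomotopic (proj f ≫ const f) (proj f ≫ f ≫ g ≫ const f) := by
      simpa using hg.whisker (proj f) (const f)
    have h₃ : IsoHomotopic (proj f ≫ f) (target f) :=
      isoHomotopic_iff.2 ⟨eval f, fun n p ↦ val_izero p, fun n p ↦ rfl⟩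
    have h₄ : IsoHomotopic (proj f ≫ f ≫ g ≫ const f) (target f ≫ g ≫ const f) := by
      simpa using h₃.whisker (𝟙 _) (g ≫ const f)
    exact (h₁.trans hP h₂).trans hP h₄

end pathObj

end PathObjects

/-! ### Hom-spaces have the homotopy extension property -/

section HomSpaces

variable {K : Type u} [Category.{v} K] [SimplicialCategory K]

section Cotensors

variable {U C : SSet.{v}} {B P X : K} {κ : U ⟶ Map P B} (hκ : IsCotensor U B κ)

include hκ

lemma IsCotensor.hom_ext {n : SimplexCategoryᵒᵖ} {x x' : (Map X P).obj n}
    (h : ∀ (m : SimplexCategoryᵒᵖ) (θ : n ⟶ m) (y : U.obj m),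
      scomp ((Map X P).map θ x) (κ.app m y) = scomp ((Map X P).map θ x') (κ.app m y)) : x = x' :=
  ((isIso_iff_bijective _).1 ((NatTrans.isIso_iff_isIso_app _).1 (hκ X) n)).1
    (ext_hev (U := U) (X := Map X B) h)

lemma IsCotensor.map_ext {σ τ : C ⟶ Map X P} (h : ∀ (n : SimplexCategoryᵒᵖ) (c : C.obj n)
    (y : U.obj n), scomp (σ.app n c) (κ.app n y) = scomp (τ.app n c) (κ.app n y)) : σ = τ := by
  ext n c
  refine hκ.hom_ext fun m θ y ↦ ?_
  exact (congrArg (fun z ↦ scomp z (κ.app m y)) (map_app_apply σ θ c)).trans ((h m _ y).trans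
    (congrArg (fun z ↦ scomp z (κ.app m y)) (map_app_apply τ θ c)).symm)

/-- The universal property gives the value on each simplex separately; uniqueness makes these values
natural. -/
lemma IsCotensor.exists_lift (h : U ⊗ C ⟶ Map X B) : ∃ σ : C ⟶ Map X P,
    ∀ (n : SimplexCategoryᵒᵖ) (c : C.obj n) (y : U.obj n),
      scomp (σ.app n c) (κ.app n y) = pap h y c := by
  have key (n : SimplexCategoryᵒᵖ) (c : C.obj n) : ∃ x : (Map X P).obj n,
      ∀ (m : SimplexCategoryᵒᵖ) (θ : n ⟶ m) (y : U.obj m),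
        scomp ((Map X P).map θ x) (κ.app m y) = pap h y (C.map θ c) := by
    obtain ⟨x, hx⟩ := ((isIso_iff_bijective _).1 ((NatTrans.isIso_iff_isIso_app _).1 (hκ X) n)).2
      (ofHev (U := U) (X := Map X B) (fun θ y ↦ pap h y (C.map θ c)) (fun θ φ y ↦ by
        rw [map_pap, CategoryTheory.Functor.map_comp_apply]))
    exact ⟨x, fun m θ y ↦ congrArg (fun z ↦ hev (U := U) (X := Map X B) z θ y) hx⟩
  choose x hx using key
  refine ⟨smk (fun c ↦ x _ c) (fun {n m} θ c ↦ hκ.hom_ext fun l φ y ↦ ?_), fun n c y ↦ ?_⟩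
  · rw [← CategoryTheory.Functor.map_comp_apply, hx, hx, CategoryTheory.Functor.map_comp_apply]
  · have := hx n c n (𝟙 n) y
    rwa [CategoryTheory.Functor.map_id_apply, CategoryTheory.Functor.map_id_apply] at this

lemma IsCotensor.exists_isCotensorMapLeft {V : SSet.{v}} {P' : K} (κ' : V ⟶ Map P' B)
    (i : U ⟶ V) : ∃ f : P' ⟶ P, IsCotensorMapLeft κ κ' i f := by
  obtain ⟨σ, hσ⟩ := hκ.exists_lift (SemiCartesianMonoidalCategory.fst U (𝟙_ _) ≫ i ≫ κ')
  refine ⟨(SSet.unitHomEquiv _).symm (σ.app (op ⦋0⦌) PUnit.unit) |>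
    (SSet.unitHomEquiv (Map P' P)) |> (SimplicialCategory.homEquiv' P' P).symm, ?_⟩
  ext n y
  refine Eq.trans ?_ (hσ n PUnit.unit y)
  refine congrArg (fun z ↦ scomp z (κ.app n y)) ((simplex_symm _ n).trans ?_)
  rw [Equiv.apply_symm_apply]
  exact map_app_apply σ _ _

end Cotensors

lemma isCotensor_of_subsingleton {T : K} (hT : ∀ (X : K) n, Subsingleton ((Map X T).obj n))
    (hT' : ∀ X : K, Nonempty (X ⟶ T)) {U : SSet.{v}} (κ : U ⟶ Map T T) : IsCotensor U T κ := by
  intro X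
  rw [NatTrans.isIso_iff_isIso_app]
  intro n
  rw [isIso_iff_bijective]
  refine ⟨fun x y _ ↦ (hT X n).elim x y, fun z ↦ ⟨simplex (hT' X).some n, ?_⟩⟩
  exact ext_hev (U := U) (X := Map X T) fun m θ y ↦ (hT X m).elim _ _

namespace InfinityCosmos

variable (𝒦 : InfinityCosmos K)

/-- This is the Leibniz axiom for the map from E to a terminal object, whose cotensors are again
terminal, so that the pullback reduces to the cotensor of E by U. -/
lemma isofibration_of_isCotensorMapLeft {U V : SSet.{v}} {E P P' : K} {κ : U ⟶ Map P E}
    {κ' : V ⟶ Map P' E} (hκ : IsCotensor U E κ) (hκ' : IsCotensor V E κ') {i : U ⟶ V} [Mono i]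
    {f : P' ⟶ P} (hf : IsCotensorMapLeft κ κ' i f) : 𝒦.isofibration f := by
  obtain ⟨T, ⟨hT⟩, -, hT'⟩ := 𝒦.exists_terminal
  let c (U : SSet.{v}) : U ⟶ Map T T := smk (fun {n} _ ↦ sid T n) (fun θ _ ↦ map_sid T θ)
  have hc (U : SSet.{v}) : IsCotensor U T (c U) :=
    isCotensor_of_subsingleton hT' (fun X ↦ ⟨hT.from X⟩) _
  have eq {X : K} {U : SSet.{v}} (f g : U ⟶ Map X T) : f = g := by
    ext n x
    exact (hT' X n).elim _ _
  exact 𝒦.isofibration_leibniz i (hT.from E) (𝒦.isofibration_of_isTerminal hT _) hκ' hκ (hc V)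
    (hc U) (iE := f) (iB := 𝟙 T) (pV := hT.from _) (pU := hT.from _) hf (eq _ _) (eq _ _) (eq _ _)
    (Q := P) (fst := 𝟙 P) (snd := hT.from P)
    (IsPullback.of_horiz_isIso ⟨hT.hom_ext _ _⟩) f (Category.comp_id f) (hT.hom_ext _ _)

/-- Extending a homotopy from S to V amounts, by the universal property of cotensors, to lifting the
inclusion of the source of the interval against Map(X, E^V) → Map(X, E^S). This map is an
isofibration of quasi-categories because E^V → E^S is an isofibration. -/
theorem hasHomotopyExtension_map (𝒦 : InfinityCosmos K) (X E : K) : HasHomotopyExtension (Map X E) := by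
  intro V S a h h₀
  obtain ⟨P', κ', hκ'⟩ := 𝒦.hasCotensors V E
  obtain ⟨P, κ, hκ⟩ := 𝒦.hasCotensors S.toSSet E
  obtain ⟨f, hf⟩ := hκ.exists_isCotensorMapLeft κ' S.ι
  have hf' (n) (y : S.toSSet.obj n) : scomp (simplex f n) (κ.app n y) = κ'.app n y.1 :=
    ConcreteCategory.congr_hom (NatTrans.congr_app hf n) y
  have hl := (𝒦.isofibration_map X f (𝒦.isofibration_of_isCotensorMapLeft hκ hκ' hf)).2.1
  obtain ⟨α, hα⟩ := hκ'.exists_lift (SemiCartesianMonoidalCategory.fst V Δ[0] ≫ a)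
  obtain ⟨β, hβ⟩ := hκ.exists_lift h
  have comp_f {n} (x : (Map X P').obj n) (y : S.toSSet.obj n) :
      scomp ((eHomWhiskerLeft SSet.{v} X f).app n x) (κ.app n y) = scomp x (κ'.app n y.1) :=
    (scomp_assoc _ _ _).trans (congrArg (scomp x) (hf' n y))
  have sq : CommSq α (SSet.const SSet.coherentIso.x₀) (eHomWhiskerLeft SSet.{v} X f) β :=
    ⟨hκ.map_ext fun n c y ↦ (comp_f _ y).trans ((hα n c y.1).trans
      ((h₀ n y).symm.trans (hβ n (izero n) y).symm))⟩
  have hl₁ (n) (c) : sq.lift.app n (izero n) = α.app n c :=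
    ConcreteCategory.congr_hom (NatTrans.congr_app sq.fac_left n) c
  have hl₂ (n) (j) : (eHomWhiskerLeft SSet.{v} X f).app n (sq.lift.app n j) = β.app n j :=
    ConcreteCategory.congr_hom (NatTrans.congr_app sq.fac_right n) j
  refine ⟨pmk (fun {n} v j ↦ scomp (sq.lift.app n j) (κ'.app n v)) (fun θ v j ↦ by
    rw [map_scomp, map_app_apply, map_app_apply]), fun n v ↦ ?_, fun n v j ↦ ?_⟩
  · let c : (Δ[0] : SSet.{v}).obj n :=
      (SSet.stdSimplex.isTerminalObj₀.from interval.{v}).app n (izero n)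
    exact (congrArg (fun z ↦ scomp z (κ'.app n v)) (hl₁ n c)).trans (hα n c v)
  · exact (comp_f _ v).symm.trans ((congrArg (fun z ↦ scomp z (κ.app n v)) (hl₂ n j)).trans
      (hβ n j v))

end InfinityCosmos

end HomSpaces

/-! ### Trivial fibrations of weights -/

section TrivialFibrations

/-- Lifts are chosen stage by stage, each compatible with the previous one, and assembled in the
limit. -/
lemma rlp_monomorphisms_tower (F : ℕᵒᵖ ⥤ SSet.{v})
    (hF : ∀ n : ℕ, (MorphismProperty.monomorphisms SSet.{v}).rlp
      (F.map (homOfLE (Nat.le_succ n)).op)) {c : Cone F} (hc : IsLimit c) :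
    (MorphismProperty.monomorphisms SSet.{v}).rlp (c.π.app (op 0)) := by
  intro U V i hi
  refine ⟨fun {t b} sq ↦ ?_⟩
  have key (n : ℕ) (l : V ⟶ F.obj (op n)) (hl : i ≫ l = t ≫ c.π.app (op n)) :
      ∃ l' : V ⟶ F.obj (op (n + 1)), i ≫ l' = t ≫ c.π.app (op (n + 1)) ∧
        l' ≫ F.map (homOfLE (Nat.le_succ n)).op = l := by
    have := hF n i hi
    have sq' : CommSq (t ≫ c.π.app (op (n + 1))) i (F.map (homOfLE (Nat.le_succ n)).op) l :=
      ⟨by rw [hl, Category.assoc, c.w]⟩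
    exact ⟨sq'.lift, sq'.fac_left, sq'.fac_right⟩
  choose next hnext hnext' using key
  let L (n : ℕ) : { l : V ⟶ F.obj (op n) // i ≫ l = t ≫ c.π.app (op n) } :=
    Nat.rec ⟨b, sq.w.symm⟩ (fun n l ↦ ⟨next n l.1 l.2, hnext n l.1 l.2⟩) n
  let α : (Functor.const ℕᵒᵖ).obj V ⟶ F := NatTrans.ofOpSequence (fun n ↦ (L n).1)
    (fun n ↦ (Category.id_comp _).trans (hnext' n (L n).1 (L n).2).symm)
  exact ⟨⟨{
    l := hc.lift ⟨V, α⟩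
    fac_left := hc.hom_ext fun j ↦ by
      rw [Category.assoc, hc.fac]
      exact (L j.unop).2
    fac_right := hc.fac _ _ }⟩⟩

lemma rlp_monomorphisms_product {J : Type v} {X Y : J → SSet.{v}} (p : ∀ j, X j ⟶ Y j)
    (hp : ∀ j, (MorphismProperty.monomorphisms SSet.{v}).rlp (p j)) {c : Fan X} (hc : IsLimit c)
    {d : Fan Y} (hd : IsLimit d) (q : c.pt ⟶ d.pt) (hq : ∀ j, q ≫ d.proj j = c.proj j ≫ p j) :
    (MorphismProperty.monomorphisms SSet.{v}).rlp q := by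
  intro U V i hi
  refine ⟨fun {t b} sq ↦ ?_⟩
  have hp' (j) := hp j i hi
  have sq' (j : J) : CommSq (t ≫ c.proj j) i (p j) (b ≫ d.proj j) :=
    ⟨by rw [Category.assoc, ← hq, ← Category.assoc, sq.w, Category.assoc]⟩
  have hl (j : J) : hc.lift (Fan.mk V fun j ↦ (sq' j).lift) ≫ c.proj j = (sq' j).lift :=
    hc.fac _ ⟨j⟩
  refine ⟨⟨{
    l := hc.lift (Fan.mk V fun j ↦ (sq' j).lift)
    fac_left := hc.hom_ext fun j ↦ (Category.assoc _ _ _).trans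
      ((congrArg (i ≫ ·) (hl j.as)).trans (sq' j.as).fac_left)
    fac_right := hd.hom_ext fun j ↦ (Category.assoc _ _ _).trans
      ((congrArg (_ ≫ ·) (hq j.as)).trans ((Category.assoc _ _ _).symm.trans
        ((congrArg (· ≫ p j.as) (hl j.as)).trans (sq' j.as).fac_right))) }⟩⟩

/-- The class of trivial fibrations of simplicial sets. -/
def trivialFibrationClass : FibrationClass.{v} SSet.{v} where
  fib := (MorphismProperty.monomorphisms SSet.{v}).rlp
  -- Simplicial sets have all limits, so no representability has to be tracked.
  obj := ⊤
  respectsIso := inferInstance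
  objIso := inferInstance
  source _ _ := trivial
  baseChange h hp _ := MorphismProperty.of_isPullback h hp
  product := rlp_monomorphisms_product
  tower F _ := rlp_monomorphisms_tower F

variable {A : Type v} [EnrichedCategory SSet.{v} A]

/-- The components of a morphism of weights. -/
def wapp {F G : Weight A} (φ : F ⟶ G) (a : A) : F.obj a ⟶ G.obj a :=
  smk (fun w ↦ wev φ w) (fun θ w ↦ map_wev φ θ w)

/-- The map `Map (-, F) ⟶ Map (-, G)` given by a morphism of weights `F ⟶ G`. -/
abbrev mapToMap {F G : Weight A} (φ : F ⟶ G) : mapTo F ⟶ mapTo G :=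
  (eHomFunctor SSet.{v} (Weight A)).flip.map φ

/-! ### Transposition for maps into Map(U × Map(a, -), G). -/

section Curry

variable {T U V : SSet.{v}} {a : A} {G : Weight A}

/-- The map adjoint to a map to `Map (U × Map a -, G)`. -/
def uncurryRep (σ : T ⟶ Map (tensorRep U a) G) : T ⊗ U ⟶ G.obj a :=
  pmk (fun {n} t y ↦ SNat.ev (σ.app n t) (𝟙 n) (tpair y (sid a n))) (fun {n m} θ t y ↦ by
    rw [SNat.map_ev, map_tpair, map_sid, ← map_app_apply, SNat.ev_map, Category.id_comp,
      Category.comp_id])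

/-- The map adjoint to a map from a product. -/
def curryRep (h : T ⊗ U ⟶ G.obj a) : T ⟶ Map (tensorRep U a) G :=
  smk (fun {n} t ↦ (tensorRepEquiv U a G n).symm (ofHev (fun θ y ↦ pap h (T.map θ t) y)
    (fun θ φ y ↦ by rw [map_pap, CategoryTheory.Functor.map_comp_apply])))
    (fun {n m} θ t ↦ (tensorRepEquiv U a G m).injective (by
      rw [Equiv.apply_symm_apply]
      refine ext_hev fun l φ y ↦ ?_
      refine (hev_tensorRepEquiv _ φ y).trans ((SNat.ev_map _ _ _ _).trans ?_)
      refine (hev_tensorRepEquiv _ (θ ≫ φ) y).symm.trans ?_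
      rw [Equiv.apply_symm_apply]
      exact congrArg (fun z ↦ pap h z y) (CategoryTheory.Functor.map_comp_apply T θ φ t)))

lemma uncurryRep_curryRep (h : T ⊗ U ⟶ G.obj a) : uncurryRep (curryRep h) = h :=
  ext_pap fun n t y ↦ by
    refine (hev_tensorRepEquiv (U := U) (a := a) (G := G) ((curryRep h).app n t) (𝟙 n) y).symm.trans
      ?_
    refine (congrArg (fun z ↦ hev z (𝟙 n) y) (Equiv.apply_symm_apply _ _)).trans ?_
    exact congrArg (fun z ↦ pap h z y) (CategoryTheory.Functor.map_id_apply T n t)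

lemma uncurryRep_injective {σ τ : T ⟶ Map (tensorRep U a) G} (h : uncurryRep σ = uncurryRep τ) :
    σ = τ := by
  ext n t
  refine (tensorRepEquiv U a G n).injective (ext_hev fun m θ y ↦ ?_)
  have := congrArg (fun k ↦ pap k (T.map θ t) y) h
  change SNat.ev (σ.app m (T.map θ t)) (𝟙 m) _ = SNat.ev (τ.app m (T.map θ t)) (𝟙 m) _ at this
  rwa [← map_app_apply, ← map_app_apply, SNat.ev_map, SNat.ev_map, Category.comp_id] at this

lemma uncurryRep_comp_left {T' : SSet.{v}} (f : T' ⟶ T) (σ : T ⟶ Map (tensorRep U a) G) :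
    uncurryRep (f ≫ σ) = f ▷ U ≫ uncurryRep σ := rfl

lemma uncurryRep_comp_map (i : U ⟶ V) (σ : T ⟶ Map (tensorRep V a) G) :
    uncurryRep (σ ≫ (mapTo G).map (tensorRepMap i a).op) = T ◁ i ≫ uncurryRep σ :=
  ext_pap fun n t y ↦ ev_mapTo_map G (tensorRepMap i a) (σ.app n t) (𝟙 n) (tpair y (sid a n))

lemma uncurryRep_comp_mapToMap {H : Weight A} (φ : G ⟶ H) (σ : T ⟶ Map (tensorRep U a) G) :
    uncurryRep (σ ≫ (mapToMap φ).app (op (tensorRep U a))) = uncurryRep σ ≫ wapp φ a :=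
  ext_pap fun n t y ↦ by
    change SNat.ev (scomp (σ.app n t) (simplex φ n)) (𝟙 n) (tpair y (sid a n)) = _
    rw [SNat.ev_scomp, ev_simplex]
    rfl

end Curry

/-- Transposition turns this into lifting the union of S × V and T × R into T × V against the
component of φ at a; the two prescribed maps glue because the union is a pushout. -/
lemma exists_lift_rep {F G : Weight A} {φ : F ⟶ G} {a : A}
    (hφ : (MorphismProperty.monomorphisms SSet.{v}).rlp (wapp φ a)) {T V : SSet.{v}}
    (S : T.Subcomplex) (R : V.Subcomplex)
    {l : (S : SSet.{v}) ⟶ Map (tensorRep V a) F} {r₁ : T ⟶ Map (tensorRep (R : SSet.{v}) a) F}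
    {r₂ : T ⟶ Map (tensorRep V a) G}
    (h₁ : l ≫ (mapTo F).map (tensorRepMap R.ι a).op = S.ι ≫ r₁)
    (h₂ : l ≫ (mapToMap φ).app (op (tensorRep V a)) = S.ι ≫ r₂)
    (h₃ : r₁ ≫ (mapToMap φ).app (op (tensorRep (R : SSet.{v}) a)) =
      r₂ ≫ (mapTo G).map (tensorRepMap R.ι a).op) :
    ∃ d : T ⟶ Map (tensorRep V a) F, S.ι ≫ d = l ∧
      d ≫ (mapTo F).map (tensorRepMap R.ι a).op = r₁ ∧
      d ≫ (mapToMap φ).app (op (tensorRep V a)) = r₂ := by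
  have h₁' : _ ◁ R.ι ≫ uncurryRep l = S.ι ▷ _ ≫ uncurryRep r₁ :=
    (uncurryRep_comp_map R.ι l).symm.trans (congrArg uncurryRep h₁)
  have h₂' : uncurryRep l ≫ wapp φ a = S.ι ▷ _ ≫ uncurryRep r₂ :=
    (uncurryRep_comp_mapToMap φ l).symm.trans (congrArg uncurryRep h₂)
  have h₃' : uncurryRep r₁ ≫ wapp φ a = _ ◁ R.ι ≫ uncurryRep r₂ :=
    (uncurryRep_comp_mapToMap φ r₁).symm.trans
      ((congrArg uncurryRep h₃).trans (uncurryRep_comp_map R.ι r₂))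
  have po := SSet.Subcomplex.unionProd.isPushout S R
  have sq : CommSq (po.desc (uncurryRep r₁) (uncurryRep l) h₁'.symm) (S.unionProd R).ι (wapp φ a)
      (uncurryRep r₂) := by
    refine ⟨po.hom_ext ?_ ?_⟩
    · rw [po.inl_desc_assoc, h₃', ← Category.assoc, SSet.Subcomplex.unionProd.ι₁_ι]
    · rw [po.inr_desc_assoc, h₂', ← Category.assoc, SSet.Subcomplex.unionProd.ι₂_ι]
  have := hφ _ (MorphismProperty.monomorphisms.infer_property (S.unionProd R).ι)
  refine ⟨curryRep sq.lift, uncurryRep_injective ?_, uncurryRep_injective ?_,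
    uncurryRep_injective ?_⟩
  · rw [uncurryRep_comp_left, uncurryRep_curryRep, ← SSet.Subcomplex.unionProd.ι₂_ι,
      Category.assoc, sq.fac_left, po.inr_desc]
  · refine (uncurryRep_comp_map R.ι _).trans ?_
    rw [uncurryRep_curryRep, ← SSet.Subcomplex.unionProd.ι₁_ι,
      Category.assoc, sq.fac_left, po.inl_desc]
  · refine (uncurryRep_comp_mapToMap φ _).trans ?_
    rw [uncurryRep_curryRep, sq.fac_right]

lemma rlp_leibniz_cell {F G : Weight A} {φ : F ⟶ G} {a : A}
    (hφ : (MorphismProperty.monomorphisms SSet.{v}).rlp (wapp φ a)) {V : SSet.{v}}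
    (R : V.Subcomplex) :
    (MorphismProperty.monomorphisms SSet.{v}).rlp (leibniz (mapToMap φ) (tensorRepMap R.ι a)) := by
  refine rlp_monomorphisms_of_subcomplex fun T S ↦ ⟨fun {l r} sq ↦ ?_⟩
  have h₁ : l ≫ (mapTo F).map (tensorRepMap R.ι a).op = S.ι ≫ r ≫ pullback.fst _ _ :=
    (congrArg (l ≫ ·) (leibniz_fst (mapToMap φ) (tensorRepMap R.ι a))).symm.trans
      ((Category.assoc _ _ _).symm.trans ((sq.w =≫ pullback.fst _ _).trans (Category.assoc _ _ _)))
  have h₂ : l ≫ (mapToMap φ).app (op (tensorRep V a)) = S.ι ≫ r ≫ pullback.snd _ _ :=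
    (congrArg (l ≫ ·) (leibniz_snd (mapToMap φ) (tensorRepMap R.ι a))).symm.trans
      ((Category.assoc _ _ _).symm.trans ((sq.w =≫ pullback.snd _ _).trans (Category.assoc _ _ _)))
  have h₃ : (r ≫ pullback.fst _ _) ≫ (mapToMap φ).app _ =
      (r ≫ pullback.snd _ _) ≫ (mapTo G).map (tensorRepMap R.ι a).op := by
    rw [Category.assoc, pullback.condition, Category.assoc]
  obtain ⟨d, hd, hd₁, hd₂⟩ := exists_lift_rep hφ S R h₁ h₂ h₃
  exact ⟨⟨{
    l := d
    fac_left := hd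
    fac_right := pullback.hom_ext
      ((Category.assoc _ _ _).trans ((congrArg (d ≫ ·) (leibniz_fst _ _)).trans hd₁))
      ((Category.assoc _ _ _).trans ((congrArg (d ≫ ·) (leibniz_snd _ _)).trans hd₂)) }⟩⟩

end TrivialFibrations

/-! ### Flexible weights preserve pointwise equivalences. -/

section Equivalences

variable {A : Type v} [EnrichedCategory SSet.{v} A]

lemma isIso_mapToMap_of_isEmpty {F G : Weight A} (φ : F ⟶ G) {V : Weight A}
    (hV : ∀ a n, IsEmpty ((V.obj a).obj n)) : IsIso ((mapToMap φ).app (op V)) := by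
  rw [NatTrans.isIso_iff_isIso_app]
  intro n
  rw [isIso_iff_bijective]
  refine ⟨fun σ τ _ ↦ SNat.ext_ev (W := V) (G := F) fun a m _ w ↦ ((hV a m).false w).elim,
    fun τ ↦ ⟨SNat.ofEv (W := V) (G := F) (fun {a m} _ w ↦ ((hV a m).false w).elim)
      (fun {a m _} _ _ w ↦ ((hV a m).false w).elim) (fun {a _ m} _ w _ ↦ ((hV a m).false w).elim),
      SNat.ext_ev (W := V) (G := G) fun a m _ w ↦ ((hV a m).false w).elim⟩⟩

/-- The cell induction applies with trivial fibrations of simplicial sets as the fibrations.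
Starting from the empty weight, the target of the Leibniz map is Map(W, G). -/
theorem rlp_map_of_isFlexible {F G : Weight A} {φ : F ⟶ G}
    (hφ : ∀ a, (MorphismProperty.monomorphisms SSet.{v}).rlp (wapp φ a)) {W : Weight A}
    (hW : IsFlexible W) :
    (MorphismProperty.monomorphisms SSet.{v}).rlp (eHomWhiskerLeft SSet.{v} W φ) := by
  obtain ⟨V, i, hV, -, hi⟩ := hW
  have h : (MorphismProperty.monomorphisms SSet.{v}).rlp (leibniz (mapToMap φ) i) :=
    fib_leibniz_cellComplex (mapToMap φ) trivialFibrationClass (fun _ _ _ hc ↦ by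
      obtain ⟨n, a⟩ := hc
      exact rlp_leibniz_cell (hφ a) _) hi trivial
  have := isIso_mapToMap_of_isEmpty φ hV
  have h' : leibniz (mapToMap φ) i ≫ pullback.snd _ _ = eHomWhiskerLeft SSet.{v} W φ :=
    leibniz_snd _ _
  rw [← h']
  exact (MorphismProperty.cancel_right_of_respectsIso _ _ _).2 h

section PathWeight

variable {F G : Weight A} (φ : F ⟶ G)

/-- The mapping path space of a morphism of weights. -/
def pathWeight : Weight A :=
  ⟨ofAction (fun a ↦ pathObj (wapp φ a))
    (fun {a b n} p x ↦ (show PathSimplex (wapp φ b) n from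
      { pt := act F (PathSimplex.pt p) x
        path := act (cotensor interval.{v} G) (a := a) (PathSimplex.path p) x
        path_zero := by
          refine (cev_act (U := interval.{v}) (G := G) (a := a) (PathSimplex.path p) x (𝟙 n)
            (izero n)).trans ?_
          refine Eq.trans ?_ (wev_act φ (PathSimplex.pt p) x).symm
          rw [CategoryTheory.Functor.map_id_apply]
          exact congrArg (fun z ↦ act G z x) (PathSimplex.path_zero p) }))
    (fun θ p x ↦ PathSimplex.ext (map_act F θ _ x)
      (map_act (cotensor interval.{v} G) θ (PathSimplex.path p) x))
    (fun p ↦ PathSimplex.ext (act_sid F _) (act_sid (cotensor interval.{v} G) (PathSimplex.path p)))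
    (fun p x y ↦ PathSimplex.ext (act_scomp F _ x y)
      (act_scomp (cotensor interval.{v} G) (PathSimplex.path p) x y))⟩

lemma pt_act_pathWeight {a b : A} {n : SimplexCategoryᵒᵖ} (p : (pathObj (wapp φ a)).obj n)
    (x : (Map a b).obj n) :
    pathObj.pt (f := wapp φ b) (act (pathWeight φ) p x) = act F (pathObj.pt p) x :=
  congrArg pathObj.pt (act_ofAction (fun a ↦ pathObj (wapp φ a)) _ _ _ _ p x)

lemma val_act_pathWeight {a b : A} {n : SimplexCategoryᵒᵖ} (p : (pathObj (wapp φ a)).obj n)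
    (x : (Map a b).obj n) (j : interval.{v}.obj n) :
    pathObj.val (f := wapp φ b) (act (pathWeight φ) p x) j = act G (pathObj.val p j) x := by
  refine (congrArg (fun z ↦ pathObj.val z j)
    (act_ofAction (fun a ↦ pathObj (wapp φ a)) _ _ _ _ p x)).trans ?_
  refine (cev_act (U := interval.{v}) (G := G) (a := a) (PathSimplex.path p) x (𝟙 n) j).trans ?_
  rw [CategoryTheory.Functor.map_id_apply]
  rfl

/-- The projection of the mapping path space to the source. -/
def pathWeightProj : pathWeight φ ⟶ F :=
  ofWev (W := pathWeight φ) (fun {a _} p ↦ pathObj.pt (f := wapp φ a) p) (fun _ _ ↦ rfl)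
    (fun p x ↦ pt_act_pathWeight φ p x)

/-- The projection of the mapping path space to the target. -/
def pathWeightTarget : pathWeight φ ⟶ G :=
  ofWev (W := pathWeight φ) (fun {a _} p ↦ (pathObj.target (wapp φ a)).app _ p)
    (fun {a _ _} θ p ↦ map_app_apply (pathObj.target (wapp φ a)) θ p)
    (fun p x ↦ val_act_pathWeight φ p x _)

/-- The constant paths. -/
def pathWeightConst : F ⟶ pathWeight φ :=
  ofWev (G := pathWeight φ) (fun {a _} w ↦ (pathObj.const (wapp φ a)).app _ w)
    (fun {a _ _} θ p ↦ map_app_apply (pathObj.const (wapp φ a)) θ p)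
    (fun {a b n} w x ↦ by
      refine pathObj.ext_val (f := wapp φ b) (pt_act_pathWeight φ
        ((pathObj.const (wapp φ a)).app n w) x).symm fun m θ j ↦ ?_
      have h {c : A} (w : (F.obj c).obj n) : pathObj.val ((pathObj (wapp φ c)).map θ
          ((pathObj.const (wapp φ c)).app n w)) j = wev φ ((F.obj c).map θ w) :=
        pathObj.val_map_lift _ _ _ θ w j
      refine (h _).trans ?_
      rw [map_act, wev_act]
      refine Eq.trans ?_ ((congrArg (fun z ↦ pathObj.val (f := wapp φ b) z j)
        (map_act (pathWeight φ) θ ((pathObj.const (wapp φ a)).app n w) x)).trans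
          (val_act_pathWeight φ _ _ _)).symm
      exact congrArg (fun z ↦ act G z _) (h w).symm)

lemma pathWeightConst_proj : pathWeightConst φ ≫ pathWeightProj φ = 𝟙 F :=
  hom_ext_wev fun _ _ _ ↦ rfl

lemma pathWeightConst_target : pathWeightConst φ ≫ pathWeightTarget φ = φ :=
  hom_ext_wev fun a n w ↦
    ConcreteCategory.congr_hom (NatTrans.congr_app (pathObj.const_target (wapp φ a)) n) w

end PathWeight

/-- Factoring φ through its mapping path space leaves only pointwise trivial fibrations and a
section, and Map(W, -) respects both. -/
theorem isQCatEquivalence_map_of_isFlexible {F G : Weight A} {φ : F ⟶ G}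
    (hF : ∀ a, HasHomotopyExtension (F.obj a)) (hG : ∀ a, HasHomotopyExtension (G.obj a))
    (hφ : ∀ a, IsQCatEquivalence (wapp φ a)) {W : Weight A} (hW : IsFlexible W) :
    IsQCatEquivalence (eHomWhiskerLeft SSet.{v} W φ) := by
  have h₁ := rlp_map_of_isFlexible (φ := pathWeightProj φ)
    (fun a ↦ pathObj.rlp_proj (f := wapp φ a) (hG a)) hW
  have h₂ := rlp_map_of_isFlexible (φ := pathWeightTarget φ)
    (fun a ↦ pathObj.rlp_target (hF a) (hG a) (hφ a)) hW
  have h := isQCatEquivalence_of_span h₁ h₂ (s := eHomWhiskerLeft SSet.{v} W (pathWeightConst φ))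
    (by rw [← eHomWhiskerLeft_comp, pathWeightConst_proj, eHomWhiskerLeft_id])
  rwa [← eHomWhiskerLeft_comp, pathWeightConst_target] at h

lemma IsQCatEquivalence.of_isIso_comm {X Y X' Y' : SSet.{v}} {f : X ⟶ Y} {f' : X' ⟶ Y'}
    (hf : IsQCatEquivalence f) (s : X' ⟶ X) (t : Y' ⟶ Y) [IsIso s] [IsIso t]
    (w : f' ≫ t = s ≫ f) : IsQCatEquivalence f' := by
  obtain ⟨g, hg, hg'⟩ := hf
  obtain rfl : f' = s ≫ f ≫ inv t := by rw [← Category.assoc, ← w]; simp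
  refine ⟨t ≫ g ≫ inv s, ?_, ?_⟩
  · simpa using hg.whisker s (inv s)
  · simpa using hg'.whisker t (inv t)

variable {K : Type u} [Category.{v} K] [SimplicialCategory K]

lemma coneHom_app {F : SFun A K} {W : Weight A} {L : K} (Λ : W ⟶ homInto F L) (x : Plex K) :
    (coneHom Λ).app x = (comparison Λ x.pt).app x.dim := rfl

lemma conePresheafMap_app_app {F G : SFun A K} (κ : F ⟶ G) (W : (Weight A)ᵒᵖ) (x : Plex K) :
    ((conePresheafMap κ).app W).app x =
      (eHomWhiskerLeft SSet.{v} W.unop (homIntoPostMap κ x.pt)).app x.dim := rfl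

lemma eYoneda_map_app {L M : K} (p : L ⟶ M) (x : Plex K) :
    ((eYoneda K).map p).app x = (eHomWhiskerLeft SSet.{v} x.pt p).app x.dim := rfl

lemma IsInducedByDiagram.comparison_comp {F G : SFun A K} {κ : F ⟶ G} {W : Weight A} {L M : K}
    {Λ : W ⟶ homInto F L} {Γ : W ⟶ homInto G M} {f : L ⟶ M} (hf : IsInducedByDiagram Λ Γ κ f)
    (Z : K) : eHomWhiskerLeft SSet.{v} Z f ≫ comparison Γ Z =
      comparison Λ Z ≫ eHomWhiskerLeft SSet.{v} W (homIntoPostMap κ Z) := by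
  refine NatTrans.ext (funext fun n ↦ ?_)
  have h := NatTrans.congr_app ((isInducedByDiagram_iff _ _ _ _).1 hf) (⟨Z, n⟩ : Plex K)
  rw [NatTrans.comp_app, NatTrans.comp_app, coneHom_app, coneHom_app, conePresheafMap_app_app,
    eYoneda_map_app] at h
  exact h

lemma wapp_homIntoPostMap {F G : SFun A K} (κ : F ⟶ G) (Z : K) (a : A) :
    wapp (homIntoPostMap κ Z) a = eHomWhiskerLeft SSet.{v} Z (component κ a) := by
  ext n x
  exact wev_homIntoPostMap κ Z x

/-- For each Z, the limit cones identify Map(Z, f) with Map(W, -) applied to the map of weights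
Map(Z, F -) → Map(Z, G -). Its components are equivalences by hypothesis, and its values have
homotopy extension in any ∞-cosmos. -/
theorem InfinityCosmos.isEquivalence_of_isInducedByDiagram (𝒦 : InfinityCosmos K) {F G : SFun A K}
    {κ : F ⟶ G} (hκ : ∀ a, IsEquivalence (component κ a)) {W : Weight A} (hW : IsFlexible W)
    {L M : K} {Λ : W ⟶ homInto F L} {Γ : W ⟶ homInto G M} (hΛ : IsWeightedLimit Λ)
    (hΓ : IsWeightedLimit Γ) {f : L ⟶ M} (hf : IsInducedByDiagram Λ Γ κ f) :
    IsEquivalence f := fun Z ↦ by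
  have := hΛ Z
  have := hΓ Z
  refine (isQCatEquivalence_map_of_isFlexible (φ := homIntoPostMap κ Z)
    (fun a ↦ 𝒦.hasHomotopyExtension_map Z (F.obj a))
    (fun a ↦ 𝒦.hasHomotopyExtension_map Z (G.obj a)) (fun a ↦ ?_) hW).of_isIso_comm
    (comparison Λ Z) (comparison Γ Z) (hf.comparison_comp Z)
  rw [wapp_homIntoPostMap]
  exact hκ a Z

end Equivalences

end InfCosmos

end

/-! ### The proposition. -/

open CategoryTheory Opposite InfCosmos in
theorem mainTheorem7 {K : Type u} [Category.{v} K] [SimplicialCategory K] (𝒦 : InfinityCosmos K)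
    {A : Type v} [EnrichedCategory SSet.{v} A] :
    -- existence of flexible weighted limits
    (∀ (F : SFun A K) (W : Weight A), IsFlexible W →
      ∃ (L : K) (Λ : W ⟶ homInto F L), IsWeightedLimit Λ) ∧
    -- projective cell complexes between flexible weights induce isofibrations
    (∀ (F : SFun A K) (W W' : Weight A) (i : W ⟶ W'),
      IsFlexible W → IsFlexible W' → IsProjectiveCellComplex i →
      ∀ (L L' : K) (Λ : W ⟶ homInto F L) (Λ' : W' ⟶ homInto F L'),
        IsWeightedLimit Λ → IsWeightedLimit Λ' →
        (∃! f : L' ⟶ L, IsInducedByWeight Λ Λ' i f) ∧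
        ∀ f : L' ⟶ L, IsInducedByWeight Λ Λ' i f → 𝒦.isofibration f) ∧
    -- any choice of the limits extends to a simplicial bifunctor,
    -- which carries projective cell complexes to isofibrations
    (∀ (L : (Flex A)ᵒᵖ × SFun A K → K)
      (Λ : ∀ x : (Flex A)ᵒᵖ × SFun A K, x.1.unop.obj ⟶ homInto x.2 (L x)),
      (∀ x, IsWeightedLimit (Λ x)) →
      ∃ P : EnrichedFunctor SSet.{v} ((Flex A)ᵒᵖ × SFun A K) K,
        ExtendsLimits L Λ P ∧
        ∀ (F : SFun A K) (W W' : Flex A) (i : W.obj ⟶ W'.obj), IsProjectiveCellComplex i →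
          𝒦.isofibration (bifunctorMapWeight P i F)) ∧
    -- pointwise equivalences, isofibrations and trivial fibrations
    (∀ (F G : SFun A K) (κ : F ⟶ G) (W : Weight A), IsFlexible W →
      ∀ (L M : K) (Λ : W ⟶ homInto F L) (Γ : W ⟶ homInto G M),
        IsWeightedLimit Λ → IsWeightedLimit Γ →
        (∃! f : L ⟶ M, IsInducedByDiagram Λ Γ κ f) ∧
        ∀ f : L ⟶ M, IsInducedByDiagram Λ Γ κ f →
          ((∀ a, IsEquivalence (component κ a)) → IsEquivalence f) ∧
          ((∀ a, 𝒦.isofibration (component κ a)) → 𝒦.isofibration f) ∧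
          ((∀ a, 𝒦.trivialFibration (component κ a)) → 𝒦.trivialFibration f)) := by
  refine ⟨fun F W hW ↦ 𝒦.exists_isWeightedLimit F hW,
    fun F W W' i _ _ hi L L' Λ Λ' hΛ hΛ' ↦ ⟨existsUnique_isInducedByWeight hΛ Λ' i,
      fun f hf ↦ 𝒦.isofibration_of_isInducedByWeight hi hΛ hΛ' hf⟩,
    fun L Λ hΛ ↦ ⟨limitBifunctor hΛ, extendsLimits_limitBifunctor hΛ, fun F W W' i hi ↦
      𝒦.isofibration_bifunctorMapWeight hΛ hi F⟩,
    fun F G κ W hW L M Λ Γ hΛ hΓ ↦ ⟨existsUnique_isInducedByDiagram Λ hΓ κ, fun f hf ↦ ?_⟩⟩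
  have h₁ (h : ∀ a, IsEquivalence (component κ a)) : IsEquivalence f :=
    𝒦.isEquivalence_of_isInducedByDiagram h hW hΛ hΓ hf
  have h₂ (h : ∀ a, 𝒦.isofibration (component κ a)) : 𝒦.isofibration f :=
    𝒦.isofibration_of_isInducedByDiagram h hW hΛ hΓ hf
  exact ⟨h₁, h₂, fun h ↦ ⟨h₂ fun a ↦ (h a).1, h₁ fun a ↦ (h a).2⟩⟩
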